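/- Let $\gamma>-3$, $0<s<1$, $K\ge 1$, and let $\phi$ be a smooth radial function on $\mathbb{R}^3$ with $0\le\phi\le1$, $\phi(x)=1$ for $|x|\le \frac34$ and $\phi(x)=0$ for $|x|>\frac43$; write $\phi(r)$ for the value of $\phi$ on $|x|=r$. Let $b\ge0$ be a measurable function of $\cos\theta$, supported in $0\le\theta\le\frac{\pi}{2}$, with $K^{-1}\theta^{-1-2s}\le \sin\theta\, b(\cos\theta)\le K\theta^{-1-2s}$ for $0<\theta\le\frac\pi2$, and for $0<\epsilon\le\frac{\sqrt2}{2}$ let $b^\epsilon(\cos\theta)=b(\cos\theta)\bigl(1-\phi(\sin\tfrac\theta2/\epsilon)\bigr)$. For $v,v_*\in\mathbb{R}^3$ and $\sigma\in\mathbb{S}^2$ put $v'=\frac{v+v_*}{2}+\frac{|v-v_*|}{2}\sigma$, $v'_*=\frac{v+v_*}{2}-\frac{|v-v_*|}{2}\sigma$, $\cos\theta=\frac{v-v_*}{|v-v_*|}\cdot\sigma$, and, for an angular function $\beta$, $$Q_\beta(g,h)(v)=\int_{\mathbb{R}^3}\int_{\mathbb{S}^2}|v-v_*|^\gamma\beta(\cos\theta)\bigl(g(v'_*)h(v')-g(v_*)h(v)\bigr)\,d\sigma\,dv_*,\qquad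 \Gamma_\beta(g,h)=\mu^{-1/2}Q_\beta(\mu^{1/2}g,\mu^{1/2}h),$$ where $\mu(v)=(2\pi)^{-3/2}e^{-|v|^2/2}$. Let $\Gamma^\epsilon=\Gamma_{b^\epsilon}$ be the cutoff operator and let $\Gamma$ be the non-cutoff operator, defined as the principal value at $\theta=0$, that is, as the limit of $\Gamma_{b\mathbf 1_{\theta\ge\delta}}$ as $\delta\to0^+$: pointwise in $v$ for Schwartz functions $g,h$, and in the weak form $\langle\Gamma(g,h),f\rangle_v=\lim_{\delta\to0^+}\langle\Gamma_{b\mathbf 1_{\theta\ge\delta}}(g,h),f\rangle_v$ in general. Here $\langle F,f\rangle_v=\int_{\mathbb{R}^3}Ff\,dv$ and functions are real-valued. With $\langle v\rangle=(1+|v|^2)^{1/2}$ let $|f|_{L^2_l}=|\langle\cdot\rangle^lf|_{L^2}$, $L^2=L^2_0$, and $|f|_{H^2_l}=|\langle D\rangle^2\langle\cdot\rangle^lf|_{L^2}$, where $\langle D\rangle^2=1-\Delta$. Then there is a constant $C>0$, depending only on $\gamma,s,K$ and $\phi$, such that for all such $b$, all $0<\epsilon\le\frac{\sqrt2}{2}$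 and all $g\in L^2$, $h\in H^2_{\gamma/2+2}$, $f\in L^2_{\gamma/2}$: the integrals over $(v,v_*,\sigma)$ defining $\langle\Gamma^\epsilon(g,h),f\rangle_v$ and $\langle\Gamma_{b\mathbf 1_{\theta\ge\delta}}(g,h),f\rangle_v$ ($\delta>0$) converge absolutely, the limit defining $\langle\Gamma(g,h),f\rangle_v$ exists, and $$\bigl|\langle(\Gamma-\Gamma^\epsilon)(g,h),f\rangle_v\bigr|\le C\,\epsilon^{2-2s}\,|g|_{L^2}\,|h|_{H^2_{\gamma/2+2}}\,|f|_{L^2_{\gamma/2}}.$$ Moreover, for Schwartz functions $g,h,f$ the limit defining $\Gamma(g,h)(v)$ exists for every $v\in\mathbb{R}^3$, $\Gamma(g,h)f$ is integrable, and $\langle\Gamma(g,h),f\rangle_v=\int_{\mathbb{R}^3}\Gamma(g,h)(v)f(v)\,dv$. -/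

import Mathlib

open MeasureTheory Filter Topology FourierTransform
open scoped ENNReal ContDiff SchwartzMap

noncomputable section

/-- Velocity space `ℝ³` with its Euclidean norm. -/
abbrev Vel : Type := EuclideanSpace ℝ (Fin 3)

/-- The unit sphere `𝕊²` of `ℝ³`. -/
abbrev S2 : Type := Metric.sphere (0 : Vel) 1

/-- The surface measure on `𝕊²` (of total mass `4π`). -/
def sphereMeasure : Measure S2 := (volume : Measure Vel).toSphere

/-- The Japanese bracket `⟨v⟩ = (1 + |v|²)^{1/2}`. -/
def japaneseBracket (v : Vel) : ℝ := Real.sqrt (1 + ‖v‖ ^ 2)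

/-- The function `⟨v⟩^l f(v)`. -/
def weighted (l : ℝ) (f : Vel → ℝ) (v : Vel) : ℝ := japaneseBracket v ^ l * f v

/-- `f ∈ L²_l`. -/
def MemL2 (l : ℝ) (f : Vel → ℝ) : Prop := MemLp (weighted l f) 2 volume

/-- The norm `|f|_{L²_l} = (∫ |f|² ⟨v⟩^{2l} dv)^{1/2}`. -/
def normL2 (l : ℝ) (f : Vel → ℝ) : ℝ := (eLpNorm (weighted l f) 2 volume).toReal

open Classical in
/-- The extended norm `|⟨D⟩ⁿ ⟨·⟩^l f|_{L²}`, computed on the Fourier side by Plancherel.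
The frequency of Mathlib's unitary Fourier transform `𝓕` is `(2π)⁻¹` times the frequency of the
convention `∫ e^{-iv·ξ} f(v) dv`, so that `⟨D⟩ⁿ` has the symbol `(1 + |2πξ|²)^{n/2}`. -/
def sobolevENorm (n : ℕ) (l : ℝ) (f : Vel → ℝ) : ℝ≥0∞ :=
  if hF : MemLp (fun v => (weighted l f v : ℂ)) 2 (volume : Measure Vel) then
    eLpNorm (fun ξ : Vel =>
      ((Real.sqrt (1 + (2 * Real.pi * ‖ξ‖) ^ 2) ^ n : ℝ) : ℂ) *
        (𝓕 (hF.toLp (fun v => (weighted l f v : ℂ))) : Lp ℂ 2 (volume : Measure Vel)) ξ) 2 volume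
  else ⊤

/-- `f ∈ Hⁿ_l`. -/
def MemSobolevWeighted (n : ℕ) (l : ℝ) (f : Vel → ℝ) : Prop := sobolevENorm n l f < ⊤

/-- The norm `|f|_{Hⁿ_l}`. -/
def normH (n : ℕ) (l : ℝ) (f : Vel → ℝ) : ℝ := (sobolevENorm n l f).toReal

/-- The global Maxwellian `μ(v) = (2π)^{-3/2} e^{-|v|²/2}`. -/
def maxwellian (v : Vel) : ℝ := (2 * Real.pi) ^ (-(3 / 2 : ℝ)) * Real.exp (-‖v‖ ^ 2 / 2)

/-- The post-collisional velocity `v' = (v + v_*)/2 + (|v - v_*|/2) σ`. -/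
def postV (v w : Vel) (σ : S2) : Vel :=
  (1 / 2 : ℝ) • (v + w) + (‖v - w‖ / 2) • (σ : Vel)

/-- The post-collisional velocity `v_*' = (v + v_*)/2 - (|v - v_*|/2) σ`. -/
def postVStar (v w : Vel) (σ : S2) : Vel :=
  (1 / 2 : ℝ) • (v + w) - (‖v - w‖ / 2) • (σ : Vel)

/-- `cos θ = ⟨(v - v_*)/|v - v_*|, σ⟩`. -/
def cosDev (v w : Vel) (σ : S2) : ℝ := inner ℝ (v - w) (σ : Vel) / ‖v - w‖

/-- The integrand `|v - v_*|^γ β(cos θ) (g'_* h' - g_* h)`, where `w` stands for `v_*`. -/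
def collisionIntegrand (γ : ℝ) (β : ℝ → ℝ) (g h : Vel → ℝ) (v w : Vel) (σ : S2) : ℝ :=
  ‖v - w‖ ^ γ * β (cosDev v w σ) *
    (g (postVStar v w σ) * h (postV v w σ) - g w * h v)

/-- The collision operator
`Q_β(g,h)(v) = ∫_{ℝ³} ∫_{𝕊²} |v - v_*|^γ β(cos θ) (g'_* h' - g_* h) dσ dv_*`
with angular function `β`. It is meant for angular functions without a singularity at `θ = 0`. -/
def collisionQ (γ : ℝ) (β : ℝ → ℝ) (g h : Vel → ℝ) (v : Vel) : ℝ :=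
  ∫ w : Vel, ∫ σ : S2, collisionIntegrand γ β g h v w σ ∂sphereMeasure

/-- The function `μ^{1/2} g`. -/
def sqrtMaxwellianMul (g : Vel → ℝ) (v : Vel) : ℝ := Real.sqrt (maxwellian v) * g v

/-- `Γ_β(g,h) = μ^{-1/2} Q_β(μ^{1/2} g, μ^{1/2} h)`. -/
def gammaOp (γ : ℝ) (β : ℝ → ℝ) (g h : Vel → ℝ) (v : Vel) : ℝ :=
  (Real.sqrt (maxwellian v))⁻¹ *
    collisionQ γ β (sqrtMaxwellianMul g) (sqrtMaxwellianMul h) v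

/-- The pairing `⟨F, f⟩_v = ∫ F(v) f(v) dv`. -/
def pairing (F f : Vel → ℝ) : ℝ := ∫ v : Vel, F v * f v

/-- The integral over `(v, v_*, σ) ∈ ℝ³ × ℝ³ × 𝕊²` that gives `⟨Γ_β(g,h), f⟩_v` converges
absolutely. -/
def GammaPairingAbsConv (γ : ℝ) (β : ℝ → ℝ) (g h f : Vel → ℝ) : Prop :=
  Integrable (fun p : Vel × Vel × S2 =>
    (Real.sqrt (maxwellian p.1))⁻¹ *
      collisionIntegrand γ β (sqrtMaxwellianMul g) (sqrtMaxwellianMul h) p.1 p.2.1 p.2.2 * f p.1)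
    ((volume : Measure Vel).prod ((volume : Measure Vel).prod sphereMeasure))

/-- The angular part `b` of a non-cutoff kernel, as a function of `cos θ`: nonnegative, supported
in `0 ≤ θ ≤ π/2`, and with `K⁻¹ θ^{-1-2s} ≤ sin θ b(cos θ) ≤ K θ^{-1-2s}` there. -/
structure IsNonCutoffAngular (s K : ℝ) (b : ℝ → ℝ) : Prop where
  measurable : Measurable b
  nonneg : ∀ x, 0 ≤ b x
  support : ∀ x, x < 0 → b x = 0
  lower : ∀ θ : ℝ, 0 < θ → θ ≤ Real.pi / 2 →
    K⁻¹ * θ ^ (-1 - 2 * s) ≤ Real.sin θ * b (Real.cos θ)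
  upper : ∀ θ : ℝ, 0 < θ → θ ≤ Real.pi / 2 →
    Real.sin θ * b (Real.cos θ) ≤ K * θ ^ (-1 - 2 * s)

/-- `φ` is the radial profile of a smooth function on `ℝ³` with values in `[0,1]`, which vanishes
for `|x| > 4/3` and equals `1` for `|x| ≤ 3/4`. -/
structure IsCutoffProfile (φ : ℝ → ℝ) : Prop where
  smooth : ContDiff ℝ ∞ (fun x : Vel => φ ‖x‖)
  nonneg : ∀ r, 0 ≤ r → 0 ≤ φ r
  le_one : ∀ r, 0 ≤ r → φ r ≤ 1
  eq_zero : ∀ r, 4 / 3 < r → φ r = 0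
  eq_one : ∀ r, 0 ≤ r → r ≤ 3 / 4 → φ r = 1

/-- The cutoff angular function `b^ε = b (1 - φ)(sin(θ/2)/ε)`, as a function of `x = cos θ`. -/
def cutoffAngular (φ b : ℝ → ℝ) (ε : ℝ) (x : ℝ) : ℝ :=
  b x * (1 - φ (Real.sin (Real.arccos x / 2) / ε))

open Classical in
/-- The truncation `b 1_{θ ≥ δ}`, as a function of `x = cos θ`. -/
def truncAngular (b : ℝ → ℝ) (δ : ℝ) (x : ℝ) : ℝ :=
  if δ ≤ Real.arccos x then b x else 0

/-- The cutoff operator `Γ^ε(g,h)`. -/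
def gammaCutoff (γ : ℝ) (φ b : ℝ → ℝ) (ε : ℝ) (g h : Vel → ℝ) : Vel → ℝ :=
  gammaOp γ (cutoffAngular φ b ε) g h

/-- The operator `Γ_δ(g,h)` with the angles `θ < δ` removed. -/
def gammaTrunc (γ : ℝ) (b : ℝ → ℝ) (δ : ℝ) (g h : Vel → ℝ) : Vel → ℝ :=
  gammaOp γ (truncAngular b δ) g h

/-- The non-cutoff operator `Γ(g,h)(v)`. As usual for a non-integrable angular singularity, the
integral is a principal value at `θ = 0`. -/
def gammaNonCutoff (γ : ℝ) (b : ℝ → ℝ) (g h : Vel → ℝ) (v : Vel) : ℝ :=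
  limUnder (𝓝[>] (0 : ℝ)) (fun δ => gammaTrunc γ b δ g h v)

/-- The trilinear form `⟨Γ(g,h), f⟩_v` of the non-cutoff operator for functions without further
regularity, as a principal value at `θ = 0`. -/
def gammaForm (γ : ℝ) (b : ℝ → ℝ) (g h f : Vel → ℝ) : ℝ :=
  limUnder (𝓝[>] (0 : ℝ)) (fun δ => pairing (gammaTrunc γ b δ g h) f)

end

noncomputable section

/-! Write c = cos(θ/2). By conservation of energy the Maxwellian factors of Γ_β cancel down to
μ^{1/2}(v_*), and for bounded β the pairing is the absolutely convergent integral of |v-v_*|^γ β(cos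
θ) μ^{1/2}(v_*) (g'_* h' - g_* h) f. The point is to bound it by the second angular moment ∫
(1-c²)|β| dc alone (`exists_pairingIntegrand_le`), although g and f are only square integrable, so
that no derivative may fall on them.

This is achieved by Carleman variables in the gain term: w = v'_*, y = v - v'_* and the direction k
of v - v_* (`map_carleman`, `carleman_spec`). Then g and f are taken at w and w + y, which do not
involve the angle, while h and μ^{1/2} are taken at w + y + q and w + q with q = v' - v orthogonal
to y and |q| = |y| tan(θ/2). The loss term is the same expression at q = 0. Two cancellations
produce the factor 1 - c². First, the half turn of k about y sends q to -q, so the gain may be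
replaced by a symmetric second difference of h μ^{1/2}, which is of size |q|²
(`exists_carlemanForm_symm_le`). Secondly, the angular kernels 4c^{-2-γ}β and 4cβ of gain and loss
agree to first order at c = 1 (`angularMass_gainKernel_sub_lossKernel_le`).

The remaining trilinear integrals are estimated by Cauchy–Schwarz. In the second difference the
factor |q|² turns |y|^γ into |y|^{γ+2}, whose square is locally integrable
(`exists_trilinear_far_le`). In the term without derivatives |y|^γ stays; it is locally integrable
because γ > -3, but its square need not be, so near y = 0 the third function is bounded by its
supremum (`exists_trilinear_le`). This is where the embedding of H² into L^∞ in dimension three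
enters. The Gaussian absorbs the change of base point in the brackets and the weights balance the
growth of |y|^{γ+2}. A general h is approximated in L² ∩ L^∞ by Bessel potentials of Schwartz
functions (`exists_sobolev_approx`), the error being controlled by a crude bound that is finite for
each bounded β.

For β = b 1_{θ≥δ} - b^ε with δ ≤ ε, the support lies in sin(θ/2) ≤ 4ε/3 and the moment is
O(ε^{2-2s}) uniformly in δ. For the difference of two truncations with δ, δ' ≤ r it is O(r^{2-2s}),
so the weak principal value exists; letting δ tend to 0 gives the estimate.

For Schwartz functions the half turn of σ about v - v_* gives an average of g'_* h' - g_* h of size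
(|v-v_*| + |v-v_*|²)(1 - cos θ), and dominated convergence yields the pointwise limit and its
pairing with f. -/

/-! ### Polar coordinates and symmetries of the surface measure -/

instance : IsFiniteMeasure sphereMeasure := by
  unfold sphereMeasure; infer_instance

theorem norm_sphere (σ : S2) : ‖(σ : Vel)‖ = 1 := norm_eq_of_mem_sphere σ

/-- The direction `z / |z|`, with an arbitrary value at `z = 0`. -/
def direction (z : Vel) : S2 :=
  ⟨if z = 0 then EuclideanSpace.single 0 1 else ‖z‖⁻¹ • z, by
    split_ifs with h
    · simp
    · simp [norm_smul, h]⟩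

theorem measurable_direction : Measurable direction := by
  refine Measurable.subtype_mk (Measurable.ite (measurableSet_singleton 0) measurable_const ?_)
  fun_prop

theorem direction_smul {r : ℝ} (hr : 0 < r) (τ : S2) : direction (r • (τ : Vel)) = τ := by
  have h1 := norm_sphere τ
  have h0 : (r • (τ : Vel)) ≠ 0 := by
    rw [← norm_ne_zero_iff, norm_smul, h1]; simp [hr.ne']
  apply Subtype.ext
  simp only [direction, if_neg h0, norm_smul, h1, Real.norm_eq_abs, abs_of_pos hr, mul_one,
    smul_smul, inv_mul_cancel₀ hr.ne', one_smul]

theorem norm_smul_direction (z : Vel) : ‖z‖ • (direction z : Vel) = z := by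
  by_cases h : z = 0
  · simp [h]
  · simp only [direction, if_neg h, smul_smul]
    rw [mul_inv_cancel₀ (norm_ne_zero_iff.2 h), one_smul]

theorem lintegral_polar {F : Vel → ℝ≥0∞} (hF : Measurable F) :
    ∫⁻ x, F x = ∫⁻ τ : S2, (∫⁻ r in Set.Ioi (0 : ℝ),
      ENNReal.ofReal (r ^ 2) * F (r • (τ : Vel))) ∂sphereMeasure := by
  have h1 : ∫⁻ x, F x = ∫⁻ x in ({0}ᶜ : Set Vel), F x := by
    rw [restrict_compl_singleton]
  have hm : MeasurableSet ({0}ᶜ : Set Vel) := (measurableSet_singleton _).compl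
  have h2 : ∫⁻ x in ({0}ᶜ : Set Vel), F x = ∫⁻ x : ({0}ᶜ : Set Vel), F x
      ∂(volume.comap Subtype.val) := by
    rw [lintegral_subtype_comap hm]
  have hp := (volume : Measure Vel).measurePreserving_homeomorphUnitSphereProd
  have h3 : ∀ x : ({0}ᶜ : Set Vel), F x =
      (fun q : S2 × Set.Ioi (0 : ℝ) => F ((q.2 : ℝ) • (q.1 : Vel)))
        (homeomorphUnitSphereProd Vel x) := by
    intro x
    have : ((homeomorphUnitSphereProd Vel).symm (homeomorphUnitSphereProd Vel x) : Vel) = x := by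
      simp
    rw [homeomorphUnitSphereProd_symm_apply_coe] at this
    simp only [this]
  have hm2 : Measurable (fun q : S2 × Set.Ioi (0 : ℝ) => F ((q.2 : ℝ) • (q.1 : Vel))) := by
    fun_prop
  rw [h1, h2, lintegral_congr h3, hp.lintegral_comp hm2, lintegral_prod _ hm2.aemeasurable]
  refine lintegral_congr fun τ => ?_
  have hd : Module.finrank ℝ Vel - 1 = 2 := by simp
  rw [hd, Measure.volumeIoiPow, lintegral_withDensity_eq_lintegral_mul₀ (by fun_prop) (by fun_prop)]
  exact lintegral_subtype_comap measurableSet_Ioi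
    (fun r : ℝ => ENNReal.ofReal (r ^ 2) * F (r • (τ : Vel)))

/-- Exchange of the direction of `z` with `σ`. -/
theorem measurePreserving_swap_direction :
    MeasurePreserving (fun q : Vel × S2 => (‖q.1‖ • (q.2 : Vel), direction q.1))
      ((volume : Measure Vel).prod sphereMeasure) ((volume : Measure Vel).prod sphereMeasure) := by
  have hmeas : Measurable (fun q : Vel × S2 => (‖q.1‖ • (q.2 : Vel), direction q.1)) := by
    have := measurable_direction
    fun_prop
  refine ⟨hmeas, ?_⟩
  refine Measure.ext_of_lintegral _ fun F hF => ?_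
  rw [lintegral_map hF hmeas, lintegral_prod_symm'
    (fun q : Vel × S2 => F (‖q.1‖ • (q.2 : Vel), direction q.1)) (hF.comp hmeas),
    lintegral_prod_symm' _ hF]
  -- In polar coordinates z = rτ the exchanged pair is (rσ, τ), so the claim reduces to the symmetry
  -- of a double integral over the sphere in σ and τ.
  have e1 : ∀ σ : S2, ∫⁻ z, F (‖z‖ • (σ : Vel), direction z) =
      ∫⁻ τ : S2, (∫⁻ r in Set.Ioi (0 : ℝ), ENNReal.ofReal (r ^ 2) * F (r • (σ : Vel), τ))
        ∂sphereMeasure := by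
    intro σ
    have hm : Measurable fun z : Vel => (‖z‖ • (σ : Vel), direction z) := by
      have := measurable_direction
      fun_prop
    rw [lintegral_polar (F := fun z => F (‖z‖ • (σ : Vel), direction z)) (hF.comp hm)]
    refine lintegral_congr fun τ => setLIntegral_congr_fun measurableSet_Ioi fun r hr => ?_
    have hr : 0 < r := hr
    simp only [direction_smul hr, norm_smul, norm_sphere, Real.norm_eq_abs, abs_of_pos hr, mul_one]
  have e2 : ∀ σ : S2, ∫⁻ z, F (z, σ) =
      ∫⁻ τ : S2, (∫⁻ r in Set.Ioi (0 : ℝ), ENNReal.ofReal (r ^ 2) * F (r • (τ : Vel), σ))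
        ∂sphereMeasure := fun σ => lintegral_polar (by fun_prop)
  simp_rw [e1, e2]
  have hK : Measurable fun q : S2 × S2 => ∫⁻ r in Set.Ioi (0 : ℝ),
      ENNReal.ofReal (r ^ 2) * F (r • (q.1 : Vel), q.2) := by
    refine Measurable.lintegral_prod_right' (f := fun q : (S2 × S2) × ℝ =>
      ENNReal.ofReal (q.2 ^ 2) * F (q.2 • (q.1.1 : Vel), q.1.2)) ?_
    have h : Measurable fun q : (S2 × S2) × ℝ => (q.2 • (q.1.1 : Vel), q.1.2) := by fun_prop
    exact (by fun_prop : Measurable fun q : (S2 × S2) × ℝ => ENNReal.ofReal (q.2 ^ 2)).mul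
      (hF.comp h)
  exact lintegral_lintegral_swap (f := fun σ τ : S2 => ∫⁻ r in Set.Ioi (0 : ℝ),
    ENNReal.ofReal (r ^ 2) * F (r • (σ : Vel), τ)) hK.aemeasurable

/-- The isometry of the sphere given by a linear isometry of the space. -/
def sphereMap (L : Vel ≃ₗᵢ[ℝ] Vel) (σ : S2) : S2 :=
  ⟨L σ, by simp⟩

theorem measurable_sphereMap (L : Vel ≃ₗᵢ[ℝ] Vel) : Measurable (sphereMap L) :=
  Measurable.subtype_mk (L.continuous.measurable.comp measurable_subtype_coe)

-- The surface measure of a set is a multiple of the volume of the cone over it, and a linear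
-- isometry maps cones to cones and preserves volume.
open scoped Pointwise in
theorem measurePreserving_sphereMap (L : Vel ≃ₗᵢ[ℝ] Vel) :
    MeasurePreserving (sphereMap L) sphereMeasure sphereMeasure := by
  refine ⟨measurable_sphereMap L, Measure.ext fun s hs => ?_⟩
  rw [Measure.map_apply (measurable_sphereMap L) hs, sphereMeasure,
    Measure.toSphere_apply' _ (measurable_sphereMap L hs), Measure.toSphere_apply' _ hs]
  congr 1
  have : Set.Ioo (0 : ℝ) 1 • ((↑) '' s : Set Vel) =
      L.symm ⁻¹' (Set.Ioo (0 : ℝ) 1 • ((↑) '' (sphereMap L ⁻¹' s) : Set Vel)) := by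
    ext x
    simp only [Set.mem_smul, Set.mem_preimage, Set.mem_image]
    constructor
    · rintro ⟨r, hr, _, ⟨σ, hσ, rfl⟩, rfl⟩
      refine ⟨r, hr, L.symm σ, ⟨sphereMap L.symm σ, ?_, rfl⟩, by simp⟩
      convert hσ
      exact Subtype.ext (by simp [sphereMap])
    · rintro ⟨r, hr, _, ⟨σ, hσ, rfl⟩, h⟩
      refine ⟨r, hr, L σ, ⟨sphereMap L σ, hσ, rfl⟩, ?_⟩
      have := congrArg L h
      simpa using this
  rw [this]
  exact (MeasurePreserving.measure_preimage_equiv (f := L.symm.toMeasurableEquiv)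
    L.symm.measurePreserving _).symm

/-! ### The distribution of one coordinate on the sphere -/

theorem lintegral_cartesian {F : Vel → ℝ≥0∞} (hF : Measurable F) :
    ∫⁻ x, F x = ∫⁻ c : ℝ, ∫⁻ q : ℝ × ℝ, F !₂[c, q.1, q.2] := by
  have h1 := (EuclideanSpace.volume_preserving_symm_measurableEquiv_toLp (Fin 3)).symm
  have h2 := (volume_preserving_piFinSuccAbove (fun _ : Fin 3 => ℝ) 0).symm
  have h3 := (volume_preserving_finTwoArrow ℝ).symm
  have h := h1.comp (h2.comp ((MeasurePreserving.id (volume : Measure ℝ)).prod h3))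
  have hfun : ∀ q : ℝ × ℝ × ℝ, (⇑(MeasurableEquiv.toLp 2 (Fin 3 → ℝ)).symm.symm ∘
      ⇑(MeasurableEquiv.piFinSuccAbove (fun _ : Fin 3 => ℝ) 0).symm ∘
      Prod.map id ⇑(MeasurableEquiv.finTwoArrow (α := ℝ)).symm) q =
      (!₂[q.1, q.2.1, q.2.2] : Vel) := by
    intro q
    ext i
    fin_cases i <;> rfl
  rw [← h.lintegral_comp hF]
  have hm : Measurable fun q : ℝ × ℝ × ℝ => F !₂[q.1, q.2.1, q.2.2] := by
    simp_rw [← hfun]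
    exact hF.comp h.measurable
  exact (lintegral_congr fun q => congrArg F (hfun q)).trans (lintegral_prod _ hm.aemeasurable)

theorem norm_vec3 (a b c : ℝ) : ‖(!₂[a, b, c] : Vel)‖ = Real.sqrt (a ^ 2 + b ^ 2 + c ^ 2) := by
  rw [EuclideanSpace.norm_eq]
  simp [Fin.sum_univ_three]

theorem lintegral_radial_plane {F : ℝ → ℝ≥0∞} (hF : Measurable F) :
    ∫⁻ q : ℝ × ℝ, F (q.1 ^ 2 + q.2 ^ 2) =
      ENNReal.ofReal (2 * Real.pi) * ∫⁻ r in Set.Ioi (0 : ℝ), ENNReal.ofReal r * F (r ^ 2) := by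
  rw [← lintegral_comp_polarCoord_symm, polarCoord_target, Measure.volume_eq_prod,
    ← Measure.prod_restrict]
  have : ∀ p : ℝ × ℝ, ENNReal.ofReal p.1 • F ((polarCoord.symm p).1 ^ 2 +
      (polarCoord.symm p).2 ^ 2) = ENNReal.ofReal p.1 * F (p.1 ^ 2) := by
    intro p
    simp only [polarCoord_symm_apply, smul_eq_mul]
    congr 2
    linear_combination p.1 ^ 2 * Real.sin_sq_add_cos_sq p.2
  simp_rw [this]
  rw [lintegral_prod _ (by fun_prop)]
  simp only [lintegral_const, Measure.restrict_apply_univ, Real.volume_Ioo, sub_neg_eq_add]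
  rw [lintegral_mul_const _ (by fun_prop), mul_comm]
  ring_nf

theorem lintegral_halfPlane_polar {F : ℝ × ℝ → ℝ≥0∞} :
    ∫⁻ q : ℝ × ℝ in {q | 0 < q.2}, F q =
      ∫⁻ p in Set.Ioi (0 : ℝ) ×ˢ Set.Ioo (0 : ℝ) Real.pi, ENNReal.ofReal p.1 *
        F (p.1 * Real.cos p.2, p.1 * Real.sin p.2) := by
  have hm : MeasurableSet {q : ℝ × ℝ | 0 < q.2} := measurableSet_lt measurable_const measurable_snd
  rw [← lintegral_indicator hm, ← lintegral_comp_polarCoord_symm, polarCoord_target,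
    ← lintegral_indicator (measurableSet_Ioi.prod measurableSet_Ioo),
    ← lintegral_indicator (measurableSet_Ioi.prod measurableSet_Ioo)]
  refine lintegral_congr fun p => ?_
  simp only [Set.indicator, Set.mem_prod, Set.mem_Ioi, Set.mem_Ioo, polarCoord_symm_apply,
    Set.mem_ofPred_eq, smul_eq_mul]
  by_cases h1 : 0 < p.1
  · by_cases h2 : -Real.pi < p.2 ∧ p.2 < Real.pi
    · by_cases h3 : 0 < p.2
      · have : 0 < p.1 * Real.sin p.2 := mul_pos h1 (Real.sin_pos_of_pos_of_lt_pi h3 h2.2)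
        simp [h1, h2, h3, this]
      · have : ¬ 0 < p.1 * Real.sin p.2 := by
          have := Real.sin_nonpos_of_nonpos_of_neg_pi_le (not_lt.1 h3) h2.1.le
          nlinarith
        simp [h3, this]
    · have h3 : ¬ (0 < p.2 ∧ p.2 < Real.pi) := fun h => h2 ⟨by linarith [Real.pi_pos], h.2⟩
      simp [h2, h3]
  · simp [h1]

theorem lintegral_sin_cos (F : ℝ → ℝ≥0∞) :
    ∫⁻ t in Set.Ioo (0 : ℝ) Real.pi, ENNReal.ofReal (Real.sin t) * F (Real.cos t) =
      ∫⁻ x in Set.Ioo (-1 : ℝ) 1, F x := by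
  have him : Real.cos '' Set.Ioo 0 Real.pi = Set.Ioo (-1) 1 := by
    ext x
    constructor
    · rintro ⟨t, ht, rfl⟩
      have h1 := Real.strictAntiOn_cos ⟨le_rfl, Real.pi_pos.le⟩ ⟨ht.1.le, ht.2.le⟩ ht.1
      have h2 := Real.strictAntiOn_cos ⟨ht.1.le, ht.2.le⟩ ⟨Real.pi_pos.le, le_rfl⟩ ht.2
      rw [Real.cos_zero] at h1
      rw [Real.cos_pi] at h2
      exact ⟨h2, h1⟩
    · intro hx
      refine ⟨Real.arccos x, ⟨Real.arccos_pos.2 hx.2, ?_⟩, Real.cos_arccos hx.1.le hx.2.le⟩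
      refine lt_of_le_of_ne (Real.arccos_le_pi x) fun h => ?_
      rw [Real.arccos_eq_pi] at h
      linarith [hx.1]
  rw [← him, lintegral_image_eq_lintegral_abs_deriv_mul measurableSet_Ioo
    (fun t _ => (Real.hasDerivAt_cos t).hasDerivWithinAt)
    (Real.injOn_cos.mono Set.Ioo_subset_Icc_self)]
  refine setLIntegral_congr_fun measurableSet_Ioo fun t ht => ?_
  simp only [abs_neg, abs_of_pos (Real.sin_pos_of_mem_Ioo ht)]

/-- The integral of F(x₀/|x|) over the unit ball is computed twice: in spherical coordinates, and in
cylindrical coordinates about the first axis followed by polar coordinates in the half plane. The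
common radial factor A = ∫₀¹ r² dr is finite and nonzero and cancels. -/
theorem lintegral_sphere_coord_zero {F : ℝ → ℝ≥0∞} (hF : Measurable F) :
    ∫⁻ σ : S2, F ((σ : Vel) 0) ∂sphereMeasure =
      ENNReal.ofReal (2 * Real.pi) * ∫⁻ x in Set.Ioo (-1 : ℝ) 1, F x := by
  set G : ℝ → ℝ≥0∞ := (Set.Ioo (0 : ℝ) 1).indicator 1 with hG
  have hGm : Measurable G := measurable_one.indicator measurableSet_Ioo
  set A : ℝ≥0∞ := ∫⁻ r in Set.Ioi (0 : ℝ), ENNReal.ofReal (r ^ 2) * G r with hA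
  have hApos : A ≠ 0 := by
    rw [hA, ← lintegral_indicator measurableSet_Ioi, ← pos_iff_ne_zero,
      lintegral_pos_iff_support (Measurable.indicator (by fun_prop) measurableSet_Ioi)]
    refine lt_of_lt_of_le (b := volume (Set.Ioo (0 : ℝ) 1)) (by simp) (measure_mono fun r hr => ?_)
    have : 0 < r ^ 2 := pow_pos hr.1 2
    simp [hG, hr.1, hr, this.not_ge]
  have hAtop : A ≠ ⊤ := by
    refine ne_top_of_le_ne_top (b := ∫⁻ r in Set.Ioo (0 : ℝ) 1, 1) (by simp) ?_
    rw [hA, ← lintegral_indicator measurableSet_Ioi, ← lintegral_indicator measurableSet_Ioo]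
    refine lintegral_mono fun r => ?_
    by_cases hr : r ∈ Set.Ioo (0 : ℝ) 1
    · have h2 : r ^ 2 ≤ 1 := by nlinarith [hr.1, hr.2]
      simp only [Set.indicator, Set.mem_Ioi, hr.1, if_true, hr, hG]
      simpa using h2
    · simp [hG, hr]
  have e1 : ∫⁻ x : Vel, G ‖x‖ * F (x 0 / ‖x‖) =
      A * ∫⁻ σ : S2, F ((σ : Vel) 0) ∂sphereMeasure := by
    rw [lintegral_polar (by fun_prop), hA, ← lintegral_const_mul _ (by fun_prop)]
    refine lintegral_congr fun τ => ?_
    rw [← lintegral_mul_const _ (by fun_prop)]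
    refine setLIntegral_congr_fun measurableSet_Ioi fun r hr => ?_
    have hr : 0 < r := hr
    simp only [norm_smul, norm_sphere, Real.norm_eq_abs, abs_of_pos hr, mul_one]
    rw [mul_assoc]
    congr 3
    simp only [PiLp.smul_apply, smul_eq_mul]
    field_simp
  have e2 : ∫⁻ x : Vel, G ‖x‖ * F (x 0 / ‖x‖) =
      A * (ENNReal.ofReal (2 * Real.pi) * ∫⁻ x in Set.Ioo (-1 : ℝ) 1, F x) := by
    rw [lintegral_cartesian (by fun_prop)]
    have h1 : ∀ c : ℝ, ∫⁻ q : ℝ × ℝ, G ‖(!₂[c, q.1, q.2] : Vel)‖ *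
        F ((!₂[c, q.1, q.2] : Vel) 0 / ‖(!₂[c, q.1, q.2] : Vel)‖) =
        ENNReal.ofReal (2 * Real.pi) * ∫⁻ r in Set.Ioi (0 : ℝ), ENNReal.ofReal r *
          (G (Real.sqrt (c ^ 2 + r ^ 2)) * F (c / Real.sqrt (c ^ 2 + r ^ 2))) := by
      intro c
      rw [← lintegral_radial_plane (F := fun s => G (Real.sqrt (c ^ 2 + s)) *
        F (c / Real.sqrt (c ^ 2 + s))) (by fun_prop)]
      refine lintegral_congr fun q => ?_
      simp only [norm_vec3, add_assoc]
      rfl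
    simp_rw [h1]
    rw [lintegral_const_mul _ (by
      refine Measurable.lintegral_prod_right' (f := fun q : ℝ × ℝ => ENNReal.ofReal q.2 *
        (G (Real.sqrt (q.1 ^ 2 + q.2 ^ 2)) * F (q.1 / Real.sqrt (q.1 ^ 2 + q.2 ^ 2)))) ?_
      fun_prop)]
    have h2 : ∫⁻ c : ℝ, ∫⁻ r in Set.Ioi (0 : ℝ), ENNReal.ofReal r *
          (G (Real.sqrt (c ^ 2 + r ^ 2)) * F (c / Real.sqrt (c ^ 2 + r ^ 2))) =
        ∫⁻ q : ℝ × ℝ in {q | 0 < q.2}, ENNReal.ofReal q.2 *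
        (G (Real.sqrt (q.1 ^ 2 + q.2 ^ 2)) * F (q.1 / Real.sqrt (q.1 ^ 2 + q.2 ^ 2))) := by
      have : {q : ℝ × ℝ | 0 < q.2} = Set.univ ×ˢ Set.Ioi (0 : ℝ) := by ext; simp
      rw [this, Measure.volume_eq_prod, ← Measure.prod_restrict, lintegral_prod _ (by fun_prop),
        Measure.restrict_univ]
    rw [h2, lintegral_halfPlane_polar, Measure.volume_eq_prod, ← Measure.prod_restrict,
      ← lintegral_sin_cos F]
    rw [mul_left_comm]
    congr 1
    rw [hA, ← lintegral_prod_mul (by fun_prop) (by fun_prop)]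
    rw [Measure.prod_restrict]
    refine setLIntegral_congr_fun (measurableSet_Ioi.prod measurableSet_Ioo) fun p hp => ?_
    have hp1 : 0 < p.1 := hp.1
    have hs : 0 < Real.sin p.2 := Real.sin_pos_of_mem_Ioo hp.2
    have h3 : Real.sqrt ((p.1 * Real.cos p.2) ^ 2 + (p.1 * Real.sin p.2) ^ 2) = p.1 := by
      rw [show (p.1 * Real.cos p.2) ^ 2 + (p.1 * Real.sin p.2) ^ 2 = p.1 ^ 2 by
        linear_combination p.1 ^ 2 * Real.sin_sq_add_cos_sq p.2, Real.sqrt_sq hp1.le]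
    simp only [h3, mul_div_cancel_left₀ _ hp1.ne']
    rw [ENNReal.ofReal_mul hp1.le, pow_two, ENNReal.ofReal_mul hp1.le]
    ring
  rw [e1] at e2
  exact (ENNReal.mul_right_inj hApos hAtop).1 e2

/-- Archimedes' hat-box theorem. -/
theorem lintegral_sphere_inner {F : ℝ → ℝ≥0∞} (hF : Measurable F) {k : Vel} (hk : ‖k‖ = 1) :
    ∫⁻ σ : S2, F (inner ℝ k (σ : Vel)) ∂sphereMeasure =
      ENNReal.ofReal (2 * Real.pi) * ∫⁻ x in Set.Ioo (-1 : ℝ) 1, F x := by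
  set e : Vel := EuclideanSpace.single 0 1
  have he : ‖e‖ = 1 := by simp [e]
  -- The reflection in the plane orthogonal to k - e exchanges the unit vectors k and e.
  set L : Vel ≃ₗᵢ[ℝ] Vel := (ℝ ∙ (k - e))ᗮ.reflection
  have hL : L k = e := Submodule.reflection_sub (by rw [hk, he])
  rw [← lintegral_sphere_coord_zero hF, ← (measurePreserving_sphereMap L).lintegral_comp
    (f := fun σ : S2 => F ((σ : Vel) 0)) (by fun_prop)]
  refine lintegral_congr fun σ => ?_
  congr 1
  rw [← L.inner_map_map, hL]
  simp [e, sphereMap, EuclideanSpace.inner_single_left]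

/-! ### The half-angle map and its Jacobian -/

/-- The point `y = v - v_*'` in terms of `z = v - v_*` and `σ`. -/
def halfReflect (σ : S2) (z : Vel) : Vel := (1 / 2 : ℝ) • (z + ‖z‖ • (σ : Vel))

/-- The inverse of `halfReflect` on the half space `y · σ > 0`. -/
def halfReflectInv (σ : S2) (y : Vel) : Vel :=
  (2 : ℝ) • y - (‖y‖ ^ 2 / inner ℝ y (σ : Vel)) • (σ : Vel)

theorem inner_sphere_self (σ : S2) : inner ℝ (σ : Vel) (σ : Vel) = 1 := by
  rw [real_inner_self_eq_norm_sq, norm_sphere, one_pow]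

/-- In the expansion of the square the cross term -4|y|² cancels |2y|². -/
theorem norm_halfReflectInv {σ : S2} {y : Vel} (h : 0 < inner ℝ y (σ : Vel)) :
    ‖halfReflectInv σ y‖ = ‖y‖ ^ 2 / inner ℝ y (σ : Vel) := by
  have h2 : ‖halfReflectInv σ y‖ ^ 2 = (‖y‖ ^ 2 / inner ℝ y (σ : Vel)) ^ 2 := by
    rw [halfReflectInv, norm_sub_sq_real, norm_smul, norm_smul, norm_sphere, real_inner_smul_left,
      real_inner_smul_right, Real.norm_eq_abs, Real.norm_eq_abs, mul_pow, mul_pow, sq_abs, sq_abs]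
    field_simp
    ring
  exact (sq_eq_sq₀ (norm_nonneg _) (by positivity)).1 h2

theorem halfReflect_halfReflectInv {σ : S2} {y : Vel} (h : 0 < inner ℝ y (σ : Vel)) :
    halfReflect σ (halfReflectInv σ y) = y := by
  rw [halfReflect, norm_halfReflectInv h, halfReflectInv]
  module

theorem inner_halfReflect (σ : S2) (z : Vel) :
    inner ℝ (halfReflect σ z) (σ : Vel) = (inner ℝ z (σ : Vel) + ‖z‖) / 2 := by
  rw [halfReflect, real_inner_smul_left, inner_add_left, real_inner_smul_left, inner_sphere_self]
  ring

/-- By Thales: y lies on the sphere with diameter from 0 to |z|σ. This recovers |z| from y and σ,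
and then z = 2y - |z|σ. -/
theorem norm_halfReflect_sq (σ : S2) (z : Vel) :
    ‖halfReflect σ z‖ ^ 2 = ‖z‖ * inner ℝ (halfReflect σ z) (σ : Vel) := by
  rw [inner_halfReflect, halfReflect, norm_smul, mul_pow, norm_add_sq_real, norm_smul,
    norm_sphere, real_inner_smul_right]
  norm_num
  ring

theorem halfReflectInv_halfReflect {σ : S2} {z : Vel}
    (h : 0 < inner ℝ (halfReflect σ z) (σ : Vel)) :
    halfReflectInv σ (halfReflect σ z) = z := by
  rw [halfReflectInv, norm_halfReflect_sq, mul_div_cancel_right₀ _ h.ne', halfReflect]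
  module

/-- Positivity fails only in the equality case of Cauchy–Schwarz, where z is a nonpositive multiple
of σ; the line through σ is a null set. -/
theorem inner_halfReflect_pos_ae (σ : S2) :
    ∀ᵐ z : Vel, 0 < inner ℝ (halfReflect σ z) (σ : Vel) := by
  have h0 : volume ((ℝ ∙ (σ : Vel) : Submodule ℝ Vel) : Set Vel) = 0 := by
    refine Measure.addHaar_submodule _ _ fun h => ?_
    have h1 : Module.finrank ℝ (ℝ ∙ (σ : Vel)) = 1 := finrank_span_singleton (by
      rw [← norm_ne_zero_iff, norm_sphere]; norm_num)
    rw [h, finrank_top] at h1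
    simp at h1
  have h1 : ∀ᵐ z : Vel, z ∉ ((ℝ ∙ (σ : Vel) : Submodule ℝ Vel) : Set Vel) :=
    measure_eq_zero_iff_ae_notMem.1 h0
  filter_upwards [h1] with z hz
  rw [inner_halfReflect]
  have hle := neg_le_of_abs_le (abs_real_inner_le_norm z (σ : Vel))
  rw [norm_sphere, mul_one] at hle
  rcases hle.lt_or_eq with h | h
  · linarith
  · exfalso
    refine hz (Submodule.mem_span_singleton.2 ⟨-‖z‖, ?_⟩)
    have : ‖z + ‖z‖ • (σ : Vel)‖ ^ 2 = 0 := by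
      rw [norm_add_sq_real, norm_smul, norm_sphere, real_inner_smul_right, ← h]
      norm_num
      ring
    have := norm_eq_zero.1 (pow_eq_zero_iff two_ne_zero |>.1 this)
    rw [neg_smul]
    exact (eq_neg_of_add_eq_zero_left this).symm

/-- The linear form occurring in the derivative of `halfReflectInv`. -/
def halfReflectForm (σ : S2) (y : Vel) : Vel →L[ℝ] ℝ :=
  (inner ℝ y (σ : Vel))⁻¹ • innerSL ℝ y -
    (‖y‖ ^ 2 / (2 * inner ℝ y (σ : Vel) ^ 2)) • innerSL ℝ (σ : Vel)

theorem hasFDerivAt_halfReflectInv {σ : S2} {y : Vel} (h : 0 < inner ℝ y (σ : Vel)) :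
    HasFDerivAt (halfReflectInv σ)
      ((2 : ℝ) • (ContinuousLinearMap.id ℝ Vel - (halfReflectForm σ y).smulRight (σ : Vel))) y := by
  have h1 : HasFDerivAt (fun y : Vel => ‖y‖ ^ 2) ((2 : ℝ) • innerSL ℝ y) y := by
    refine (hasStrictFDerivAt_norm_sq y).hasFDerivAt.congr_fderiv ?_
    ext1 x
    simp
  have h2 : HasFDerivAt (fun y : Vel => inner ℝ y (σ : Vel)) (innerSL ℝ (σ : Vel)) y := by
    have := (innerSL ℝ (σ : Vel)).hasFDerivAt (x := y)
    refine this.congr_of_eventuallyEq (Eventually.of_forall fun x => ?_)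
    simp [real_inner_comm]
  have h3 := h1.mul ((hasDerivAt_inv h.ne').comp_hasFDerivAt y h2)
  have h4 := ((ContinuousLinearMap.id ℝ Vel).hasFDerivAt (x := y)).const_smul (2 : ℝ) |>.sub
    (h3.smul_const (σ : Vel))
  refine (h4.congr_fderiv ?_).congr_of_eventuallyEq (Eventually.of_forall fun x => ?_)
  · ext1 x
    simp only [halfReflectForm, sub_apply, smul_apply,
      ContinuousLinearMap.smulRight_apply, add_apply, innerSL_apply_apply,
      ContinuousLinearMap.id_apply, smul_eq_mul, smul_sub, smul_smul, Function.comp_apply]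
    congr 2
    field_simp
    ring
  · simp [halfReflectInv, div_eq_mul_inv]

/-- Twice a rank-one perturbation of the identity by a form ℓ has determinant 8(1 - ℓ(σ)), and here
ℓ(σ) = 1 - |y|²/(2(y·σ)²). -/
theorem det_halfReflectInv {σ : S2} {y : Vel} (h : 0 < inner ℝ y (σ : Vel)) :
    ((2 : ℝ) • (ContinuousLinearMap.id ℝ Vel -
      (halfReflectForm σ y).smulRight (σ : Vel))).det =
      4 * ‖y‖ ^ 2 / inner ℝ y (σ : Vel) ^ 2 := by
  have e : (((2 : ℝ) • (ContinuousLinearMap.id ℝ Vel -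
      (halfReflectForm σ y).smulRight (σ : Vel)) : Vel →L[ℝ] Vel) : Vel →ₗ[ℝ] Vel) =
      (2 : ℝ) • LinearMap.transvection (halfReflectForm σ y : Vel →ₗ[ℝ] ℝ) (-(σ : Vel)) := by
    ext1 x
    simp [LinearMap.transvection.apply, sub_eq_add_neg]
  rw [ContinuousLinearMap.det, e, LinearMap.det_smul, LinearMap.transvection.det]
  simp only [halfReflectForm, ContinuousLinearMap.coe_coe, sub_apply,
    smul_apply, innerSL_apply_apply, smul_eq_mul, inner_neg_right,
    inner_sphere_self, finrank_euclideanSpace, Fintype.card_fin]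
  field_simp
  ring

theorem lintegral_halfReflect {F : Vel → ℝ≥0∞} (σ : S2) :
    ∫⁻ z, F (halfReflect σ z) = ∫⁻ y in {y : Vel | 0 < inner ℝ y (σ : Vel)},
      ENNReal.ofReal (4 * ‖y‖ ^ 2 / inner ℝ y (σ : Vel) ^ 2) * F y := by
  have hs : MeasurableSet {y : Vel | 0 < inner ℝ y (σ : Vel)} :=
    measurableSet_lt measurable_const (by fun_prop)
  have hinj : Set.InjOn (halfReflectInv σ) {y : Vel | 0 < inner ℝ y (σ : Vel)} := by
    intro a ha b hb hab
    rw [← halfReflect_halfReflectInv ha, hab, halfReflect_halfReflectInv hb]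
  have him : halfReflectInv σ '' {y : Vel | 0 < inner ℝ y (σ : Vel)} =
      {z | 0 < inner ℝ (halfReflect σ z) (σ : Vel)} := by
    ext z
    constructor
    · rintro ⟨y, hy, rfl⟩
      show 0 < inner ℝ _ _
      rw [halfReflect_halfReflectInv hy]
      exact hy
    · intro hz
      exact ⟨_, hz, halfReflectInv_halfReflect hz⟩
  have h1 : ∫⁻ z, F (halfReflect σ z) =
      ∫⁻ z in {z | 0 < inner ℝ (halfReflect σ z) (σ : Vel)}, F (halfReflect σ z) := by
    rw [Measure.restrict_eq_self_of_ae_mem (s := {z | 0 < inner ℝ (halfReflect σ z) (σ : Vel)})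
      (inner_halfReflect_pos_ae σ)]
  rw [h1, ← him, lintegral_image_eq_lintegral_abs_det_fderiv_mul volume hs
    (fun y hy => (hasFDerivAt_halfReflectInv hy).hasFDerivWithinAt) hinj]
  refine setLIntegral_congr_fun hs fun y hy => ?_
  have hy : 0 < inner ℝ y (σ : Vel) := hy
  simp only [det_halfReflectInv hy, halfReflect_halfReflectInv hy]
  rw [abs_of_nonneg (by positivity)]

/-! ### Carleman variables -/

/-- The product measure `dv dv_* dσ`. -/
abbrev tripleMeasure : Measure (Vel × Vel × S2) :=
  (volume : Measure Vel).prod ((volume : Measure Vel).prod sphereMeasure)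

theorem measurePreserving_shift {s : Vel × S2 → Vel} (hs : Measurable s) :
    MeasurePreserving (fun q : Vel × Vel × S2 => (q.1 + s q.2, q.2))
      tripleMeasure tripleMeasure := by
  have hm : Measurable (fun q : Vel × Vel × S2 => (q.1 + s q.2, q.2)) := by fun_prop
  refine ⟨hm, Measure.ext_of_lintegral _ fun F hF => ?_⟩
  rw [lintegral_map hF hm, lintegral_prod_symm' (fun q : Vel × Vel × S2 => F (q.1 + s q.2, q.2))
    (hF.comp hm), lintegral_prod_symm' _ hF]
  exact lintegral_congr fun q => lintegral_add_right_eq_self (fun w => F (w, q)) (s q)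

theorem measurePreserving_relative :
    MeasurePreserving (fun q : Vel × Vel × S2 => (q.2.1, q.1 - q.2.1, q.2.2))
      tripleMeasure tripleMeasure := by
  have hm : Measurable (fun q : Vel × Vel × S2 => (q.2.1, q.1 - q.2.1, q.2.2)) := by fun_prop
  refine ⟨hm, Measure.ext_of_lintegral _ fun F hF => ?_⟩
  have hF2 : Measurable fun q : Vel × Vel × S2 => F (q.2.1, q.1 - q.2.1, q.2.2) := hF.comp hm
  rw [lintegral_map hF hm, lintegral_prod _ hF2.aemeasurable, lintegral_prod _ hF.aemeasurable]
  have e1 : ∀ v : Vel, ∫⁻ q : Vel × S2, F (q.1, v - q.1, q.2) ∂(volume.prod sphereMeasure) =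
      ∫⁻ w : Vel, ∫⁻ σ, F (w, v - w, σ) ∂sphereMeasure := fun v =>
    lintegral_prod _ (hF2.comp measurable_prodMk_left).aemeasurable
  have e2 : ∀ w : Vel, ∫⁻ q : Vel × S2, F (w, q) ∂(volume.prod sphereMeasure) =
      ∫⁻ z : Vel, ∫⁻ σ, F (w, z, σ) ∂sphereMeasure := fun w =>
    lintegral_prod _ (hF.comp measurable_prodMk_left).aemeasurable
  simp only [e1, e2]
  have hK : Measurable fun q : Vel × Vel => ∫⁻ σ, F (q.2, q.1 - q.2, σ) ∂sphereMeasure := by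
    refine Measurable.lintegral_prod_right' (f := fun q : (Vel × Vel) × S2 =>
      F (q.1.2, q.1.1 - q.1.2, q.2)) ?_
    exact hF.comp (by fun_prop : Measurable fun q : (Vel × Vel) × S2 =>
      (q.1.2, q.1.1 - q.1.2, q.2))
  rw [lintegral_lintegral_swap (f := fun v w => ∫⁻ σ, F (w, v - w, σ) ∂sphereMeasure)
    hK.aemeasurable]
  exact lintegral_congr fun w => lintegral_sub_right_eq_self
    (fun z => ∫⁻ σ, F (w, z, σ) ∂sphereMeasure) w

/-- The Carleman variables `(v_*', v - v_*', (v - v_*) / |v - v_*|)`. -/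
def carleman (q : Vel × Vel × S2) : Vel × Vel × S2 :=
  (postVStar q.1 q.2.1 q.2.2, halfReflect q.2.2 (q.1 - q.2.1), direction (q.1 - q.2.1))

/-- The Jacobian of the Carleman variables. -/
def carlemanJac (q : Vel × S2) : ℝ :=
  if 0 < inner ℝ q.1 (q.2 : Vel) then 4 * ‖q.1‖ ^ 2 / inner ℝ q.1 (q.2 : Vel) ^ 2 else 0

theorem measurable_carlemanJac : Measurable carlemanJac :=
  Measurable.ite (measurableSet_lt measurable_const (by fun_prop)) (by fun_prop) measurable_const

theorem carlemanJac_nonneg (q : Vel × S2) : 0 ≤ carlemanJac q := by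
  unfold carlemanJac
  split_ifs <;> positivity

theorem measurable_halfReflect : Measurable fun q : Vel × S2 => halfReflect q.2 q.1 := by
  unfold halfReflect; fun_prop

theorem measurable_postV : Measurable fun q : Vel × Vel × S2 => postV q.1 q.2.1 q.2.2 := by
  unfold postV; fun_prop

theorem measurable_postVStar :
    Measurable fun q : Vel × Vel × S2 => postVStar q.1 q.2.1 q.2.2 := by
  unfold postVStar; fun_prop

theorem measurable_cosDev : Measurable fun q : Vel × Vel × S2 => cosDev q.1 q.2.1 q.2.2 := by
  unfold cosDev; fun_prop

theorem measurable_carleman : Measurable carleman := by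
  have h1 := measurable_postVStar
  have h2 := measurable_halfReflect
  have h3 := measurable_direction
  unfold carleman
  refine h1.prodMk (Measurable.prodMk ?_ ?_)
  · exact h2.comp (by fun_prop : Measurable fun q : Vel × Vel × S2 => (q.1 - q.2.1, q.2.2))
  · fun_prop

theorem map_halfReflect :
    Measure.map (fun q : Vel × S2 => (halfReflect q.2 q.1, q.2)) (volume.prod sphereMeasure) =
      (volume.prod sphereMeasure).withDensity fun q => ENNReal.ofReal (carlemanJac q) := by
  have hm : Measurable (fun q : Vel × S2 => (halfReflect q.2 q.1, q.2)) :=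
    measurable_halfReflect.prodMk measurable_snd
  have hJ := measurable_carlemanJac
  refine Measure.ext_of_lintegral _ fun F hF => ?_
  rw [lintegral_map hF hm, lintegral_withDensity_eq_lintegral_mul _ (by fun_prop) hF,
    lintegral_prod_symm' (fun q : Vel × S2 => F (halfReflect q.2 q.1, q.2)) (hF.comp hm),
    lintegral_prod_symm' _ (by fun_prop)]
  refine lintegral_congr fun σ => ?_
  rw [lintegral_halfReflect (F := fun y => F (y, σ)) σ,
    ← lintegral_indicator (measurableSet_lt measurable_const (by fun_prop))]
  refine lintegral_congr fun y => ?_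
  by_cases h : 0 < inner ℝ y (σ : Vel) <;> simp [carlemanJac, h]

/-- The change of variables is a composition: pass to (v_*, v - v_*, σ), translate v_* to v'_*,
exchange σ with the direction k of v - v_*, and apply the half-angle map with k fixed. The first
three preserve the measure, and only the last contributes a Jacobian. -/
theorem map_carleman :
    Measure.map carleman tripleMeasure =
      tripleMeasure.withDensity fun q => ENNReal.ofReal (carlemanJac q.2) := by
  have hJ := measurable_carlemanJac
  have hs : Measurable fun q : Vel × S2 => (1 / 2 : ℝ) • (q.1 - ‖q.1‖ • (q.2 : Vel)) := by fun_prop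
  have hmid := (measurePreserving_shift hs).comp measurePreserving_relative
  have hswap := (MeasurePreserving.id (volume : Measure Vel)).prod measurePreserving_swap_direction
  have h1 := hswap.comp hmid
  have hm : Measurable (fun q : Vel × S2 => (halfReflect q.2 q.1, q.2)) :=
    measurable_halfReflect.prodMk measurable_snd
  have hfun : carleman = Prod.map id (fun q : Vel × S2 => (halfReflect q.2 q.1, q.2)) ∘
      (Prod.map id (fun q : Vel × S2 => (‖q.1‖ • (q.2 : Vel), direction q.1)) ∘
        ((fun q : Vel × Vel × S2 =>
          (q.1 + (1 / 2 : ℝ) • (q.2.1 - ‖q.2.1‖ • (q.2.2 : Vel)), q.2)) ∘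
        fun q : Vel × Vel × S2 => (q.2.1, q.1 - q.2.1, q.2.2))) := by
    funext q
    simp only [carleman, Function.comp_apply, Prod.map_apply, id_eq, Prod.mk.injEq, and_true]
    constructor
    · simp only [postVStar]
      module
    · simp only [halfReflect, norm_smul, norm_sphere, norm_norm, mul_one, norm_smul_direction]
      rw [add_comm]
  rw [hfun, ← Measure.map_map (measurable_id.prodMap hm) h1.measurable, h1.map_eq,
    ← Measure.map_prod_map _ _ measurable_id hm, Measure.map_id, map_halfReflect,
    prod_withDensity_right (by fun_prop)]

theorem ae_carleman {P : Vel × Vel × S2 → Prop}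
    (h : ∀ᵐ q ∂tripleMeasure, P q) : ∀ᵐ q ∂tripleMeasure, P (carleman q) := by
  refine ae_of_ae_map measurable_carleman.aemeasurable ?_
  rw [map_carleman]
  exact (withDensity_absolutelyContinuous _ _).ae_le h

/-- The density of the image measure vanishes outside the half space y·k > 0. -/
theorem ae_carleman_pos :
    ∀ᵐ q ∂tripleMeasure, 0 < inner ℝ (carleman q).2.1 ((carleman q).2.2 : Vel) := by
  have hJ := measurable_carlemanJac
  refine ae_of_ae_map (p := fun q : Vel × Vel × S2 => 0 < inner ℝ q.2.1 (q.2.2 : Vel))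
    measurable_carleman.aemeasurable ?_
  rw [map_carleman, ae_withDensity_iff (by fun_prop)]
  refine Eventually.of_forall fun q hq => ?_
  by_contra h
  exact hq (by simp [carlemanJac, h])

theorem integrable_carleman {G : Vel × Vel × S2 → ℝ} (hG : Measurable G) :
    Integrable (fun q => G (carleman q)) tripleMeasure ↔
      Integrable (fun q => carlemanJac q.2 * G q) tripleMeasure := by
  have hJ := measurable_carlemanJac
  rw [← Function.comp_def G, ← integrable_map_measure hG.aestronglyMeasurable
    measurable_carleman.aemeasurable, map_carleman,
    integrable_withDensity_iff_integrable_smul' (by fun_prop) (by simp)]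
  simp only [ENNReal.toReal_ofReal (carlemanJac_nonneg _), smul_eq_mul]

theorem integral_carleman {G : Vel × Vel × S2 → ℝ} (hG : Measurable G) :
    ∫ q, G (carleman q) ∂tripleMeasure = ∫ q, carlemanJac q.2 * G q ∂tripleMeasure := by
  have hJ := measurable_carlemanJac
  rw [← integral_map measurable_carleman.aemeasurable hG.aestronglyMeasurable, map_carleman,
    integral_withDensity_eq_integral_toReal_smul (by fun_prop) (by simp)]
  simp only [ENNReal.toReal_ofReal (carlemanJac_nonneg _), smul_eq_mul]

/-- The cosine of the angle between `y` and `σ`. -/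
def cosAngle (q : Vel × S2) : ℝ := inner ℝ q.1 (q.2 : Vel) / ‖q.1‖

/-- The vector `v' - v = v_* - v_*'` in Carleman variables. -/
def carlemanShift (q : Vel × S2) : Vel :=
  q.1 - (‖q.1‖ ^ 2 / inner ℝ q.1 (q.2 : Vel)) • (q.2 : Vel)

theorem measurable_cosAngle : Measurable cosAngle := by
  unfold cosAngle; fun_prop

theorem measurable_carlemanShift : Measurable carlemanShift := by
  unfold carlemanShift; fun_prop

theorem cosAngle_le_one (q : Vel × S2) : cosAngle q ≤ 1 := by
  unfold cosAngle
  refine div_le_one_of_le₀ ?_ (norm_nonneg _)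
  simpa [norm_sphere] using real_inner_le_norm q.1 (q.2 : Vel)

theorem inner_carlemanShift {q : Vel × S2} (h : inner ℝ q.1 (q.2 : Vel) ≠ 0) :
    inner ℝ q.1 (carlemanShift q) = 0 := by
  rw [carlemanShift, inner_sub_right, real_inner_smul_right, real_inner_self_eq_norm_sq]
  field_simp
  ring

/-- As `cosAngle` is cos(θ/2), this is the relation |q| = |y| tan(θ/2) in the right triangle with
legs y and q and hypotenuse v - v_*. -/
theorem norm_carlemanShift_sq {q : Vel × S2} (h : 0 < inner ℝ q.1 (q.2 : Vel)) :
    ‖carlemanShift q‖ ^ 2 = ‖q.1‖ ^ 2 * ((1 - cosAngle q ^ 2) / cosAngle q ^ 2) := by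
  have h0 : q.1 ≠ 0 := by
    rintro h0
    simp [h0] at h
  have h1 := norm_ne_zero_iff.2 h0
  rw [carlemanShift, norm_sub_sq_real, norm_smul, norm_sphere, real_inner_smul_right, cosAngle,
    Real.norm_eq_abs, mul_one, sq_abs]
  field_simp
  ring

/-- The collision geometry in Carleman variables. -/
theorem carleman_spec {v w : Vel} {σ : S2} (hvw : v ≠ w)
    (h : 0 < inner ℝ (carleman (v, w, σ)).2.1 ((carleman (v, w, σ)).2.2 : Vel)) :
    v = (carleman (v, w, σ)).1 + (carleman (v, w, σ)).2.1 ∧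
    w = (carleman (v, w, σ)).1 + carlemanShift (carleman (v, w, σ)).2 ∧
    postVStar v w σ = (carleman (v, w, σ)).1 ∧
    postV v w σ = (carleman (v, w, σ)).1 + (carleman (v, w, σ)).2.1 +
      carlemanShift (carleman (v, w, σ)).2 ∧
    ‖v - w‖ = ‖(carleman (v, w, σ)).2.1‖ / cosAngle (carleman (v, w, σ)).2 ∧
    cosDev v w σ = 2 * cosAngle (carleman (v, w, σ)).2 ^ 2 - 1 := by
  set k := (carleman (v, w, σ)).2.2 with hk
  set y := (carleman (v, w, σ)).2.1 with hy
  have hz : ‖v - w‖ ≠ 0 := norm_ne_zero_iff.2 (sub_ne_zero.2 hvw)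
  have hk' : ‖v - w‖ • (k : Vel) = v - w := norm_smul_direction _
  have hyk : y = halfReflect k (‖v - w‖ • (σ : Vel)) := by
    rw [halfReflect, norm_smul, norm_sphere, norm_norm, mul_one, hk', hy]
    simp only [carleman, halfReflect]
    rw [add_comm]
  have hsq : ‖y‖ ^ 2 = ‖v - w‖ * inner ℝ y (k : Vel) := by
    have := norm_halfReflect_sq k (‖v - w‖ • (σ : Vel))
    rwa [← hyk, norm_smul, norm_sphere, norm_norm, mul_one] at this
  -- The right side is |v-v_*| cos²(θ/2): the vector y bisects the angle between k and σ.
  have hin : inner ℝ y (k : Vel) = ‖v - w‖ * (cosDev v w σ + 1) / 2 := by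
    rw [hyk, inner_halfReflect, norm_smul, norm_sphere, norm_norm, mul_one, cosDev,
      real_inner_smul_left, ← hk', real_inner_smul_left, norm_smul, norm_sphere, norm_norm,
      real_inner_comm]
    field_simp
  have hratio : ‖y‖ ^ 2 / inner ℝ y (k : Vel) = ‖v - w‖ := by
    rw [hsq]; field_simp
  have hshift : carlemanShift (carleman (v, w, σ)).2 = y - (v - w) := by
    rw [carlemanShift, ← hy, ← hk, hratio, hk']
  have hfst : (carleman (v, w, σ)).1 = postVStar v w σ := rfl
  have hv : v = postVStar v w σ + y := by
    rw [hy]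
    simp only [carleman, postVStar, halfReflect]
    module
  have hy0 : ‖y‖ ≠ 0 := by
    intro h0
    rw [h0] at hsq
    have := mul_pos (lt_of_le_of_ne (norm_nonneg _) hz.symm) h
    rw [← hsq] at this
    norm_num at this
  have hw : w = postVStar v w σ + (y - (v - w)) := by
    calc w = v - (v - w) := by abel
      _ = _ := by nth_rewrite 1 [hv]; abel
  refine ⟨?_, ?_, rfl, ?_, ?_, ?_⟩
  · rw [hfst]; exact hv
  · rw [hfst, hshift]; exact hw
  · rw [hfst, hshift]
    have : postV v w σ = v + w - postVStar v w σ := by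
      simp only [postV, postVStar]
      module
    rw [this, show y = v - postVStar v w σ from eq_sub_of_add_eq' hv.symm]
    abel
  · rw [cosAngle, ← hy, ← hk, ← hratio]
    field_simp
  · rw [cosAngle, ← hy, ← hk, div_pow, hsq]
    rw [hin] at h ⊢
    have h3 : cosDev v w σ + 1 ≠ 0 := by
      rintro h3
      rw [h3] at h
      norm_num at h
    field_simp
    ring

/-! ### Brackets, powers and Gaussian weights -/

theorem one_le_japaneseBracket (v : Vel) : 1 ≤ japaneseBracket v := by
  rw [japaneseBracket, Real.one_le_sqrt]
  nlinarith [sq_nonneg ‖v‖]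

theorem japaneseBracket_pos (v : Vel) : 0 < japaneseBracket v :=
  one_pos.trans_le (one_le_japaneseBracket v)

theorem japaneseBracket_sq (v : Vel) : japaneseBracket v ^ 2 = 1 + ‖v‖ ^ 2 :=
  Real.sq_sqrt (by positivity)

theorem continuous_japaneseBracket : Continuous japaneseBracket := by
  unfold japaneseBracket; fun_prop

theorem measurable_japaneseBracket : Measurable japaneseBracket :=
  continuous_japaneseBracket.measurable

theorem norm_le_japaneseBracket (v : Vel) : ‖v‖ ≤ japaneseBracket v := by
  rw [japaneseBracket]
  exact Real.le_sqrt_of_sq_le (by linarith)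

/-- The constants are such that 1 + 8 + 6|b|² + 6|c|² fits into 9(1+|b|²)(1+|c|²). -/
theorem japaneseBracket_le_three_mul {a b c : Vel}
    (h : ‖a‖ ^ 2 ≤ 8 + 6 * ‖b‖ ^ 2 + 6 * ‖c‖ ^ 2) :
    japaneseBracket a ≤ 3 * (japaneseBracket b * japaneseBracket c) := by
  have ha := japaneseBracket_sq a
  have hb := japaneseBracket_sq b
  have hc := japaneseBracket_sq c
  refine le_of_sq_le_sq ?_
      (by have := japaneseBracket_pos b; have := japaneseBracket_pos c; positivity)
  rw [mul_pow, mul_pow, ha, hb, hc]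
  nlinarith [mul_nonneg (sq_nonneg ‖b‖) (sq_nonneg ‖c‖), sq_nonneg ‖b‖, sq_nonneg ‖c‖]

theorem norm_add_sq_le (a b : Vel) : ‖a + b‖ ^ 2 ≤ 2 * ‖a‖ ^ 2 + 2 * ‖b‖ ^ 2 := by
  have := norm_add_le a b
  nlinarith [sq_nonneg (‖a‖ - ‖b‖), norm_nonneg (a + b), norm_nonneg a, norm_nonneg b]

theorem norm_sub_sq_le (a b : Vel) : ‖a - b‖ ^ 2 ≤ 2 * ‖a‖ ^ 2 + 2 * ‖b‖ ^ 2 := by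
  have := norm_add_sq_le a (-b)
  rwa [← sub_eq_add_neg, norm_neg] at this

/-- An inequality of Peetre's type for exponents of either sign: the first comparison serves r ≥ 0,
the second r ≤ 0. -/
theorem rpow_le_of_comparable {a b c : ℝ} (ha : 0 < a) (hb : 0 < b) (hc : 0 < c)
    (h1 : a ≤ 3 * (b * c)) (h2 : b ≤ 3 * (a * c)) (r : ℝ) :
    a ^ r ≤ (3 * c) ^ |r| * b ^ r := by
  have h3 : 0 < 3 * c := by positivity
  rcases le_total 0 r with hr | hr
  · rw [abs_of_nonneg hr, ← Real.mul_rpow h3.le hb.le]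
    exact Real.rpow_le_rpow ha.le (by linarith) hr
  · have h4 : b / (3 * c) ≤ a := by rw [div_le_iff₀ h3]; linarith
    calc a ^ r ≤ (b / (3 * c)) ^ r :=
          Real.rpow_le_rpow_of_nonpos (by positivity) h4 hr
      _ = (3 * c) ^ |r| * b ^ r := by
          rw [abs_of_nonpos hr, Real.div_rpow hb.le h3.le, Real.rpow_neg h3.le]
          field_simp

theorem exists_japaneseBracket_rpow_le (r : ℝ) :
    ∃ C : ℝ, 0 < C ∧ ∀ w : Vel,
      (3 * japaneseBracket w) ^ |r| ≤ C * Real.exp (‖w‖ ^ 2 / 16) := by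
  -- Raising 1 + |w|² ≤ K exp(|w|²/K) to the power |r|/2 gives the exponent |w|²|r|/(2K), and K ≥
  -- 8|r| makes it at most |w|²/16.
  set K : ℝ := 1 + 8 * |r|
  have hK : 1 ≤ K := by simp [K]
  have hK0 : 0 < K := by linarith
  refine ⟨3 ^ |r| * K ^ (|r| / 2), by positivity, fun w => ?_⟩
  rw [Real.mul_rpow (by norm_num) (japaneseBracket_pos w).le, mul_assoc]
  refine mul_le_mul_of_nonneg_left ?_ (by positivity)
  have h1 : japaneseBracket w ^ |r| = (1 + ‖w‖ ^ 2) ^ (|r| / 2) := by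
    rw [japaneseBracket, Real.sqrt_eq_rpow, ← Real.rpow_mul (by positivity)]
    ring_nf
  have h2 : 1 + ‖w‖ ^ 2 ≤ K * Real.exp (‖w‖ ^ 2 / K) := by
    have := Real.add_one_le_exp (‖w‖ ^ 2 / K)
    calc 1 + ‖w‖ ^ 2 ≤ K * (‖w‖ ^ 2 / K + 1) := by field_simp; linarith
      _ ≤ _ := by gcongr
  calc japaneseBracket w ^ |r| ≤ (K * Real.exp (‖w‖ ^ 2 / K)) ^ (|r| / 2) := by
        rw [h1]; exact Real.rpow_le_rpow (by positivity) h2 (by positivity)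
    _ = K ^ (|r| / 2) * Real.exp (‖w‖ ^ 2 / K * (|r| / 2)) := by
        rw [Real.mul_rpow hK0.le (Real.exp_pos _).le, ← Real.exp_mul]
    _ ≤ _ := by
        gcongr
        rw [div_mul_eq_mul_div, div_le_div_iff₀ hK0 (by norm_num)]
        have : |r| / 2 * 16 ≤ K := by simp [K]; linarith
        nlinarith [sq_nonneg ‖w‖]

/-- For |u-w| > 1 the length |u-w| and the bracket of u are comparable up to the bracket of w. For
|u-w| ≤ 1 the bracket of u is bounded by that of w, and the extra term takes up the singularity of a
negative power. -/
theorem norm_rpow_le (a : ℝ) {u w : Vel} (huw : u ≠ w) :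
    ‖u - w‖ ^ a ≤ (3 * japaneseBracket w) ^ |a| * japaneseBracket u ^ a *
      (1 + if ‖u - w‖ ≤ 1 then ‖u - w‖ ^ a else 0) := by
  have hu := japaneseBracket_pos u
  have hw := japaneseBracket_pos w
  have hy : 0 < ‖u - w‖ := norm_pos_iff.2 (sub_ne_zero.2 huw)
  have hA : 0 < (3 * japaneseBracket w) ^ |a| * japaneseBracket u ^ a := by positivity
  have h1 : ‖u - w‖ ≤ 3 * (japaneseBracket u * japaneseBracket w) :=
    (norm_le_japaneseBracket _).trans (japaneseBracket_le_three_mul (by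
      nlinarith [norm_sub_sq_le u w, sq_nonneg ‖u‖, sq_nonneg ‖w‖]))
  rcases le_or_gt ‖u - w‖ 1 with h | h
  · rw [if_pos h]
    have h2 : japaneseBracket u ≤ 3 * (1 * japaneseBracket w) := by
      have : ‖u‖ ^ 2 ≤ 2 * ‖u - w‖ ^ 2 + 2 * ‖w‖ ^ 2 := by
        simpa using norm_add_sq_le (u - w) w
      have h0 : japaneseBracket (0 : Vel) = 1 := by simp [japaneseBracket]
      rw [← h0]
      exact japaneseBracket_le_three_mul (by
        rw [norm_zero]
        nlinarith [sq_nonneg ‖w‖, norm_nonneg (u - w)])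
    rcases le_total 0 a with ha | ha
    · have h3 : ‖u - w‖ ^ a ≤ (3 * (japaneseBracket u * japaneseBracket w)) ^ a :=
        Real.rpow_le_rpow hy.le h1 ha
      have h4 : (3 * (japaneseBracket u * japaneseBracket w)) ^ a =
          (3 * japaneseBracket w) ^ |a| * japaneseBracket u ^ a := by
        rw [abs_of_nonneg ha, ← Real.mul_rpow (by positivity) hu.le]
        ring_nf
      rw [h4] at h3
      have : 0 ≤ ‖u - w‖ ^ a := by positivity
      nlinarith
    · have h3 : 1 ≤ (3 * japaneseBracket w) ^ |a| * japaneseBracket u ^ a := by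
        rw [abs_of_nonpos ha, Real.rpow_neg (by positivity), ← div_eq_inv_mul,
          one_le_div (by positivity)]
        exact Real.rpow_le_rpow_of_nonpos hu (by linarith) ha
      have : 0 ≤ ‖u - w‖ ^ a := by positivity
      nlinarith
  · rw [if_neg h.not_ge, add_zero, mul_one]
    refine rpow_le_of_comparable hy hu hw h1 ?_ a
    refine le_of_sq_le_sq ?_ (by positivity)
    have h2 : ‖u‖ ^ 2 ≤ 2 * ‖u - w‖ ^ 2 + 2 * ‖w‖ ^ 2 := by
      simpa using norm_add_sq_le (u - w) w
    rw [mul_pow, mul_pow, japaneseBracket_sq, japaneseBracket_sq]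
    have h4 : 1 ≤ ‖u - w‖ ^ 2 := by nlinarith
    nlinarith [mul_nonneg (sub_nonneg.2 h4) (sq_nonneg ‖w‖)]

/-- The comparison of the brackets at the points `u = w + y` and `u + q`, where `q ⟂ y`. -/
theorem japaneseBracket_comparable {w y q : Vel} (h1 : inner ℝ y q = 0) (h2 : ‖q‖ ≤ ‖y‖) :
    japaneseBracket (w + y) ≤ 3 * (japaneseBracket (w + y + q) * japaneseBracket (w + q)) ∧
    japaneseBracket (w + y + q) ≤ 3 * (japaneseBracket (w + y) * japaneseBracket (w + q)) := by
  have hq : ‖q‖ ^ 2 ≤ ‖y‖ ^ 2 := by gcongr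
  constructor
  · have a1 := norm_sub_sq_le (w + y + q) q
    have a2 := norm_sub_sq_le (w + y + q) (w + q)
    rw [add_sub_cancel_right] at a1
    rw [show w + y + q - (w + q) = y by abel] at a2
    exact japaneseBracket_le_three_mul (by nlinarith [sq_nonneg ‖w + q‖])
  · have a1 := norm_add_sq_le (w + y) q
    have a2 := norm_sub_sq_le (w + y) (w + q)
    -- By orthogonality |q|² ≤ |y|² + |q|² = |y - q|², so q is controlled by w + y and w + q.
    rw [show w + y - (w + q) = y - q by abel, norm_sub_sq_real, h1] at a2
    exact japaneseBracket_le_three_mul (by nlinarith [sq_nonneg ‖w + q‖, sq_nonneg ‖q‖])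

theorem lintegral_ball_rpow_lt_top {a : ℝ} (ha : -3 < a) :
    ∫⁻ z : Vel, ENNReal.ofReal (if ‖z‖ ≤ 1 then ‖z‖ ^ a else 0) < ⊤ := by
  have hm : Measurable fun z : Vel => ENNReal.ofReal (if ‖z‖ ≤ 1 then ‖z‖ ^ a else 0) :=
    (Measurable.ite (measurableSet_le (by fun_prop) measurable_const) (by fun_prop)
      measurable_const).ennreal_ofReal
  rw [lintegral_polar hm]
  have h1 : ∀ τ : S2, ∫⁻ r in Set.Ioi (0 : ℝ), ENNReal.ofReal (r ^ 2) *
      ENNReal.ofReal (if ‖r • (τ : Vel)‖ ≤ 1 then ‖r • (τ : Vel)‖ ^ a else 0) =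
      ∫⁻ r in Set.Ioc (0 : ℝ) 1, ENNReal.ofReal (r ^ (2 + a)) := by
    intro τ
    rw [← lintegral_indicator measurableSet_Ioi, ← lintegral_indicator measurableSet_Ioc]
    refine lintegral_congr fun r => ?_
    by_cases hr : 0 < r
    · by_cases hr1 : r ≤ 1
      · simp only [Set.indicator, Set.mem_Ioi, hr, Set.mem_Ioc, hr1, norm_smul, norm_sphere,
          Real.norm_eq_abs, abs_of_pos hr, mul_one, and_self, if_true]
        rw [← ENNReal.ofReal_mul (by positivity), Real.rpow_add hr]
        norm_num
      · simp [Set.indicator, hr, hr1, norm_smul, abs_of_pos hr]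
    · simp [Set.indicator, hr]
  simp_rw [h1]
  rw [lintegral_const]
  refine ENNReal.mul_lt_top ?_ (measure_lt_top _ _)
  have := (intervalIntegral.intervalIntegrable_rpow' (a := 0) (b := 1) (r := 2 + a)
    (by linarith)).1
  refine lt_of_le_of_lt (lintegral_mono fun r => ?_) this.2
  exact Real.ofReal_le_enorm _

theorem lintegral_gaussian_lt_top {c : ℝ} (hc : 0 < c) :
    ∫⁻ w : Vel, ENNReal.ofReal (Real.exp (-‖w‖ ^ 2 / c)) < ⊤ := by
  have h := GaussianFourier.integrable_cexp_neg_mul_sq_norm_add (V := Vel) (b := ((1 / c : ℝ) : ℂ))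
    (by simpa using hc) 0 0
  refine lt_of_le_of_lt (lintegral_mono fun w => ?_) h.2
  rw [← ofReal_norm, Complex.norm_exp]
  refine ENNReal.ofReal_le_ofReal (Real.exp_le_exp.2 (le_of_eq ?_))
  simp [← Complex.ofReal_pow]
  ring

/-- A Gaussian average of |u-w|^a is of order at most that of the bracket of u to the power a: half
of the Gaussian pays for the powers of the bracket of w, and the singularity at w = u is integrable.
-/
theorem exists_lintegral_rpow_gaussian_le {a : ℝ} (ha : -3 < a) :
    ∃ C : ℝ≥0∞, C ≠ ⊤ ∧ ∀ u : Vel,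
      ∫⁻ w : Vel, ENNReal.ofReal (‖u - w‖ ^ a * japaneseBracket u ^ (-a) *
        Real.exp (-‖w‖ ^ 2 / 8)) ≤ C := by
  obtain ⟨C, hC, hle⟩ := exists_japaneseBracket_rpow_le a
  set B := ∫⁻ z : Vel, ENNReal.ofReal (if ‖z‖ ≤ 1 then ‖z‖ ^ a else 0) with hB
  set G := ∫⁻ w : Vel, ENNReal.ofReal (Real.exp (-‖w‖ ^ 2 / 16)) with hG
  have hm : Measurable fun z : Vel => ENNReal.ofReal (if ‖z‖ ≤ 1 then ‖z‖ ^ a else 0) :=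
    (Measurable.ite (measurableSet_le (by fun_prop) measurable_const) (by fun_prop)
      measurable_const).ennreal_ofReal
  refine ⟨ENNReal.ofReal C * (G + B), ENNReal.mul_ne_top ENNReal.ofReal_ne_top
    (ENNReal.add_ne_top.2 ⟨(lintegral_gaussian_lt_top (by norm_num)).ne,
      (lintegral_ball_rpow_lt_top ha).ne⟩), fun u => ?_⟩
  have hpt : ∀ᵐ w : Vel, ENNReal.ofReal (‖u - w‖ ^ a * japaneseBracket u ^ (-a) *
      Real.exp (-‖w‖ ^ 2 / 8)) ≤ ENNReal.ofReal C *
        (ENNReal.ofReal (Real.exp (-‖w‖ ^ 2 / 16)) +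
          ENNReal.ofReal (if ‖u - w‖ ≤ 1 then ‖u - w‖ ^ a else 0)) := by
    have hne : ∀ᵐ w : Vel, w ≠ u := by
      rw [ae_iff]; simp
    filter_upwards [hne] with w hw
    set D := if ‖u - w‖ ≤ 1 then ‖u - w‖ ^ a else 0 with hD
    have hD0 : 0 ≤ D := by rw [hD]; split_ifs <;> positivity
    rw [← ENNReal.ofReal_add (Real.exp_pos _).le hD0, ← ENNReal.ofReal_mul hC.le]
    refine ENNReal.ofReal_le_ofReal ?_
    have h1 := norm_rpow_le a hw.symm
    have hu := japaneseBracket_pos u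
    have he : Real.exp (‖w‖ ^ 2 / 16) * Real.exp (-‖w‖ ^ 2 / 8) = Real.exp (-‖w‖ ^ 2 / 16) := by
      rw [← Real.exp_add]; ring_nf
    have he1 : Real.exp (-‖w‖ ^ 2 / 16) ≤ 1 := Real.exp_le_one_iff.2 (by
      have := sq_nonneg ‖w‖; linarith)
    calc ‖u - w‖ ^ a * japaneseBracket u ^ (-a) * Real.exp (-‖w‖ ^ 2 / 8)
        ≤ ((3 * japaneseBracket w) ^ |a| * japaneseBracket u ^ a * (1 + D)) *
          japaneseBracket u ^ (-a) * Real.exp (-‖w‖ ^ 2 / 8) := by gcongr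
      _ = (3 * japaneseBracket w) ^ |a| * ((1 + D) * Real.exp (-‖w‖ ^ 2 / 8)) := by
          rw [Real.rpow_neg hu.le]
          field_simp
      _ ≤ (C * Real.exp (‖w‖ ^ 2 / 16)) * ((1 + D) * Real.exp (-‖w‖ ^ 2 / 8)) := by
          have := hle w
          gcongr
      _ = C * ((1 + D) * Real.exp (-‖w‖ ^ 2 / 16)) := by rw [← he]; ring
      _ ≤ C * (Real.exp (-‖w‖ ^ 2 / 16) + D) := by
          gcongr
          nlinarith
  refine (lintegral_mono_ae hpt).trans ?_
  rw [lintegral_const_mul' _ _ ENNReal.ofReal_ne_top, lintegral_add_left (by fun_prop)]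
  gcongr
  rw [hB]
  exact (lintegral_sub_left_eq_self (fun z : Vel =>
    ENNReal.ofReal (if ‖z‖ ≤ 1 then ‖z‖ ^ a else 0)) u).le

/-! ### Trilinear bounds for kernels with an orthogonal shift -/

/-- The `L²` norm of a nonnegative extended real function. -/
def l2norm (f : Vel → ℝ≥0∞) : ℝ≥0∞ := (∫⁻ x, f x ^ (2 : ℝ)) ^ (1 / 2 : ℝ)

theorem l2norm_rpow_two (f : Vel → ℝ≥0∞) : l2norm f ^ (2 : ℝ) = ∫⁻ x, f x ^ (2 : ℝ) := by
  rw [l2norm, ← ENNReal.rpow_mul]; norm_num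

/-- The weight of the trilinear form in Carleman variables. -/
def carlemanWeight (γ e : ℝ) (w y q : Vel) : ℝ :=
  ‖y‖ ^ e * japaneseBracket (w + y) ^ (-(γ / 2)) * japaneseBracket (w + y + q) ^ (-(γ / 2 + 2)) *
    Real.exp (-‖w + q‖ ^ 2 / 8)

theorem carlemanWeight_nonneg (γ e : ℝ) (w y q : Vel) : 0 ≤ carlemanWeight γ e w y q := by
  have := japaneseBracket_pos (w + y)
  have := japaneseBracket_pos (w + y + q)
  unfold carlemanWeight; positivity

theorem measurable_carlemanWeight (γ e : ℝ) {q : Vel × S2 → Vel} (hq : Measurable q) :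
    Measurable fun x : Vel × Vel × S2 => carlemanWeight γ e x.1 x.2.1 (q x.2) := by
  have := measurable_japaneseBracket
  unfold carlemanWeight; fun_prop

/-- At the expense of half of the Gaussian the bracket at w + y moves to w + y + q, the argument of
the third function. -/
theorem exists_carlemanWeight_le (γ : ℝ) : ∃ C : ℝ, 0 < C ∧ ∀ (e : ℝ) (w y q : Vel),
    inner ℝ y q = 0 → ‖q‖ ≤ ‖y‖ → carlemanWeight γ e w y q ≤
      C * (‖y‖ ^ e * japaneseBracket (w + y + q) ^ (-(γ + 2)) *
        Real.exp (-‖w + q‖ ^ 2 / 16)) := by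
  obtain ⟨C, hC, hle⟩ := exists_japaneseBracket_rpow_le (-(γ / 2))
  refine ⟨C, hC, fun e w y q h1 h2 => ?_⟩
  have hu := japaneseBracket_pos (w + y)
  have hu1 := japaneseBracket_pos (w + y + q)
  have hw1 := japaneseBracket_pos (w + q)
  obtain ⟨c1, c2⟩ := japaneseBracket_comparable h1 h2 (w := w)
  have h3 := rpow_le_of_comparable hu hu1 hw1 c1 c2 (-(γ / 2))
  have he : Real.exp (‖w + q‖ ^ 2 / 16) * Real.exp (-‖w + q‖ ^ 2 / 8) =
      Real.exp (-‖w + q‖ ^ 2 / 16) := by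
    rw [← Real.exp_add]; ring_nf
  have hr : japaneseBracket (w + y + q) ^ (-(γ + 2)) = japaneseBracket (w + y + q) ^ (-(γ / 2)) *
      japaneseBracket (w + y + q) ^ (-(γ / 2 + 2)) := by
    rw [← Real.rpow_add hu1]; ring_nf
  calc carlemanWeight γ e w y q ≤ ‖y‖ ^ e * ((C * Real.exp (‖w + q‖ ^ 2 / 16)) *
        japaneseBracket (w + y + q) ^ (-(γ / 2))) * japaneseBracket (w + y + q) ^ (-(γ / 2 + 2)) *
        Real.exp (-‖w + q‖ ^ 2 / 8) := by
        unfold carlemanWeight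
        gcongr
        refine h3.trans ?_
        gcongr
        exact hle _
    _ = _ := by rw [hr, ← he]; ring

/-- For |y| ≤ 1 the brackets at w + y + q and w + q are comparable, so that the Gaussian at w + q
absorbs every power of them. -/
theorem exists_carlemanWeight_le_near (γ : ℝ) : ∃ C : ℝ, 0 < C ∧ ∀ (e : ℝ) (w y q : Vel),
    inner ℝ y q = 0 → ‖q‖ ≤ ‖y‖ → ‖y‖ ≤ 1 → carlemanWeight γ e w y q ≤ C * ‖y‖ ^ e := by
  obtain ⟨C, hC, hle⟩ := exists_carlemanWeight_le γ
  obtain ⟨C', hC', hle'⟩ := exists_japaneseBracket_rpow_le (2 * (γ + 2))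
  refine ⟨C * C', by positivity, fun e w y q h1 h2 h3 => (hle e w y q h1 h2).trans ?_⟩
  have hu1 := japaneseBracket_pos (w + y + q)
  have hw1 := japaneseBracket_pos (w + q)
  have h4 : japaneseBracket (w + y + q) ^ (-(γ + 2)) ≤
      (3 * japaneseBracket (w + q)) ^ |2 * (γ + 2)| := by
    have hb : (1 : ℝ) = japaneseBracket (0 : Vel) := by simp [japaneseBracket]
    have hy : ‖y‖ ^ 2 ≤ 1 := by nlinarith [norm_nonneg y]
    have c1 : japaneseBracket (w + y + q) ≤ 3 * (1 * japaneseBracket (w + q)) := by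
      rw [hb]
      have a1 := norm_add_sq_le (w + q) y
      rw [show w + q + y = w + y + q by abel] at a1
      exact japaneseBracket_le_three_mul (by rw [norm_zero]; nlinarith [sq_nonneg ‖w + q‖])
    have c2 : 1 ≤ 3 * (japaneseBracket (w + y + q) * japaneseBracket (w + q)) := by
      nlinarith [one_le_japaneseBracket (w + y + q), one_le_japaneseBracket (w + q)]
    refine (rpow_le_of_comparable hu1 one_pos hw1 c1 c2 _).trans ?_
    rw [Real.one_rpow, mul_one]
    refine Real.rpow_le_rpow_of_exponent_le ?_ ?_
    · linarith [one_le_japaneseBracket (w + q)]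
    · rw [abs_neg, abs_mul]
      have := abs_nonneg (γ + 2)
      norm_num
      linarith
  have h5 : japaneseBracket (w + y + q) ^ (-(γ + 2)) * Real.exp (-‖w + q‖ ^ 2 / 16) ≤ C' := by
    calc _ ≤ (C' * Real.exp (‖w + q‖ ^ 2 / 16)) * Real.exp (-‖w + q‖ ^ 2 / 16) := by
          gcongr
          exact h4.trans (hle' _)
      _ = C' := by rw [mul_assoc, ← Real.exp_add]; ring_nf; simp
  calc C * (‖y‖ ^ e * japaneseBracket (w + y + q) ^ (-(γ + 2)) * Real.exp (-‖w + q‖ ^ 2 / 16))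
      = C * ‖y‖ ^ e * (japaneseBracket (w + y + q) ^ (-(γ + 2)) *
          Real.exp (-‖w + q‖ ^ 2 / 16)) := by ring
    _ ≤ C * ‖y‖ ^ e * C' := by gcongr
    _ = _ := by ring

/-- An angular kernel with a translation orthogonal to `y`, not longer than `y`. -/
structure IsCarlemanKernel (κ : Vel × S2 → ℝ≥0∞) (q : Vel × S2 → Vel) (m : ℝ≥0∞) : Prop where
  meas : Measurable κ
  meas_shift : Measurable q
  orthogonal : ∀ x, κ x ≠ 0 → inner ℝ x.1 (q x) = 0
  norm_le : ∀ x, κ x ≠ 0 → ‖q x‖ ≤ ‖x.1‖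
  lintegral_le : ∀ y, ∫⁻ σ, κ (y, σ) ∂sphereMeasure ≤ m

theorem lintegral_triple_swap {F : Vel × Vel × S2 → ℝ≥0∞} (hF : Measurable F) :
    ∫⁻ x, F x ∂tripleMeasure = ∫⁻ y : Vel, ∫⁻ σ, (∫⁻ w, F (w, y, σ)) ∂sphereMeasure := by
  rw [lintegral_prod_symm' _ hF, lintegral_prod _ (Measurable.aemeasurable ?_)]
  exact hF.lintegral_prod_left'

/-- Integration against a Carleman kernel. -/
theorem lintegral_kernel_le {κ : Vel × S2 → ℝ≥0∞} {q : Vel × S2 → Vel} {m : ℝ≥0∞}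
    (hκ : IsCarlemanKernel κ q m) {F : Vel × Vel → ℝ≥0∞} (hF : Measurable F) :
    ∫⁻ x, κ x.2 * F (x.1, x.2.1) ∂tripleMeasure ≤ m * ∫⁻ y : Vel, ∫⁻ w : Vel, F (w, y) := by
  have h1 := hκ.meas
  rw [lintegral_triple_swap (by fun_prop), ← lintegral_const_mul _ hF.lintegral_prod_left']
  refine lintegral_mono fun y => ?_
  calc ∫⁻ σ, (∫⁻ w, κ (y, σ) * F (w, y)) ∂sphereMeasure
      = ∫⁻ σ, κ (y, σ) * (∫⁻ w, F (w, y)) ∂sphereMeasure :=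
        lintegral_congr fun σ => lintegral_const_mul _ (by fun_prop)
    _ = (∫⁻ σ, κ (y, σ) ∂sphereMeasure) * ∫⁻ w, F (w, y) :=
        lintegral_mul_const _ (by fun_prop)
    _ ≤ _ := by gcongr; exact hκ.lintegral_le y

theorem lintegral_mul_translate_sq (g f : Vel → ℝ≥0∞) (hg : Measurable g) (hf : Measurable f) :
    ∫⁻ y : Vel, ∫⁻ w : Vel, g w * f (w + y) = (∫⁻ x, g x) * ∫⁻ x, f x := by
  rw [lintegral_lintegral_swap (f := fun y w : Vel => g w * f (w + y)) (by
    refine Measurable.aemeasurable ?_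
    unfold Function.uncurry
    fun_prop), ← lintegral_mul_const _ hg]
  refine lintegral_congr fun w => ?_
  rw [lintegral_const_mul _ (by fun_prop), lintegral_add_left_eq_self (fun y => f y) w]

/-- The trilinear bound for the exponent `γ + 2`. -/
theorem exists_trilinear_far_le {γ : ℝ} (hγ : -3 < γ) : ∃ C : ℝ≥0∞, C ≠ ⊤ ∧
    ∀ (κ : Vel × S2 → ℝ≥0∞) (q : Vel × S2 → Vel) (m : ℝ≥0∞), IsCarlemanKernel κ q m →
    ∀ g f H : Vel → ℝ≥0∞, Measurable g → Measurable f → Measurable H →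
      ∫⁻ x, κ x.2 * (ENNReal.ofReal (carlemanWeight γ (γ + 2) x.1 x.2.1 (q x.2)) *
        (g x.1 * f (x.1 + x.2.1) * H (x.1 + x.2.1 + q x.2))) ∂tripleMeasure ≤
      C * m * (l2norm g * l2norm f * l2norm H) := by
  obtain ⟨C₁, hC₁, hle⟩ := exists_carlemanWeight_le γ
  -- Cauchy–Schwarz squares |y|^(γ+2). This is harmless since 2(γ+2) > -2; the square of |y|^γ need
  -- not be locally integrable.
  obtain ⟨C₂, hC₂, hle2⟩ := exists_lintegral_rpow_gaussian_le (a := 2 * (γ + 2)) (by linarith)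
  refine ⟨ENNReal.ofReal C₁ * C₂ ^ (1 / 2 : ℝ), ENNReal.mul_ne_top ENNReal.ofReal_ne_top
    (ENNReal.rpow_ne_top_of_nonneg (by norm_num) hC₂), fun κ q m hκ g f H hg hf hH => ?_⟩
  have hκm := hκ.meas
  have hqm := hκ.meas_shift
  have hj := measurable_japaneseBracket
  set ρ : Vel × Vel × S2 → ℝ≥0∞ := fun x => κ x.2 with hρ
  have hρm : Measurable ρ := by fun_prop
  -- The two factors for Cauchy–Schwarz with respect to the measure of density κ: A contains g and
  -- f, whose arguments are free of the angle; B contains the third function and the whole weight.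
  set A : Vel × Vel × S2 → ℝ≥0∞ := fun x => g x.1 * f (x.1 + x.2.1) with hA
  have hAm : Measurable A := by fun_prop
  set B : Vel × Vel × S2 → ℝ≥0∞ := fun x => ENNReal.ofReal (‖x.2.1‖ ^ (γ + 2) *
    japaneseBracket (x.1 + x.2.1 + q x.2) ^ (-(γ + 2)) * Real.exp (-‖x.1 + q x.2‖ ^ 2 / 16)) *
    H (x.1 + x.2.1 + q x.2) with hB
  have hBm : Measurable B := by fun_prop
  have hA2 : ∫⁻ x, ρ x * A x ^ (2 : ℝ) ∂tripleMeasure ≤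
      m * (l2norm g ^ (2 : ℝ) * l2norm f ^ (2 : ℝ)) := by
    rw [l2norm_rpow_two, l2norm_rpow_two, ← lintegral_mul_translate_sq _ _ (by fun_prop)
      (by fun_prop)]
    refine le_trans (le_of_eq ?_) (lintegral_kernel_le hκ (F := fun p : Vel × Vel =>
      g p.1 ^ (2 : ℝ) * f (p.1 + p.2) ^ (2 : ℝ)) (by fun_prop))
    refine lintegral_congr fun x => ?_
    simp only [hρ, hA]
    rw [ENNReal.mul_rpow_of_nonneg _ _ (by norm_num)]
  have hB2 : ∫⁻ x, ρ x * B x ^ (2 : ℝ) ∂tripleMeasure ≤ m * (C₂ * l2norm H ^ (2 : ℝ)) := by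
    set B' : Vel × Vel → ℝ≥0∞ := fun p => ENNReal.ofReal (‖p.2‖ ^ (2 * (γ + 2)) *
      japaneseBracket (p.1 + p.2) ^ (-(2 * (γ + 2))) * Real.exp (-‖p.1‖ ^ 2 / 8)) *
      H (p.1 + p.2) ^ (2 : ℝ) with hB'
    have hB'm : Measurable B' := by fun_prop
    -- After the translation of w by q(y, σ) only κ depends on σ, so that the angular integral
    -- separates.
    have e1 : ∫⁻ x, ρ x * B x ^ (2 : ℝ) ∂tripleMeasure =
        ∫⁻ x, κ x.2 * B' (x.1, x.2.1) ∂tripleMeasure := by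
      rw [← (measurePreserving_shift hqm).lintegral_comp
        (f := fun x : Vel × Vel × S2 => κ x.2 * B' (x.1, x.2.1)) (by fun_prop)]
      refine lintegral_congr fun x => ?_
      simp only [hρ, hB, hB']
      have hu1 := japaneseBracket_pos (x.1 + x.2.1 + q x.2)
      rw [ENNReal.mul_rpow_of_nonneg _ _ (by norm_num),
        ENNReal.ofReal_rpow_of_nonneg (by positivity) (by norm_num),
        show x.1 + q x.2 + x.2.1 = x.1 + x.2.1 + q x.2 by abel]
      congr 3
      rw [Real.mul_rpow (by positivity) (by positivity), Real.mul_rpow (by positivity)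
        (by positivity), ← Real.rpow_mul (norm_nonneg _), ← Real.rpow_mul hu1.le, ← Real.exp_mul]
      ring_nf
    rw [e1]
    refine (lintegral_kernel_le hκ hB'm).trans ?_
    gcongr
    rw [lintegral_lintegral_swap (f := fun y w : Vel => B' (w, y)) (by
      refine Measurable.aemeasurable ?_
      unfold Function.uncurry
      fun_prop)]
    have e2 : ∀ w : Vel, ∫⁻ y : Vel, B' (w, y) = ∫⁻ u : Vel, B' (w, u - w) := fun w =>
      (lintegral_sub_right_eq_self (fun y => B' (w, y)) w).symm
    simp_rw [e2]
    rw [lintegral_lintegral_swap (f := fun w u : Vel => B' (w, u - w)) (by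
      refine Measurable.aemeasurable ?_
      unfold Function.uncurry
      fun_prop), l2norm_rpow_two, ← lintegral_const_mul' _ _ hC₂]
    refine lintegral_mono fun u => ?_
    simp only [hB', add_sub_cancel]
    rw [lintegral_mul_const _ (by fun_prop)]
    gcongr
    exact hle2 u
  calc ∫⁻ x, κ x.2 * (ENNReal.ofReal (carlemanWeight γ (γ + 2) x.1 x.2.1 (q x.2)) *
        (g x.1 * f (x.1 + x.2.1) * H (x.1 + x.2.1 + q x.2))) ∂tripleMeasure
      ≤ ∫⁻ x, ENNReal.ofReal C₁ * (ρ x * (A * B) x) ∂tripleMeasure := by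
        refine lintegral_mono fun x => ?_
        by_cases hx : κ x.2 = 0
        · simp [hx]
        have h1 := hle (γ + 2) x.1 x.2.1 (q x.2) (hκ.orthogonal _ hx) (hκ.norm_le _ hx)
        have h2 := ENNReal.ofReal_le_ofReal h1
        rw [ENNReal.ofReal_mul hC₁.le] at h2
        calc _ ≤ κ x.2 * (ENNReal.ofReal C₁ * ENNReal.ofReal (‖x.2.1‖ ^ (γ + 2) *
            japaneseBracket (x.1 + x.2.1 + q x.2) ^ (-(γ + 2)) *
            Real.exp (-‖x.1 + q x.2‖ ^ 2 / 16)) *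
            (g x.1 * f (x.1 + x.2.1) * H (x.1 + x.2.1 + q x.2))) := by gcongr
          _ = _ := by
            simp only [hρ, hA, hB, Pi.mul_apply]
            ring
    _ = ENNReal.ofReal C₁ * ∫⁻ x, (A * B) x ∂(tripleMeasure.withDensity ρ) := by
        rw [lintegral_const_mul' _ _ ENNReal.ofReal_ne_top,
          lintegral_withDensity_eq_lintegral_mul _ hρm (hAm.mul hBm)]
        rfl
    _ ≤ ENNReal.ofReal C₁ * ((m * (l2norm g ^ (2 : ℝ) * l2norm f ^ (2 : ℝ))) ^ (1 / 2 : ℝ) *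
          (m * (C₂ * l2norm H ^ (2 : ℝ))) ^ (1 / 2 : ℝ)) := by
        gcongr
        refine (ENNReal.lintegral_mul_le_Lp_mul_Lq _ Real.HolderConjugate.two_two
          hAm.aemeasurable hBm.aemeasurable).trans ?_
        rw [lintegral_withDensity_eq_lintegral_mul _ hρm (by fun_prop),
          lintegral_withDensity_eq_lintegral_mul _ hρm (by fun_prop)]
        gcongr
        · exact hA2
        · exact hB2
    _ = _ := by
        have hr : ∀ a : ℝ≥0∞, (a ^ (2 : ℝ)) ^ (1 / 2 : ℝ) = a := fun a => by
          rw [← ENNReal.rpow_mul]; norm_num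
        have hm2 : m ^ (1 / 2 : ℝ) * m ^ (1 / 2 : ℝ) = m := by
          rw [← ENNReal.rpow_add_of_nonneg _ _ (by norm_num) (by norm_num)]; norm_num
        rw [ENNReal.mul_rpow_of_nonneg _ _ (by norm_num),
          ENNReal.mul_rpow_of_nonneg _ _ (by norm_num),
          ENNReal.mul_rpow_of_nonneg _ _ (by norm_num),
          ENNReal.mul_rpow_of_nonneg _ _ (by norm_num), hr, hr, hr]
        nth_rewrite 3 [← hm2]
        ring

/-- The trilinear bound for the exponent `γ`, with a bounded third function. -/
theorem exists_trilinear_le {γ : ℝ} (hγ : -3 < γ) : ∃ C : ℝ≥0∞, C ≠ ⊤ ∧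
    ∀ (κ : Vel × S2 → ℝ≥0∞) (q : Vel × S2 → Vel) (m : ℝ≥0∞), IsCarlemanKernel κ q m →
    ∀ g f H : Vel → ℝ≥0∞, Measurable g → Measurable f → Measurable H →
    ∀ S : ℝ≥0∞, (∀ᵐ x, H x ≤ S) →
      ∫⁻ x, κ x.2 * (ENNReal.ofReal (carlemanWeight γ γ x.1 x.2.1 (q x.2)) *
        (g x.1 * f (x.1 + x.2.1) * H (x.1 + x.2.1 + q x.2))) ∂tripleMeasure ≤
      C * m * (l2norm g * l2norm f * (l2norm H + S)) := by
  obtain ⟨C₁, hC₁, hfar⟩ := exists_trilinear_far_le hγ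
  obtain ⟨C₂, hC₂, hnear⟩ := exists_carlemanWeight_le_near γ
  set D : Vel → ℝ≥0∞ := fun z => ENNReal.ofReal (if ‖z‖ ≤ 1 then ‖z‖ ^ γ else 0) with hD
  have hone : Measurable D :=
    (Measurable.ite (measurableSet_le (by fun_prop) measurable_const) (by fun_prop)
      measurable_const).ennreal_ofReal
  set B := ∫⁻ z : Vel, D z with hB
  have hB_top : B ≠ ⊤ := (lintegral_ball_rpow_lt_top hγ).ne
  refine ⟨C₁ + ENNReal.ofReal C₂ * B, ENNReal.add_ne_top.2 ⟨hC₁,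
    ENNReal.mul_ne_top ENNReal.ofReal_ne_top hB_top⟩,
    fun κ q m hκ g f H hg hf hH S hS => ?_⟩
  have hκm := hκ.meas
  have hqm := hκ.meas_shift
  have hS' : ∀ᵐ x ∂tripleMeasure, H (x.1 + x.2.1 + q x.2) ≤ S := by
    have h1 := (measurePreserving_shift (s := fun p => p.1 + q p) (by fun_prop))
    have h2 : ∀ᵐ x ∂tripleMeasure, H x.1 ≤ S :=
      Measure.quasiMeasurePreserving_fst.ae hS
    filter_upwards [h1.quasiMeasurePreserving.ae h2] with x hx
    rwa [add_assoc]
  have hW := (measurable_carlemanWeight γ (γ + 2) hqm).ennreal_ofReal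
  -- For |y| > 1 one has |y|^γ ≤ |y|^(γ+2), which is the previous bound. For |y| ≤ 1 the weight is
  -- at most a multiple of |y|^γ and H is replaced by S.
  have hsplit : ∀ᵐ x ∂tripleMeasure,
      κ x.2 * (ENNReal.ofReal (carlemanWeight γ γ x.1 x.2.1 (q x.2)) *
        (g x.1 * f (x.1 + x.2.1) * H (x.1 + x.2.1 + q x.2))) ≤
      κ x.2 * (ENNReal.ofReal (carlemanWeight γ (γ + 2) x.1 x.2.1 (q x.2)) *
        (g x.1 * f (x.1 + x.2.1) * H (x.1 + x.2.1 + q x.2))) +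
      ENNReal.ofReal C₂ * S * (κ x.2 * (D x.2.1 *
        (g x.1 * f (x.1 + x.2.1)))) := by
    filter_upwards [hS'] with x hx
    by_cases hk : κ x.2 = 0
    · simp [hk]
    rcases le_or_gt ‖x.2.1‖ 1 with h | h
    · refine le_add_left ?_
      have h1 := ENNReal.ofReal_le_ofReal
        (hnear γ x.1 x.2.1 (q x.2) (hκ.orthogonal _ hk) (hκ.norm_le _ hk) h)
      rw [ENNReal.ofReal_mul hC₂.le] at h1
      simp only [hD, if_pos h]
      calc _ ≤ κ x.2 * (ENNReal.ofReal C₂ * ENNReal.ofReal (‖x.2.1‖ ^ γ) *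
            (g x.1 * f (x.1 + x.2.1) * S)) := by gcongr
        _ = _ := by ring
    · refine le_add_right ?_
      gcongr
      unfold carlemanWeight
      have := japaneseBracket_pos (x.1 + x.2.1)
      have := japaneseBracket_pos (x.1 + x.2.1 + q x.2)
      gcongr
      · exact h.le
      · linarith
  -- Here Cauchy–Schwarz is applied in w at fixed y, so |y|^γ enters to the first power only.
  have hnear2 : ∫⁻ x, κ x.2 * (D x.2.1 *
      (g x.1 * f (x.1 + x.2.1))) ∂tripleMeasure ≤ m * (B * (l2norm g * l2norm f)) := by
    refine (lintegral_kernel_le hκ (F := fun p : Vel × Vel =>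
      D p.2 * (g p.1 * f (p.1 + p.2)))
      (by fun_prop)).trans ?_
    gcongr
    rw [hB, ← lintegral_mul_const _ hone]
    refine lintegral_mono fun y => ?_
    dsimp only
    rw [lintegral_const_mul' _ _ ENNReal.ofReal_ne_top]
    gcongr
    refine (ENNReal.lintegral_mul_le_Lp_mul_Lq volume Real.HolderConjugate.two_two
      hg.aemeasurable (g := fun w => f (w + y)) (by fun_prop)).trans (le_of_eq ?_)
    rw [l2norm, l2norm, lintegral_add_right_eq_self (fun w => f w ^ (2 : ℝ)) y]
  refine (lintegral_mono_ae hsplit).trans ?_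
  rw [lintegral_add_left (by fun_prop), lintegral_const_mul _ (by fun_prop)]
  calc _ ≤ C₁ * m * (l2norm g * l2norm f * l2norm H) +
        ENNReal.ofReal C₂ * S * (m * (B * (l2norm g * l2norm f))) :=
        add_le_add (hfar κ q m hκ g f H hg hf hH) (by gcongr)
    _ ≤ C₁ * m * (l2norm g * l2norm f * (l2norm H + S)) +
        ENNReal.ofReal C₂ * (l2norm H + S) * (m * (B * (l2norm g * l2norm f))) := by
        gcongr
        · exact le_self_add
        · exact le_add_self
    _ = _ := by ring

/-! ### Angular kernels and the half turn about y -/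

theorem map_sphere_inner {k : Vel} (hk : ‖k‖ = 1) :
    Measure.map (fun σ : S2 => inner ℝ k (σ : Vel)) sphereMeasure =
      ENNReal.ofReal (2 * Real.pi) • volume.restrict (Set.Ioo (-1 : ℝ) 1) := by
  refine Measure.ext_of_lintegral _ fun F hF => ?_
  rw [lintegral_map hF (by fun_prop), lintegral_sphere_inner hF hk, lintegral_smul_measure,
    smul_eq_mul]

theorem cosAngle_eq {y : Vel} (σ : S2) :
    cosAngle (y, σ) = inner ℝ (‖y‖⁻¹ • y) (σ : Vel) := by
  rw [cosAngle, real_inner_smul_left, div_eq_inv_mul]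

theorem norm_inv_norm_smul {y : Vel} (hy : y ≠ 0) : ‖‖y‖⁻¹ • y‖ = 1 := by
  rw [norm_smul, norm_inv, norm_norm, inv_mul_cancel₀ (norm_ne_zero_iff.2 hy)]

theorem lintegral_cosAngle {F : ℝ → ℝ≥0∞} (hF : Measurable F) {y : Vel} (hy : y ≠ 0) :
    ∫⁻ σ, F (cosAngle (y, σ)) ∂sphereMeasure =
      ENNReal.ofReal (2 * Real.pi) * ∫⁻ x in Set.Ioo (-1 : ℝ) 1, F x := by
  simp_rw [cosAngle_eq]
  exact lintegral_sphere_inner hF (norm_inv_norm_smul hy)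

theorem integral_cosAngle {F : ℝ → ℝ} (hF : Measurable F) {y : Vel} (hy : y ≠ 0) :
    ∫ σ, F (cosAngle (y, σ)) ∂sphereMeasure =
      2 * Real.pi * ∫ x in Set.Ioo (-1 : ℝ) 1, F x := by
  simp_rw [cosAngle_eq]
  rw [← integral_map (φ := fun σ : S2 => inner ℝ (‖y‖⁻¹ • y) (σ : Vel)) (by fun_prop)
    hF.aestronglyMeasurable, map_sphere_inner (norm_inv_norm_smul hy), integral_smul_measure,
    ENNReal.toReal_ofReal (by positivity), smul_eq_mul]

/-- A function of the angle between `y` and `σ`, restricted to the half space `y · σ > 0`. -/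
def angularKernel (Φ : ℝ → ℝ) (q : Vel × S2) : ℝ :=
  if 0 < inner ℝ q.1 (q.2 : Vel) then Φ (cosAngle q) else 0

theorem measurable_angularKernel {Φ : ℝ → ℝ} (hΦ : Measurable Φ) :
    Measurable (angularKernel Φ) :=
  Measurable.ite (measurableSet_lt measurable_const (by fun_prop))
    (hΦ.comp measurable_cosAngle) measurable_const

theorem cosAngle_pos {q : Vel × S2} (h : 0 < inner ℝ q.1 (q.2 : Vel)) : 0 < cosAngle q := by
  refine div_pos h (norm_pos_iff.2 ?_)
  rintro h0
  simp [h0] at h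

theorem angularKernel_eq_indicator {y : Vel} (hy : y ≠ 0) (Φ : ℝ → ℝ) (σ : S2) :
    angularKernel Φ (y, σ) = (Set.Ioi (0 : ℝ)).indicator Φ (cosAngle (y, σ)) := by
  by_cases h : 0 < inner ℝ y (σ : Vel)
  · have := cosAngle_pos (q := (y, σ)) h
    simp [angularKernel, h, this]
  · have h2 : ¬ 0 < cosAngle (y, σ) := fun h2 =>
      h ((div_pos_iff_of_pos_right (norm_pos_iff.2 hy)).1 h2)
    simp [angularKernel, h, Set.indicator, h2]

theorem Ioo_inter_Ioi_zero : Set.Ioo (-1 : ℝ) 1 ∩ Set.Ioi 0 = Set.Ioo 0 1 := by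
  ext x
  simp only [Set.mem_inter_iff, Set.mem_Ioo, Set.mem_Ioi]
  constructor
  · rintro ⟨⟨_, h⟩, h'⟩; exact ⟨h', h⟩
  · rintro ⟨h, h'⟩; exact ⟨⟨by linarith, h'⟩, h⟩

theorem integral_angularKernel {Φ : ℝ → ℝ} (hΦ : Measurable Φ) {y : Vel} (hy : y ≠ 0) :
    ∫ σ, angularKernel Φ (y, σ) ∂sphereMeasure =
      2 * Real.pi * ∫ x in Set.Ioo (0 : ℝ) 1, Φ x := by
  simp_rw [angularKernel_eq_indicator hy]
  rw [integral_cosAngle (hΦ.indicator measurableSet_Ioi) hy,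
    setIntegral_indicator measurableSet_Ioi, Ioo_inter_Ioi_zero]

theorem lintegral_angularKernel_le {Φ : ℝ → ℝ} (hΦ : Measurable Φ) (y : Vel) :
    ∫⁻ σ, ENNReal.ofReal |angularKernel Φ (y, σ)| ∂sphereMeasure ≤
      ENNReal.ofReal (2 * Real.pi) * ∫⁻ x in Set.Ioo (0 : ℝ) 1, ENNReal.ofReal |Φ x| := by
  rcases eq_or_ne y 0 with rfl | hy
  · simp [angularKernel]
  simp_rw [angularKernel_eq_indicator hy]
  have hm : Measurable fun x => ENNReal.ofReal |(Set.Ioi (0 : ℝ)).indicator Φ x| :=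
    (measurable_norm.comp (hΦ.indicator measurableSet_Ioi)).ennreal_ofReal
  rw [lintegral_cosAngle hm hy, ← Ioo_inter_Ioi_zero, Set.inter_comm,
    ← Measure.restrict_restrict measurableSet_Ioi, ← lintegral_indicator measurableSet_Ioi]
  refine le_of_eq ?_
  congr 1
  refine lintegral_congr fun x => ?_
  by_cases h : 0 < x <;> simp [Set.indicator, h]

/-- The support condition c² ≥ 1/2 means θ ≤ π/2, where tan(θ/2) ≤ 1 and the shift is no longer than
y. For t = 0 there is no shift and the support is irrelevant. -/
theorem isCarlemanKernel_angularKernel {Φ : ℝ → ℝ} (hΦ : Measurable Φ)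
    {t : ℝ} (hsupp : ∀ x, Φ x ≠ 0 → t = 0 ∨ 1 / 2 ≤ x ^ 2) (ht : |t| ≤ 1) :
    IsCarlemanKernel (fun q => ENNReal.ofReal |angularKernel Φ q|)
      (fun q => t • carlemanShift q)
      (ENNReal.ofReal (2 * Real.pi) * ∫⁻ x in Set.Ioo (0 : ℝ) 1, ENNReal.ofReal |Φ x|) where
  meas := (measurable_norm.comp (measurable_angularKernel hΦ)).ennreal_ofReal
  meas_shift := by
    have := measurable_carlemanShift
    fun_prop
  orthogonal q hq := by
    have h : 0 < inner ℝ q.1 (q.2 : Vel) := by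
      by_contra h
      simp [angularKernel, h] at hq
    rw [real_inner_smul_right, inner_carlemanShift h.ne', mul_zero]
  norm_le q hq := by
    have h : 0 < inner ℝ q.1 (q.2 : Vel) := by
      by_contra h
      simp [angularKernel, h] at hq
    have h2 : Φ (cosAngle q) ≠ 0 := by
      intro h2
      simp [angularKernel, h2] at hq
    obtain rfl | h3 := hsupp _ h2
    · simp
    have h4 : ‖carlemanShift q‖ ≤ ‖q.1‖ := by
      refine le_of_sq_le_sq ?_ (norm_nonneg _)
      rw [norm_carlemanShift_sq h]
      refine mul_le_of_le_one_right (by positivity) ?_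
      rw [div_le_one (by linarith)]
      linarith
    rw [norm_smul, Real.norm_eq_abs]
    nlinarith [norm_nonneg (carlemanShift q)]
  lintegral_le := lintegral_angularKernel_le hΦ

/-- The rotation by the angle `π` of the sphere around the axis through `y`. -/
def axisRotation (q : Vel × S2) : Vel × S2 := (q.1, sphereMap (ℝ ∙ q.1).reflection q.2)

theorem coe_axisRotation (q : Vel × S2) : ((axisRotation q).2 : Vel) =
    (2 : ℝ) • (inner ℝ q.1 (q.2 : Vel) / ‖q.1‖ ^ 2) • q.1 - (q.2 : Vel) := by
  simp only [axisRotation, sphereMap]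
  rw [Submodule.reflection_singleton_apply]
  simp [two_smul]

theorem measurable_axisRotation : Measurable axisRotation := by
  have : Measurable fun q : Vel × S2 => ((axisRotation q).2 : Vel) := by
    simp_rw [coe_axisRotation]
    fun_prop
  exact measurable_fst.prodMk (this.subtype_mk (h := fun q => (axisRotation q).2.2))

theorem measurePreserving_axisRotation :
    MeasurePreserving axisRotation ((volume : Measure Vel).prod sphereMeasure)
      ((volume : Measure Vel).prod sphereMeasure) :=
  (MeasurePreserving.id (volume : Measure Vel)).skew_product
    (g := fun y σ => sphereMap (ℝ ∙ y).reflection σ) measurable_axisRotation.snd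
    (Eventually.of_forall fun y => (measurePreserving_sphereMap (ℝ ∙ y).reflection).map_eq)

theorem inner_axisRotation (q : Vel × S2) :
    inner ℝ (axisRotation q).1 ((axisRotation q).2 : Vel) = inner ℝ q.1 (q.2 : Vel) := by
  rw [coe_axisRotation]
  simp only [axisRotation, inner_sub_right, real_inner_smul_right, real_inner_self_eq_norm_sq]
  rcases eq_or_ne q.1 0 with h | h
  · simp [h]
  · have := norm_ne_zero_iff.2 h
    field_simp
    ring

theorem angularKernel_axisRotation (Φ : ℝ → ℝ) (q : Vel × S2) :
    angularKernel Φ (axisRotation q) = angularKernel Φ q := by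
  simp only [angularKernel, cosAngle, inner_axisRotation]
  rfl

/-- The half turn about y fixes y and acts as -1 on the plane orthogonal to y, which contains the
shift. -/
theorem carlemanShift_axisRotation {q : Vel × S2} (h : inner ℝ q.1 (q.2 : Vel) ≠ 0) :
    carlemanShift (axisRotation q) = -carlemanShift q := by
  have h0 : q.1 ≠ 0 := by
    rintro h0
    simp [h0] at h
  have h1 := norm_ne_zero_iff.2 h0
  unfold carlemanShift
  rw [inner_axisRotation, coe_axisRotation, show (axisRotation q).1 = q.1 from rfl, smul_sub,
    smul_smul, smul_smul, mul_assoc, show ‖q.1‖ ^ 2 / inner ℝ q.1 (q.2 : Vel) *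
    (2 * (inner ℝ q.1 (q.2 : Vel) / ‖q.1‖ ^ 2)) = 2 by field_simp]
  module

/-! ### Second differences along a line -/

/-- A function of one variable with bounds on its derivatives up to the second order. -/
def HasSecondOrderBound (φ A : ℝ → ℝ) (P : ℝ) : Prop :=
  ∃ φ' φ'' : ℝ → ℝ, (∀ t, HasDerivAt φ (φ' t) t) ∧ (∀ t, HasDerivAt φ' (φ'' t) t) ∧
    Continuous φ'' ∧ ∀ t, |φ t| ≤ A t ∧ |φ' t| ≤ A t * P ∧ |φ'' t| ≤ A t * P ^ 2

/-- The factor 4 = 1 + 2 + 1 comes from Leibniz' rule for the second derivative and also covers the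
lower orders. -/
theorem HasSecondOrderBound.mul {φ ψ A B : ℝ → ℝ} {P : ℝ} (hP : 0 ≤ P)
    (h1 : HasSecondOrderBound φ A P) (h2 : HasSecondOrderBound ψ B P) :
    HasSecondOrderBound (fun t => φ t * ψ t) (fun t => 4 * (A t * B t)) P := by
  obtain ⟨φ', φ'', a1, a2, a3, a4⟩ := h1
  obtain ⟨ψ', ψ'', b1, b2, b3, b4⟩ := h2
  have cφ : Continuous φ := continuous_iff_continuousAt.2 fun t => (a1 t).continuousAt
  have cφ' : Continuous φ' := continuous_iff_continuousAt.2 fun t => (a2 t).continuousAt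
  have cψ : Continuous ψ := continuous_iff_continuousAt.2 fun t => (b1 t).continuousAt
  have cψ' : Continuous ψ' := continuous_iff_continuousAt.2 fun t => (b2 t).continuousAt
  refine ⟨fun t => φ' t * ψ t + φ t * ψ' t,
    fun t => φ'' t * ψ t + φ' t * ψ' t + (φ' t * ψ' t + φ t * ψ'' t), fun t => (a1 t).mul (b1 t),
    fun t => ((a2 t).mul (b1 t)).add ((a1 t).mul (b2 t)), by fun_prop, fun t => ?_⟩
  obtain ⟨x0, x1, x2⟩ := a4 t
  obtain ⟨y0, y1, y2⟩ := b4 t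
  have hA : 0 ≤ A t := (abs_nonneg _).trans x0
  have hB : 0 ≤ B t := (abs_nonneg _).trans y0
  have m00 : |φ t * ψ t| ≤ A t * B t := by
    rw [abs_mul]; exact mul_le_mul x0 y0 (abs_nonneg _) hA
  have m10 : |φ' t * ψ t| ≤ A t * P * B t := by
    rw [abs_mul]; exact mul_le_mul x1 y0 (abs_nonneg _) (by positivity)
  have m01 : |φ t * ψ' t| ≤ A t * (B t * P) := by
    rw [abs_mul]; exact mul_le_mul x0 y1 (abs_nonneg _) hA
  have m20 : |φ'' t * ψ t| ≤ A t * P ^ 2 * B t := by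
    rw [abs_mul]; exact mul_le_mul x2 y0 (abs_nonneg _) (by positivity)
  have m02 : |φ t * ψ'' t| ≤ A t * (B t * P ^ 2) := by
    rw [abs_mul]; exact mul_le_mul x0 y2 (abs_nonneg _) hA
  have m11 : |φ' t * ψ' t| ≤ A t * P * (B t * P) := by
    rw [abs_mul]; exact mul_le_mul x1 y1 (abs_nonneg _) (by positivity)
  have hAB : 0 ≤ A t * B t := by positivity
  refine ⟨by linarith, ?_, ?_⟩
  · have : 0 ≤ A t * B t * P := by positivity
    refine (abs_add_le _ _).trans ?_
    linarith
  · refine (abs_add_le _ _).trans ?_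
    have h1 := abs_add_le (φ'' t * ψ t) (φ' t * ψ' t)
    have h2 := abs_add_le (φ' t * ψ' t) (φ t * ψ'' t)
    linarith

/-- The derivative of φ(t) + φ(-t) is the integral of φ'' over [-t, t]. The majorant stays under the
integral and is not replaced by its supremum, because second derivatives will be controlled in L²
only. -/
theorem HasSecondOrderBound.abs_second_difference_le {φ A : ℝ → ℝ} {P : ℝ}
    (h : HasSecondOrderBound φ A P) (hA : Continuous A) :
    |φ 1 + φ (-1) - 2 * φ 0| ≤ ∫ t in (-1)..1, A t * P ^ 2 := by
  obtain ⟨φ', φ'', a1, a2, a3, a4⟩ := h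
  set I := ∫ t in (-1)..1, A t * P ^ 2
  have hc : Continuous fun t => A t * P ^ 2 := by fun_prop
  have hpos : ∀ t, 0 ≤ A t * P ^ 2 := fun t => (abs_nonneg _).trans (a4 t).2.2
  have hd : ∀ t ∈ Set.Icc (0 : ℝ) 1, ‖φ' t - φ' (-t)‖ ≤ I := by
    intro t ht
    have e : ∫ s in (-t)..t, φ'' s = φ' t - φ' (-t) :=
      intervalIntegral.integral_eq_sub_of_hasDerivAt (fun s _ => a2 s) (a3.intervalIntegrable _ _)
    rw [← e]
    have ht' : -t ≤ t := by linarith [ht.1]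
    calc ‖∫ s in (-t)..t, φ'' s‖ ≤ ∫ s in (-t)..t, A s * P ^ 2 :=
          intervalIntegral.norm_integral_le_of_norm_le ht'
            (Eventually.of_forall fun s _ => (a4 s).2.2) (hc.intervalIntegrable _ _)
      _ ≤ I := by
          refine intervalIntegral.integral_mono_interval (by linarith [ht.2]) ht' ht.2
            (Eventually.of_forall hpos) (hc.intervalIntegrable _ _)
  have hψ : ∀ t ∈ Set.Icc (0 : ℝ) 1, HasDerivWithinAt (fun t => φ t + φ (-t)) (φ' t - φ' (-t))
      (Set.Icc 0 1) t := by
    intro t _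
    have := (a1 t).add ((a1 (-t)).comp t (hasDerivAt_neg t))
    simp only [mul_neg, mul_one, ← sub_eq_add_neg] at this
    exact this.hasDerivWithinAt
  have := norm_image_sub_le_of_norm_deriv_le_segment' hψ
    (fun t ht => hd t ⟨ht.1, ht.2.le⟩) 1 (by simp)
  simp only [neg_zero, Real.norm_eq_abs, sub_zero, mul_one] at this
  rwa [show φ 1 + φ (-1) - (φ 0 + φ 0) = φ 1 + φ (-1) - 2 * φ 0 by ring] at this

/-! ### Approximation in H² by Bessel potentials of Schwartz functions -/

section

open LineDeriv SchwartzMap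

theorem eLpNorm_two_eq_l2norm {F : Type*} [NormedAddCommGroup F] (f : Vel → F) :
    eLpNorm f 2 volume = l2norm fun x => ‖f x‖ₑ := by
  rw [eLpNorm_eq_lintegral_rpow_enorm_toReal (by norm_num) (by norm_num), l2norm]
  norm_num

theorem l2norm_mono {f g : Vel → ℝ≥0∞} (h : ∀ᵐ x, f x ≤ g x) : l2norm f ≤ l2norm g := by
  unfold l2norm
  refine ENNReal.rpow_le_rpow (lintegral_mono_ae ?_) (by norm_num)
  filter_upwards [h] with x hx
  gcongr

theorem lineDerivOp_eq_sum (p : Vel) (χ : 𝓢(Vel, ℂ)) :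
    ∂_{p} χ = ∑ i : Fin 3, p i • ∂_{(EuclideanSpace.single i (1 : ℝ) : Vel)} χ := by
  ext x
  rw [sum_apply]
  simp only [smul_apply, SchwartzMap.lineDerivOp_apply_eq_fderiv]
  conv_lhs => rw [show p = ∑ i : Fin 3, p i • (EuclideanSpace.single i (1 : ℝ) : Vel) by
    ext j; simp [Fin.sum_univ_three, PiLp.single_apply]; fin_cases j <;> simp]
  rw [map_sum]
  simp

/-- The derivative of a Schwartz function in the `i`-th coordinate direction. -/
abbrev coordDeriv (i : Fin 3) (χ : 𝓢(Vel, ℂ)) : 𝓢(Vel, ℂ) :=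
  ∂_{(EuclideanSpace.single i (1 : ℝ) : Vel)} χ

theorem norm_lineDerivOp_le (p : Vel) (χ : 𝓢(Vel, ℂ)) (x : Vel) :
    ‖(∂_{p} χ) x‖ ≤ (∑ i, ‖coordDeriv i χ x‖) * ‖p‖ := by
  rw [lineDerivOp_eq_sum, sum_apply, Finset.sum_mul]
  refine (norm_sum_le _ _).trans (Finset.sum_le_sum fun i _ => ?_)
  rw [smul_apply, norm_smul, mul_comm]
  gcongr
  exact PiLp.norm_apply_le p i

theorem coordDeriv_lineDerivOp (i : Fin 3) (p : Vel) (χ : 𝓢(Vel, ℂ)) :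
    coordDeriv i (∂_{p} χ) = ∑ j, p j • coordDeriv i (coordDeriv j χ) := by
  rw [lineDerivOp_eq_sum, coordDeriv, lineDerivOp_sum]
  simp only [lineDerivOp_smul]

theorem norm_lineDerivOp_lineDerivOp_le (p : Vel) (χ : 𝓢(Vel, ℂ)) (x : Vel) :
    ‖(∂_{p} (∂_{p} χ)) x‖ ≤ (∑ i, ∑ j, ‖coordDeriv i (coordDeriv j χ) x‖) * ‖p‖ ^ 2 := by
  refine (norm_lineDerivOp_le p _ x).trans ?_
  rw [pow_two, ← mul_assoc]
  gcongr
  rw [Finset.sum_mul]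
  refine Finset.sum_le_sum fun i _ => ?_
  rw [coordDeriv_lineDerivOp, sum_apply, Finset.sum_mul]
  refine (norm_sum_le _ _).trans (Finset.sum_le_sum fun j _ => ?_)
  rw [smul_apply, norm_smul, mul_comm]
  gcongr
  exact PiLp.norm_apply_le p j

theorem hasDerivAt_line (χ : 𝓢(Vel, ℂ)) (x p : Vel) (t : ℝ) :
    HasDerivAt (fun t : ℝ => χ (x + t • p)) ((∂_{p} χ) (x + t • p)) t := by
  have h1 : HasDerivAt (fun t : ℝ => x + t • p) p t := by
    simpa using ((hasDerivAt_id t).smul_const p).const_add x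
  exact (χ.hasFDerivAt (x + t • p)).comp_hasDerivAt t h1

/-- The sum of the absolute values of the derivatives of order at most two. -/
def secondOrderSize (χ : 𝓢(Vel, ℂ)) (x : Vel) : ℝ :=
  ‖χ x‖ + ∑ i, ‖coordDeriv i χ x‖ + ∑ i, ∑ j, ‖coordDeriv i (coordDeriv j χ) x‖

theorem continuous_secondOrderSize (χ : 𝓢(Vel, ℂ)) : Continuous (secondOrderSize χ) := by
  have h (χ : 𝓢(Vel, ℂ)) : Continuous fun x => ‖χ x‖ := χ.continuous.norm
  unfold secondOrderSize
  exact ((h _).add (continuous_finsetSum _ fun i _ => h _)).add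
    (continuous_finsetSum _ fun i _ => continuous_finsetSum _ fun j _ => h _)

theorem hasSecondOrderBound_re (χ : 𝓢(Vel, ℂ)) (x p : Vel) :
    HasSecondOrderBound (fun t => (χ (x + t • p)).re) (fun t => secondOrderSize χ (x + t • p))
      ‖p‖ := by
  have hre (χ : 𝓢(Vel, ℂ)) (t : ℝ) : HasDerivAt (fun t : ℝ => (χ (x + t • p)).re)
      ((∂_{p} χ) (x + t • p)).re t :=
    Complex.reCLM.hasFDerivAt.comp_hasDerivAt t (hasDerivAt_line χ x p t)
  have hc (χ : 𝓢(Vel, ℂ)) : Continuous fun t : ℝ => (χ (x + t • p)).re :=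
    Complex.continuous_re.comp (χ.continuous.comp (by fun_prop))
  refine ⟨fun t => ((∂_{p} χ) (x + t • p)).re, fun t => ((∂_{p} (∂_{p} χ)) (x + t • p)).re,
    hre χ, hre (∂_{p} χ), hc _, fun t => ?_⟩
  beta_reduce
  generalize x + t • p = y
  have n1 : 0 ≤ ∑ i, ‖coordDeriv i χ y‖ := Finset.sum_nonneg fun _ _ => norm_nonneg _
  have n2 : 0 ≤ ∑ i, ∑ j, ‖coordDeriv i (coordDeriv j χ) y‖ :=
    Finset.sum_nonneg fun _ _ => Finset.sum_nonneg fun _ _ => norm_nonneg _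
  have n0 := norm_nonneg (χ y)
  have h1 := (Complex.abs_re_le_norm _).trans (norm_lineDerivOp_le p χ y)
  have h2 := (Complex.abs_re_le_norm _).trans (norm_lineDerivOp_lineDerivOp_le p χ y)
  have e1 : (∑ i, ‖coordDeriv i χ y‖) ≤ secondOrderSize χ y := by
    unfold secondOrderSize; linarith
  have e2 : (∑ i, ∑ j, ‖coordDeriv i (coordDeriv j χ) y‖) ≤ secondOrderSize χ y := by
    unfold secondOrderSize; linarith
  refine ⟨(Complex.abs_re_le_norm _).trans (by unfold secondOrderSize; linarith),
    h1.trans (mul_le_mul_of_nonneg_right e1 (norm_nonneg p)),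
    h2.trans (mul_le_mul_of_nonneg_right e2 (by positivity))⟩

/-- The Schwartz function with Fourier transform `(1 + |ξ|²)⁻¹ G(ξ)`. -/
def besselTwo (G : 𝓢(Vel, ℂ)) : 𝓢(Vel, ℂ) :=
  𝓕⁻ (smulLeftCLM ℂ (fun ξ : Vel => (1 + ‖ξ‖ ^ 2) ^ (-1 : ℝ)) G)

theorem fourier_besselTwo (G : 𝓢(Vel, ℂ)) (ξ : Vel) :
    𝓕 (besselTwo G) ξ = ((1 + ‖ξ‖ ^ 2)⁻¹ : ℝ) • G ξ := by
  rw [besselTwo, FourierTransform.fourier_fourierInv_eq, smulLeftCLM_apply_apply (by fun_prop),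
    Real.rpow_neg_one]

theorem besselTwo_sub (G₁ G₂ : 𝓢(Vel, ℂ)) : besselTwo (G₁ - G₂) = besselTwo G₁ - besselTwo G₂ := by
  rw [besselTwo, map_sub]
  exact map_sub (FourierTransform.fourierInvCLM ℂ 𝓢(Vel, ℂ)) _ _

theorem eLpNorm_eq_of_norm_toLp {χ ψ : 𝓢(Vel, ℂ)}
    (h : ‖χ.toLp 2 volume‖ = ‖ψ.toLp 2 volume‖) : eLpNorm χ 2 volume = eLpNorm ψ 2 volume := by
  have h1 := norm_toLp (f := χ) (p := 2) (μ := volume)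
  have h2 := norm_toLp (f := ψ) (p := 2) (μ := volume)
  exact (ENNReal.toReal_eq_toReal_iff' (χ.memLp 2 volume).eLpNorm_ne_top
      (ψ.memLp 2 volume).eLpNorm_ne_top).1
    (h1.symm.trans (h.trans h2))

theorem norm_toLp_fourier (χ : 𝓢(Vel, ℂ)) :
    ‖(𝓕 χ : 𝓢(Vel, ℂ)).toLp 2 (volume : Measure Vel)‖ = ‖χ.toLp 2 (volume : Measure Vel)‖ := by
  simp

/-- Plancherel on the left side; G itself plays the part of a function on the Fourier side. -/
theorem eLpNorm_le_of_fourier_le {χ G : 𝓢(Vel, ℂ)} {c : ℝ}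
    (h : ∀ ξ, ‖𝓕 χ ξ‖ ≤ c * ‖G ξ‖) : eLpNorm χ 2 volume ≤ ENNReal.ofReal c * eLpNorm G 2 volume :=
        by
  have h1 := norm_toLp_fourier χ
  revert h1 h
  generalize (𝓕 χ : 𝓢(Vel, ℂ)) = ψ
  intro h h1
  rw [← eLpNorm_eq_of_norm_toLp h1]
  exact eLpNorm_le_mul_eLpNorm_of_ae_le_mul (Eventually.of_forall h) 2

theorem fourier_coordDeriv (i : Fin 3) (χ : 𝓢(Vel, ℂ)) (ξ : Vel) :
    ‖𝓕 (coordDeriv i χ) ξ‖ ≤ 2 * Real.pi * (‖ξ‖ * ‖𝓕 χ ξ‖) := by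
  have ht : (fun x : Vel => inner ℝ x (EuclideanSpace.single i (1 : ℝ))).HasTemperateGrowth :=
    ((innerSL ℝ).flip (EuclideanSpace.single i (1 : ℝ) : Vel)).hasTemperateGrowth
  rw [fourier_lineDerivOp_eq, smul_apply, smulLeftCLM_apply_apply ht, norm_smul, norm_smul]
  have h1 : ‖(2 * Real.pi * Complex.I : ℂ)‖ = 2 * Real.pi := by
    simp [abs_of_pos Real.pi_pos]
  have h2 : ‖(inner ℝ ξ (EuclideanSpace.single i (1 : ℝ)) : ℝ)‖ ≤ ‖ξ‖ := by
    refine (norm_inner_le_norm _ _).trans ?_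
    simp
  rw [h1]
  gcongr

theorem eLpNorm_besselTwo_le (G : 𝓢(Vel, ℂ)) :
    eLpNorm (besselTwo G) 2 volume ≤ ENNReal.ofReal 1 * eLpNorm G 2 volume := by
  refine eLpNorm_le_of_fourier_le fun ξ => ?_
  rw [fourier_besselTwo, norm_smul, norm_inv, Real.norm_eq_abs, abs_of_pos (by positivity)]
  gcongr
  exact inv_le_one_of_one_le₀ (by nlinarith [sq_nonneg ‖ξ‖])

theorem eLpNorm_coordDeriv_besselTwo_le (i : Fin 3) (G : 𝓢(Vel, ℂ)) :
    eLpNorm (coordDeriv i (besselTwo G)) 2 volume ≤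
      ENNReal.ofReal (2 * Real.pi) * eLpNorm G 2 volume := by
  refine eLpNorm_le_of_fourier_le fun ξ => (fourier_coordDeriv i _ ξ).trans ?_
  rw [fourier_besselTwo, norm_smul, norm_inv, Real.norm_eq_abs, abs_of_pos (by positivity),
    ← mul_assoc ‖ξ‖]
  gcongr
  refine mul_le_of_le_one_left (norm_nonneg _) ?_
  rw [← div_eq_mul_inv, div_le_one (by positivity)]
  nlinarith [sq_nonneg (‖ξ‖ - 1)]

theorem eLpNorm_coordDeriv_coordDeriv_besselTwo_le (i j : Fin 3) (G : 𝓢(Vel, ℂ)) :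
    eLpNorm (coordDeriv i (coordDeriv j (besselTwo G))) 2 volume ≤
      ENNReal.ofReal ((2 * Real.pi) ^ 2) * eLpNorm G 2 volume := by
  refine eLpNorm_le_of_fourier_le fun ξ => (fourier_coordDeriv i _ ξ).trans ?_
  have h1 := fourier_coordDeriv j (besselTwo G) ξ
  rw [fourier_besselTwo, norm_smul, norm_inv, Real.norm_eq_abs, abs_of_pos (by positivity)] at h1
  calc _ ≤ 2 * Real.pi * (‖ξ‖ * (2 * Real.pi * (‖ξ‖ * ((1 + ‖ξ‖ ^ 2)⁻¹ * ‖G ξ‖)))) := by gcongr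
    _ = (2 * Real.pi) ^ 2 * (‖ξ‖ ^ 2 * (1 + ‖ξ‖ ^ 2)⁻¹ * ‖G ξ‖) := by ring
    _ ≤ _ := by
      gcongr
      refine mul_le_of_le_one_left (norm_nonneg _) ?_
      rw [← div_eq_mul_inv, div_le_one (by positivity)]
      linarith

/-- The `L²` norm of the multiplier of `besselTwo`. -/
def besselConst : ℝ≥0∞ := l2norm fun ξ => ENNReal.ofReal ((1 + ‖ξ‖ ^ 2)⁻¹)

/-- The square of the multiplier decays like |ξ|⁻⁴ and 4 > 3: two derivatives suffice for
boundedness in dimension three. -/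
theorem besselConst_ne_top : besselConst ≠ ⊤ := by
  refine ENNReal.rpow_ne_top_of_nonneg (by norm_num) (ne_of_lt ?_)
  have h := (integrable_rpow_neg_one_add_norm_sq (E := Vel) (μ := volume) (r := 4)
    (by simp; norm_num)).lintegral_lt_top
  refine lt_of_le_of_lt (lintegral_mono fun ξ => ?_) h
  rw [ENNReal.ofReal_rpow_of_nonneg (by positivity) (by norm_num)]
  refine ENNReal.ofReal_le_ofReal (le_of_eq ?_)
  rw [← Real.rpow_neg_one, ← Real.rpow_mul (by positivity)]
  norm_num

/-- The Sobolev embedding of H² into L^∞: Fourier inversion and Cauchy–Schwarz. -/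
theorem enorm_besselTwo_le (G : 𝓢(Vel, ℂ)) (x : Vel) :
    ‖besselTwo G x‖ₑ ≤ besselConst * eLpNorm G 2 volume := by
  set ρ := smulLeftCLM ℂ (fun ξ : Vel => (1 + ‖ξ‖ ^ 2) ^ (-1 : ℝ)) G with hρ
  have h1 : ‖besselTwo G x‖ₑ ≤ ∫⁻ ξ, ‖ρ ξ‖ₑ := by
    rw [besselTwo, fourierInv_coe, Real.fourierInv_eq]
    refine (enorm_integral_le_lintegral_enorm _).trans (le_of_eq (lintegral_congr fun ξ => ?_))
    rw [← ofReal_norm, ← ofReal_norm, Circle.norm_smul]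
  refine h1.trans ?_
  have h2 : ∀ ξ, ‖ρ ξ‖ₑ = ENNReal.ofReal ((1 + ‖ξ‖ ^ 2)⁻¹) * ‖G ξ‖ₑ := by
    intro ξ
    rw [hρ, smulLeftCLM_apply_apply (by fun_prop), enorm_smul, Real.rpow_neg_one,
      Real.enorm_of_nonneg (by positivity)]
  simp_rw [h2]
  have hG : Measurable fun ξ => ‖G ξ‖ₑ := G.continuous.enorm.measurable
  refine (ENNReal.lintegral_mul_le_Lp_mul_Lq volume Real.HolderConjugate.two_two
    (f := fun ξ : Vel => ENNReal.ofReal ((1 + ‖ξ‖ ^ 2)⁻¹)) (by fun_prop)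
    hG.aemeasurable).trans (le_of_eq ?_)
  rw [eLpNorm_two_eq_l2norm, besselConst, l2norm, l2norm]

theorem exists_l2norm_secondOrderSize_le : ∃ C : ℝ≥0∞, C ≠ ⊤ ∧ ∀ G : 𝓢(Vel, ℂ),
    l2norm (fun x => ENNReal.ofReal (secondOrderSize (besselTwo G) x)) ≤
      C * eLpNorm G 2 volume := by
  refine ⟨ENNReal.ofReal 1 + ∑ _i : Fin 3, ENNReal.ofReal (2 * Real.pi) +
    ∑ _i : Fin 3, ∑ _j : Fin 3, ENNReal.ofReal ((2 * Real.pi) ^ 2), by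
      simp [ENNReal.mul_eq_top], fun G => ?_⟩
  have hs (χ : 𝓢(Vel, ℂ)) : AEStronglyMeasurable (fun x => ‖χ x‖) volume :=
    χ.continuous.norm.aestronglyMeasurable
  have he : l2norm (fun x => ENNReal.ofReal (secondOrderSize (besselTwo G) x)) =
      eLpNorm (secondOrderSize (besselTwo G)) 2 volume := by
    rw [eLpNorm_two_eq_l2norm]
    congr 1
    funext x
    rw [Real.enorm_of_nonneg]
    unfold secondOrderSize
    positivity
  have hfun : secondOrderSize (besselTwo G) = (fun x => ‖besselTwo G x‖) +
      (∑ i, fun x => ‖coordDeriv i (besselTwo G) x‖) +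
      ∑ i, ∑ j, fun x => ‖coordDeriv i (coordDeriv j (besselTwo G)) x‖ := by
    funext x
    simp [secondOrderSize]
  rw [he, hfun, add_mul, add_mul, Finset.sum_mul, Finset.sum_mul]
  simp_rw [Finset.sum_mul]
  have h2 : (1 : ℝ≥0∞) ≤ 2 := by norm_num
  have m1 : AEStronglyMeasurable (∑ i, fun x => ‖coordDeriv i (besselTwo G) x‖) volume :=
    Finset.aestronglyMeasurable_sum _ fun i _ => hs _
  have m2 (i : Fin 3) : AEStronglyMeasurable
      (∑ j, fun x => ‖coordDeriv i (coordDeriv j (besselTwo G)) x‖) volume :=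
    Finset.aestronglyMeasurable_sum _ fun j _ => hs _
  refine (eLpNorm_add_le ((hs _).add m1) (Finset.aestronglyMeasurable_sum _ fun i _ => m2 i)
    h2).trans (add_le_add ((eLpNorm_add_le (hs _) m1 h2).trans (add_le_add ?_ ?_)) ?_)
  · rw [eLpNorm_norm]
    exact eLpNorm_besselTwo_le G
  · refine (eLpNorm_sum_le (fun i _ => hs _) h2).trans (Finset.sum_le_sum fun i _ => ?_)
    rw [eLpNorm_norm]
    exact eLpNorm_coordDeriv_besselTwo_le i G
  · refine (eLpNorm_sum_le (fun i _ => m2 i) h2).trans (Finset.sum_le_sum fun i _ => ?_)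
    refine (eLpNorm_sum_le (fun j _ => hs _) h2).trans (Finset.sum_le_sum fun j _ => ?_)
    rw [eLpNorm_norm]
    exact eLpNorm_coordDeriv_coordDeriv_besselTwo_le i j G

theorem exists_schwartz_eLpNorm_sub_lt {U : Vel → ℂ} (hU : MemLp U 2) {δ : ℝ≥0∞} (hδ : 0 < δ) :
    ∃ G : 𝓢(Vel, ℂ), eLpNorm (fun ξ => U ξ - G ξ) 2 volume < δ := by
  obtain ⟨r, hr0, hr⟩ : ∃ r : ℝ, 0 < r ∧ ENNReal.ofReal r ≤ δ := by
    rcases eq_or_ne δ ⊤ with rfl | h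
    · exact ⟨1, one_pos, le_top⟩
    · exact ⟨δ.toReal, ENNReal.toReal_pos hδ.ne' h, ENNReal.ofReal_toReal_le⟩
  obtain ⟨G, hG⟩ := Metric.denseRange_iff.1 (SchwartzMap.denseRange_toLpCLM (E := Vel) (F := ℂ)
    (p := 2) (μ := volume) (by norm_num)) (hU.toLp U) r hr0
  have h1 : eLpNorm (fun ξ => U ξ - G ξ) 2 volume = ENNReal.ofReal (dist (hU.toLp U)
      (SchwartzMap.toLpCLM ℝ ℂ 2 volume G)) := by
    rw [Lp.dist_def, ENNReal.ofReal_toReal]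
    · refine eLpNorm_congr_ae ?_
      filter_upwards [hU.coeFn_toLp, G.coeFn_toLp 2 volume] with x hx hx2
      change _ = (hU.toLp U) x - (G.toLp 2 volume) x
      rw [hx, hx2]
    · exact ((Lp.memLp _).sub (Lp.memLp _)).eLpNorm_ne_top
  refine ⟨G, ?_⟩
  rw [h1]
  exact ((ENNReal.ofReal_lt_ofReal_iff hr0).2 hG).trans_le hr

/-- By Plancherel the left side is the norm of the right-hand function divided by the multiplier 1 +
|ξ|² ≥ 1. -/
theorem eLpNorm_sub_besselTwo_le {k : Vel → ℂ} (hk : MemLp k 2) (G : 𝓢(Vel, ℂ)) :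
    eLpNorm (fun x => k x - besselTwo G x) 2 volume ≤ eLpNorm (fun ξ =>
      ((1 + ‖ξ‖ ^ 2 : ℝ) : ℂ) * (𝓕 (hk.toLp k) : Lp ℂ 2 (volume : Measure Vel)) ξ - G ξ) 2
        volume := by
  set V : Lp ℂ 2 (volume : Measure Vel) := 𝓕 (hk.toLp k) with hV
  have e1 : eLpNorm (fun x => k x - besselTwo G x) 2 volume =
      ‖hk.toLp k - (besselTwo G).toLp 2 volume‖ₑ := by
    rw [Lp.enorm_def]
    refine eLpNorm_congr_ae ?_
    filter_upwards [hk.coeFn_toLp, (besselTwo G).coeFn_toLp 2 volume,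
      Lp.coeFn_sub (hk.toLp k) ((besselTwo G).toLp 2 volume)] with x h1 h2 h3
    rw [h3, Pi.sub_apply, h1, h2]
  have e2 : ‖hk.toLp k - (besselTwo G).toLp 2 volume‖ₑ =
      ‖V - (𝓕 (besselTwo G) : 𝓢(Vel, ℂ)).toLp 2 volume‖ₑ := by
    rw [hV, ← SchwartzMap.toLp_fourier_eq, ← ofReal_norm, ← ofReal_norm,
      ← Lp.norm_fourier_eq]
    exact congrArg (fun W : Lp ℂ 2 (volume : Measure Vel) => ENNReal.ofReal ‖W‖)
      (map_sub (Lp.fourierTransformₗᵢ Vel ℂ) _ _)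
  rw [e1, e2, Lp.enorm_def]
  refine eLpNorm_mono_ae ?_
  filter_upwards [(𝓕 (besselTwo G) : 𝓢(Vel, ℂ)).coeFn_toLp 2 volume,
      Lp.coeFn_sub V ((𝓕 (besselTwo G) : 𝓢(Vel, ℂ)).toLp 2 volume)] with ξ h2 h3
  rw [h3, Pi.sub_apply, h2, fourier_besselTwo]
  have h4 : (1 : ℝ) ≤ 1 + ‖ξ‖ ^ 2 := by nlinarith [sq_nonneg ‖ξ‖]
  have h5 : ((1 + ‖ξ‖ ^ 2 : ℝ) : ℂ) ≠ 0 := by exact_mod_cast (by linarith : (1 + ‖ξ‖ ^ 2 : ℝ) ≠ 0)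
  have h6 : ((1 + ‖ξ‖ ^ 2 : ℝ) : ℂ) * V ξ - G ξ =
      ((1 + ‖ξ‖ ^ 2 : ℝ) : ℂ) * (V ξ - ((1 + ‖ξ‖ ^ 2)⁻¹ : ℝ) • G ξ) := by
    rw [Complex.real_smul, Complex.ofReal_inv]
    field_simp
  rw [h6, norm_mul, Complex.norm_real, Real.norm_eq_abs, abs_of_pos (by linarith)]
  exact le_mul_of_one_le_left (norm_nonneg _) h4

/-- The pointwise Sobolev bound passes to the limit: k is the L² limit of the potentials of Schwartz
functions Gₙ tending to U, hence an almost everywhere limit along a subsequence, and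
`enorm_besselTwo_le` applies to Gₙ - G. -/
theorem enorm_sub_besselTwo_le {k : Vel → ℂ} (hk : MemLp k 2) (G : 𝓢(Vel, ℂ))
    (hU : MemLp (fun ξ => ((1 + ‖ξ‖ ^ 2 : ℝ) : ℂ) *
      (𝓕 (hk.toLp k) : Lp ℂ 2 (volume : Measure Vel)) ξ) 2) :
    ∀ᵐ x, ‖k x - besselTwo G x‖ₑ ≤ besselConst * eLpNorm (fun ξ =>
      ((1 + ‖ξ‖ ^ 2 : ℝ) : ℂ) * (𝓕 (hk.toLp k) : Lp ℂ 2 (volume : Measure Vel)) ξ - G ξ) 2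
        volume := by
  have hsub := eLpNorm_sub_besselTwo_le hk
  set U : Vel → ℂ := fun ξ => ((1 + ‖ξ‖ ^ 2 : ℝ) : ℂ) *
      (𝓕 (hk.toLp k) : Lp ℂ 2 (volume : Measure Vel)) ξ with hUdef
  have hseq (n : ℕ) : ∃ G : 𝓢(Vel, ℂ), eLpNorm (fun ξ => U ξ - G ξ) 2 volume < (n : ℝ≥0∞)⁻¹ :=
    exists_schwartz_eLpNorm_sub_lt hU (by simp)
  choose Gn hGn using hseq
  have hGlim : Tendsto (fun n => eLpNorm (fun ξ => U ξ - Gn n ξ) 2 volume) atTop (𝓝 0) :=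
    tendsto_of_tendsto_of_tendsto_of_le_of_le tendsto_const_nhds
      ENNReal.tendsto_inv_nat_nhds_zero (fun _ => zero_le) fun n => (hGn n).le
  have hlim : Tendsto (fun n => eLpNorm ((fun x => besselTwo (Gn n) x) - k) 2 volume) atTop
      (𝓝 0) := by
    refine tendsto_of_tendsto_of_tendsto_of_le_of_le tendsto_const_nhds hGlim
      (fun _ => zero_le) fun n => ?_
    rw [eLpNorm_sub_comm]
    exact hsub (Gn n)
  obtain ⟨ns, hns, hae⟩ := (tendstoInMeasure_of_tendsto_eLpNorm (by norm_num)
    (fun n => (besselTwo (Gn n)).continuous.aestronglyMeasurable) hk.1 hlim).exists_seq_tendsto_ae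
  filter_upwards [hae] with x hx
  have hx1 : Tendsto (fun n => ‖besselTwo (Gn (ns n)) x - besselTwo G x‖ₑ) atTop
      (𝓝 ‖k x - besselTwo G x‖ₑ) := (hx.sub_const _).enorm
  have hx2 : Tendsto (fun n => besselConst * (eLpNorm (fun ξ => U ξ - Gn (ns n) ξ) 2 volume +
      eLpNorm (fun ξ => U ξ - G ξ) 2 volume)) atTop
      (𝓝 (besselConst * (0 + eLpNorm (fun ξ => U ξ - G ξ) 2 volume))) :=
    ENNReal.Tendsto.const_mul ((hGlim.comp hns.tendsto_atTop).add tendsto_const_nhds)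
      (Or.inr besselConst_ne_top)
  rw [zero_add] at hx2
  refine le_of_tendsto_of_tendsto' hx1 hx2 fun n => ?_
  have h1 := enorm_besselTwo_le (Gn (ns n) - G) x
  rw [besselTwo_sub, sub_apply] at h1
  refine h1.trans ?_
  gcongr
  have h2 : (⇑(Gn (ns n) - G) : Vel → ℂ) =
      (fun ξ => U ξ - G ξ) - (fun ξ => U ξ - Gn (ns n) ξ) := by
    funext ξ
    simp only [sub_apply, Pi.sub_apply]
    ring
  rw [h2, add_comm]
  exact eLpNorm_sub_le (hU.1.sub G.continuous.aestronglyMeasurable)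
    (hU.1.sub (Gn (ns n)).continuous.aestronglyMeasurable) (by norm_num)

/-- A function in `H²` is approximated in `L² ∩ L^∞` by twice differentiable functions with
controlled derivatives. -/
theorem exists_sobolev_approx : ∃ C : ℝ≥0∞, C ≠ ⊤ ∧ ∀ (k : Vel → ℝ)
    (hk : MemLp (fun v => (k v : ℂ)) 2), ∀ A : ℝ≥0∞, A ≠ ⊤ →
    eLpNorm (fun ξ : Vel => ((Real.sqrt (1 + (2 * Real.pi * ‖ξ‖) ^ 2) ^ 2 : ℝ) : ℂ) *
        (𝓕 (hk.toLp (fun v => (k v : ℂ))) : Lp ℂ 2 (volume : Measure Vel)) ξ) 2 volume ≤ A →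
    ∀ ε : ℝ≥0∞, 0 < ε → ∃ k' N : Vel → ℝ, Continuous k' ∧ Continuous N ∧
      (∀ x p, HasSecondOrderBound (fun t => k' (x + t • p)) (fun t => N (x + t • p)) ‖p‖) ∧
      l2norm (fun x => ENNReal.ofReal (N x)) ≤ C * (A + ε) ∧
      (∀ x, ‖k' x‖ₑ ≤ C * (A + ε)) ∧
      l2norm (fun x => ‖k x - k' x‖ₑ) ≤ C * ε ∧
      ∀ᵐ x, ‖k x - k' x‖ₑ ≤ C * ε := by
  obtain ⟨C₀, hC₀, hN⟩ := exists_l2norm_secondOrderSize_le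
  refine ⟨C₀ + besselConst + 1, by simp [hC₀, besselConst_ne_top], fun k hk A hA hkA ε hε => ?_⟩
  set V : Lp ℂ 2 (volume : Measure Vel) := 𝓕 (hk.toLp (fun v => (k v : ℂ))) with hV
  set U : Vel → ℂ := fun ξ => ((1 + ‖ξ‖ ^ 2 : ℝ) : ℂ) * V ξ with hUdef
  -- The multiplier 1 + |ξ|² without the factor 2π is dominated by the one of the norm.
  have hUA : eLpNorm U 2 volume ≤ A := by
    refine (eLpNorm_mono fun ξ => ?_).trans hkA
    rw [hUdef, norm_mul, norm_mul, Complex.norm_real, Complex.norm_real]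
    gcongr
    rw [Real.sq_sqrt (by positivity), Real.norm_eq_abs, Real.norm_eq_abs, abs_of_pos
      (by positivity),
      abs_of_pos (by positivity), mul_pow]
    have : (1 : ℝ) ≤ (2 * Real.pi) ^ 2 := by nlinarith [Real.pi_gt_three]
    nlinarith [sq_nonneg ‖ξ‖]
  have hUm : AEStronglyMeasurable U volume := by
    have hc : Continuous fun ξ : Vel => ((1 + ‖ξ‖ ^ 2 : ℝ) : ℂ) := by fun_prop
    exact hc.aestronglyMeasurable.mul (Lp.aestronglyMeasurable V)
  have hU : MemLp U 2 := ⟨hUm, hUA.trans_lt hA.lt_top⟩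
  -- The approximation takes place on the Fourier side, after multiplication by 1 + |ξ|²; the
  -- approximant k' is the real part of the potential of G.
  obtain ⟨G, hG⟩ := exists_schwartz_eLpNorm_sub_lt hU hε
  have hGA : eLpNorm G 2 volume ≤ A + ε := by
    have h2 : (⇑G : Vel → ℂ) = U - (fun ξ => U ξ - G ξ) := by
      funext ξ
      simp
    rw [h2]
    exact (eLpNorm_sub_le hUm (hUm.sub G.continuous.aestronglyMeasurable) (by norm_num)).trans
      (add_le_add hUA hG.le)
  have hre : ∀ x, ‖k x - (besselTwo G x).re‖ₑ ≤ ‖(k x : ℂ) - besselTwo G x‖ₑ := by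
    intro x
    rw [← ofReal_norm, ← ofReal_norm]
    refine ENNReal.ofReal_le_ofReal ?_
    have := Complex.abs_re_le_norm ((k x : ℂ) - besselTwo G x)
    simpa using this
  have c1 : besselConst ≤ C₀ + besselConst + 1 := by
    rw [add_assoc, add_comm besselConst, ← add_assoc]
    exact le_add_self
  refine ⟨fun x => (besselTwo G x).re, secondOrderSize (besselTwo G),
    Complex.continuous_re.comp (besselTwo G).continuous, continuous_secondOrderSize _,
    hasSecondOrderBound_re _, ?_, fun x => ?_, ?_, ?_⟩
  · refine (hN G).trans (mul_le_mul' ?_ hGA)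
    rw [add_assoc]
    exact le_self_add
  · refine le_trans ?_ ((enorm_besselTwo_le G x).trans (mul_le_mul' c1 hGA))
    rw [← ofReal_norm, ← ofReal_norm]
    exact ENNReal.ofReal_le_ofReal (Complex.abs_re_le_norm _)
  · refine (l2norm_mono (Eventually.of_forall hre)).trans ?_
    rw [← eLpNorm_two_eq_l2norm]
    refine (eLpNorm_sub_besselTwo_le hk G).trans (hG.le.trans ?_)
    exact le_mul_of_one_le_left zero_le le_add_self
  · filter_upwards [enorm_sub_besselTwo_le hk G hU] with x hx
    exact (hre x).trans (hx.trans (mul_le_mul' c1 hG.le))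

end

/-! ### Brackets and Maxwellian along a line -/

theorem sqrt_maxwellian (v : Vel) : Real.sqrt (maxwellian v) =
    Real.sqrt ((2 * Real.pi) ^ (-(3 / 2 : ℝ))) * Real.exp (-‖v‖ ^ 2 / 4) := by
  rw [maxwellian, Real.sqrt_mul (by positivity)]
  congr 1
  rw [Real.sqrt_eq_iff_mul_self_eq (by positivity) (by positivity), ← Real.exp_add]
  ring_nf

theorem sqrt_maxwellian_pos (v : Vel) : 0 < Real.sqrt (maxwellian v) := by
  rw [sqrt_maxwellian]
  have := Real.pi_pos
  positivity

theorem measurable_maxwellian : Measurable maxwellian := by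
  unfold maxwellian; fun_prop

theorem sqrt_maxwellian_const_le : Real.sqrt ((2 * Real.pi) ^ (-(3 / 2 : ℝ))) ≤ 1 := by
  rw [Real.sqrt_le_iff]
  refine ⟨zero_le_one, ?_⟩
  rw [one_pow]
  exact Real.rpow_le_one_of_one_le_of_nonpos (by linarith [Real.pi_gt_three]) (by norm_num)

/-- Half of the decay is given up to match `hasSecondOrderBound_sqrt_maxwellian`, where it pays for
polynomial factors. -/
theorem sqrt_maxwellian_le (v : Vel) : Real.sqrt (maxwellian v) ≤ Real.exp (-‖v‖ ^ 2 / 8) := by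
  rw [sqrt_maxwellian]
  refine (mul_le_of_le_one_left (by positivity) sqrt_maxwellian_const_le).trans ?_
  refine Real.exp_le_exp.2 ?_
  nlinarith [sq_nonneg ‖v‖]

/-- The chain rule for ρ(t) = 1 + |x+tp|², where |ρ'| ≤ 2ρ|p|, |ρ'|² ≤ 4ρ|p|² and ρ'' = 2|p|². The
hypotheses on F' and F'' carry exactly these factors. -/
theorem hasSecondOrderBound_radial {F F' F'' G : ℝ → ℝ}
    (h1 : ∀ r, 1 ≤ r → HasDerivAt F (F' r) r) (h2 : ∀ r, 1 ≤ r → HasDerivAt F' (F'' r) r)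
    (hc : ContinuousOn F'' (Set.Ici 1)) (b0 : ∀ r, 1 ≤ r → |F r| ≤ G r)
    (b1 : ∀ r, 1 ≤ r → |F' r| * (2 * r) ≤ G r)
    (b2 : ∀ r, 1 ≤ r → |F'' r| * (4 * r) + 2 * |F' r| ≤ G r) (x p : Vel) :
    HasSecondOrderBound (fun t => F (1 + ‖x + t • p‖ ^ 2)) (fun t => G (1 + ‖x + t • p‖ ^ 2))
      ‖p‖ := by
  have hone (t : ℝ) : 1 ≤ 1 + ‖x + t • p‖ ^ 2 := by nlinarith [sq_nonneg ‖x + t • p‖]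
  have hline (t : ℝ) : HasDerivAt (fun t : ℝ => x + t • p) p t := by
    simpa using ((hasDerivAt_id t).smul_const p).const_add x
  have d1 (t : ℝ) : HasDerivAt (fun t : ℝ => 1 + ‖x + t • p‖ ^ 2)
      (2 * inner ℝ (x + t • p) p) t := (hline t).norm_sq.const_add 1
  have d2 (t : ℝ) : HasDerivAt (fun t : ℝ => 2 * inner ℝ (x + t • p) p) (2 * ‖p‖ ^ 2) t := by
    have := ((hline t).inner ℝ (hasDerivAt_const t p)).const_mul 2
    simpa using this
  have cρ : Continuous fun t : ℝ => 1 + ‖x + t • p‖ ^ 2 := by fun_prop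
  refine ⟨fun t => F' (1 + ‖x + t • p‖ ^ 2) * (2 * inner ℝ (x + t • p) p),
    fun t => F'' (1 + ‖x + t • p‖ ^ 2) * (2 * inner ℝ (x + t • p) p) *
      (2 * inner ℝ (x + t • p) p) + F' (1 + ‖x + t • p‖ ^ 2) * (2 * ‖p‖ ^ 2),
    fun t => (h1 _ (hone t)).comp t (d1 t),
    fun t => ((h2 _ (hone t)).comp t (d1 t)).mul (d2 t), ?_, fun t => ?_⟩
  · have c2 : Continuous fun t : ℝ => F'' (1 + ‖x + t • p‖ ^ 2) :=
      hc.comp_continuous cρ hone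
    have c1 : Continuous fun t : ℝ => F' (1 + ‖x + t • p‖ ^ 2) :=
      continuous_iff_continuousAt.2 fun t => ((h2 _ (hone t)).comp t (d1 t)).continuousAt
    have c0 : Continuous fun t : ℝ => 2 * inner ℝ (x + t • p) p := by fun_prop
    exact ((c2.mul c0).mul c0).add (c1.mul continuous_const)
  · have hr := hone t
    have hin : |2 * inner ℝ (x + t • p) p| ≤ 2 * (‖x + t • p‖ * ‖p‖) := by
      rw [abs_mul, abs_of_pos (two_pos : (0 : ℝ) < 2)]
      gcongr
      exact abs_real_inner_le_norm _ _
    beta_reduce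
    generalize 2 * inner ℝ (x + t • p) p = I at *
    set n := ‖x + t • p‖
    have hn : 0 ≤ n := norm_nonneg _
    have hP := norm_nonneg p
    set P := ‖p‖
    set r := 1 + n ^ 2
    have hI1 : |I| ≤ 2 * r * P := hin.trans (by nlinarith [sq_nonneg (n - 1)])
    have hI2 : |I| * |I| ≤ 4 * r * P ^ 2 := by
      calc |I| * |I| ≤ (2 * (n * P)) * (2 * (n * P)) := by gcongr
        _ ≤ _ := by nlinarith [sq_nonneg P]
    refine ⟨b0 _ hr, ?_, ?_⟩
    · rw [abs_mul]
      calc |F' r| * |I| ≤ |F' r| * (2 * r * P) := by gcongr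
        _ = |F' r| * (2 * r) * P := by ring
        _ ≤ _ := by gcongr; exact b1 _ hr
    · refine (abs_add_le _ _).trans ?_
      rw [abs_mul, abs_mul, abs_mul, abs_of_nonneg (by positivity : 0 ≤ 2 * P ^ 2), mul_assoc]
      calc |F'' r| * (|I| * |I|) + |F' r| * (2 * P ^ 2)
          ≤ |F'' r| * (4 * r * P ^ 2) + |F' r| * (2 * P ^ 2) := by gcongr
        _ = (|F'' r| * (4 * r) + 2 * |F' r|) * P ^ 2 := by ring
        _ ≤ _ := by gcongr; exact b2 _ hr

theorem japaneseBracket_rpow_eq (r : ℝ) (v : Vel) :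
    japaneseBracket v ^ r = (1 + ‖v‖ ^ 2) ^ (r / 2) := by
  rw [japaneseBracket, Real.sqrt_eq_rpow, ← Real.rpow_mul (by positivity)]
  ring_nf

/-- With z = 1 + |x+tp|² ≥ 1, each derivative of z^(r/2) in z lowers the power by one, so a multiple
of the function itself is a majorant. -/
theorem exists_hasSecondOrderBound_japaneseBracket (r : ℝ) : ∃ C : ℝ, 0 < C ∧ ∀ x p : Vel,
    HasSecondOrderBound (fun t => japaneseBracket (x + t • p) ^ r)
      (fun t => C * japaneseBracket (x + t • p) ^ r) ‖p‖ := by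
  set a := r / 2 with ha
  refine ⟨1 + 2 * |a| + |a * (a - 1)| * 4, by positivity, fun x p => ?_⟩
  simp_rw [japaneseBracket_rpow_eq r]
  have e1 (z : ℝ) (hz : 1 ≤ z) : z ^ (a - 1) * z = z ^ a := by
    rw [← Real.rpow_add_one (by positivity)]; ring_nf
  have e2 (z : ℝ) (hz : 1 ≤ z) : z ^ (a - 1 - 1) * z = z ^ (a - 1) := by
    rw [← Real.rpow_add_one (by positivity)]; ring_nf
  have e3 (z : ℝ) (hz : 1 ≤ z) : z ^ (a - 1) ≤ z ^ a :=
    Real.rpow_le_rpow_of_exponent_le hz (by linarith)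
  refine hasSecondOrderBound_radial (F := fun z => z ^ a) (F' := fun z => a * z ^ (a - 1))
    (F'' := fun z => a * ((a - 1) * z ^ (a - 1 - 1)))
    (G := fun z => (1 + 2 * |a| + |a * (a - 1)| * 4) * z ^ a)
    (fun z hz => Real.hasDerivAt_rpow_const (Or.inl (by positivity)))
    (fun z hz => (Real.hasDerivAt_rpow_const (Or.inl (by positivity))).const_mul a) ?_
    (fun z hz => ?_) (fun z hz => ?_) (fun z hz => ?_) x p
  · refine continuousOn_const.mul (continuousOn_const.mul ?_)
    exact fun z hz => (Real.continuousAt_rpow_const z _ (Or.inl (by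
      have : (1 : ℝ) ≤ z := hz
      positivity))).continuousWithinAt
  · have : 0 < z ^ a := by positivity
    rw [abs_of_pos this]
    refine le_mul_of_one_le_left this.le ?_
    have := abs_nonneg a
    have := abs_nonneg (a * (a - 1))
    linarith
  · have h0 : 0 < z ^ a := by positivity
    have h1 : 0 < z ^ (a - 1) := by positivity
    have h2 := e1 z hz
    rw [abs_mul, abs_of_pos h1, show |a| * z ^ (a - 1) * (2 * z) = 2 * |a| * (z ^ (a - 1) * z) by
      ring,
      h2]
    gcongr
    have := abs_nonneg (a * (a - 1))
    linarith
  · have h0 : 0 < z ^ a := by positivity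
    have h1 : 0 < z ^ (a - 1) := by positivity
    have h2 : 0 < z ^ (a - 1 - 1) := by positivity
    rw [show a * ((a - 1) * z ^ (a - 1 - 1)) = a * (a - 1) * z ^ (a - 1 - 1) by ring,
      abs_mul _ (z ^ (a - 1 - 1)), abs_of_pos h2, abs_mul a (z ^ (a - 1)), abs_of_pos h1]
    calc |a * (a - 1)| * z ^ (a - 1 - 1) * (4 * z) + 2 * (|a| * z ^ (a - 1))
        = |a * (a - 1)| * 4 * (z ^ (a - 1 - 1) * z) + 2 * |a| * z ^ (a - 1) := by ring
      _ ≤ |a * (a - 1)| * 4 * z ^ a + 2 * |a| * z ^ a := by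
        rw [e2 z hz]
        gcongr
        all_goals linarith
      _ ≤ _ := by nlinarith

theorem hasSecondOrderBound_sqrt_maxwellian (x p : Vel) :
    HasSecondOrderBound (fun t => Real.sqrt (maxwellian (x + t • p)))
      (fun t => 8 * Real.exp (-‖x + t • p‖ ^ 2 / 8)) ‖p‖ := by
  set c := Real.sqrt ((2 * Real.pi) ^ (-(3 / 2 : ℝ))) with hc
  have hc0 : 0 ≤ c := Real.sqrt_nonneg _
  have hc1 : c ≤ 1 := sqrt_maxwellian_const_le
  have h := hasSecondOrderBound_radial (F := fun z => c * Real.exp ((1 - z) / 4))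
    (F' := fun z => c * (Real.exp ((1 - z) / 4) * (-1 / 4)))
    (F'' := fun z => c * (Real.exp ((1 - z) / 4) * (-1 / 4) * (-1 / 4)))
    (G := fun z => 8 * Real.exp ((1 - z) / 8)) ?_ ?_ (by fun_prop) ?_ ?_ ?_ x p
  · simp_rw [sqrt_maxwellian]
    convert h using 4 <;> ring
  · intro r _
    exact (((hasDerivAt_id r).const_sub 1).div_const 4).exp.const_mul c
  · intro r _
    exact ((((hasDerivAt_id r).const_sub 1).div_const 4).exp.mul_const (-1 / 4)).const_mul c
  all_goals
    intro r hr
    have e : Real.exp ((1 - r) / 4) = Real.exp ((1 - r) / 8) * Real.exp ((1 - r) / 8) := by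
      rw [← Real.exp_add]; ring_nf
    have e2 : 1 + (r - 1) / 8 ≤ Real.exp ((r - 1) / 8) := by
      have := Real.add_one_le_exp ((r - 1) / 8); linarith
    have e3 : Real.exp ((r - 1) / 8) * Real.exp ((1 - r) / 8) = 1 := by
      rw [← Real.exp_add]; ring_nf; exact Real.exp_zero
    -- This is 1 + x ≤ exp x at x = (r-1)/8; the factor r + 7 dominates the powers of r produced by
    -- the chain rule.
    have e4 : (r + 7) * Real.exp ((1 - r) / 8) ≤ 8 := by
      nlinarith [Real.exp_pos ((1 - r) / 8)]
    have hE : c * Real.exp ((1 - r) / 4) ≤ Real.exp ((1 - r) / 4) :=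
      mul_le_of_le_one_left (Real.exp_pos _).le hc1
    have hE0 : 0 ≤ c * Real.exp ((1 - r) / 4) := by positivity
    have hE1 : Real.exp ((1 - r) / 4) * (r + 7) ≤ 8 * Real.exp ((1 - r) / 8) := by
      rw [e]; nlinarith [Real.exp_pos ((1 - r) / 8)]
    have hE2 : c * Real.exp ((1 - r) / 4) * (r + 7) ≤ 8 * Real.exp ((1 - r) / 8) :=
      (mul_le_mul_of_nonneg_right hE (by linarith)).trans hE1
  · rw [abs_of_nonneg hE0]
    nlinarith
  · rw [show c * (Real.exp ((1 - r) / 4) * (-1 / 4)) = -(c * Real.exp ((1 - r) / 4) / 4) by ring,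
      abs_neg, abs_of_nonneg (by positivity)]
    nlinarith
  · rw [show c * (Real.exp ((1 - r) / 4) * (-1 / 4) * (-1 / 4)) =
      c * Real.exp ((1 - r) / 4) / 16 by ring,
      show c * (Real.exp ((1 - r) / 4) * (-1 / 4)) = -(c * Real.exp ((1 - r) / 4) / 4) by ring,
      abs_neg, abs_of_nonneg (by positivity), abs_of_nonneg (by positivity)]
    nlinarith

/-! ### The trilinear form and its symmetrisation -/

instance : SFinite ((volume : Measure Vel).prod sphereMeasure) := Measure.prod.instSFinite

instance : SFinite tripleMeasure := Measure.prod.instSFinite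

/-- The trilinear form in Carleman variables, with the velocity shift scaled by `t`. -/
def carlemanForm (γ : ℝ) (Φ : ℝ → ℝ) (t : ℝ) (g h f : Vel → ℝ) (x : Vel × Vel × S2) : ℝ :=
  angularKernel Φ x.2 * (‖x.2.1‖ ^ γ * (g x.1 * f (x.1 + x.2.1)) *
    (h (x.1 + x.2.1 + t • carlemanShift x.2) *
      Real.sqrt (maxwellian (x.1 + t • carlemanShift x.2))))

theorem measurable_carlemanForm (γ : ℝ) {Φ : ℝ → ℝ} (hΦ : Measurable Φ) (t : ℝ) {g h f : Vel → ℝ}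
    (hg : Measurable g) (hh : Measurable h) (hf : Measurable f) :
    Measurable (carlemanForm γ Φ t g h f) := by
  have := measurable_angularKernel hΦ
  have := measurable_carlemanShift
  have := measurable_maxwellian
  unfold carlemanForm
  fun_prop

theorem weighted_neg_weighted (l : ℝ) (f : Vel → ℝ) (v : Vel) :
    japaneseBracket v ^ (-l) * weighted l f v = f v := by
  have := japaneseBracket_pos v
  rw [weighted, ← mul_assoc, ← Real.rpow_add this]
  simp

theorem abs_eq_weighted (l : ℝ) (f : Vel → ℝ) (v : Vel) :
    |f v| = japaneseBracket v ^ (-l) * |weighted l f v| := by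
  have := japaneseBracket_pos v
  rw [← abs_of_pos (Real.rpow_pos_of_pos this (-l)), ← abs_mul, weighted_neg_weighted]

theorem measurable_weighted (l : ℝ) {f : Vel → ℝ} (hf : Measurable f) :
    Measurable (weighted l f) := by
  have := measurable_japaneseBracket
  unfold weighted; fun_prop

theorem enorm_carlemanForm_le (γ : ℝ) (Φ : ℝ → ℝ) (t : ℝ) (g h f : Vel → ℝ)
    (x : Vel × Vel × S2) :
    ‖carlemanForm γ Φ t g h f x‖ₑ ≤ ENNReal.ofReal |angularKernel Φ x.2| *
      (ENNReal.ofReal (carlemanWeight γ γ x.1 x.2.1 (t • carlemanShift x.2)) *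
        (‖g x.1‖ₑ * ‖weighted (γ / 2) f (x.1 + x.2.1)‖ₑ *
          ‖weighted (γ / 2 + 2) h (x.1 + x.2.1 + t • carlemanShift x.2)‖ₑ)) := by
  have hW := carlemanWeight_nonneg γ γ x.1 x.2.1 (t • carlemanShift x.2)
  simp_rw [← ofReal_norm, Real.norm_eq_abs]
  rw [← ENNReal.ofReal_mul (by positivity), ← ENNReal.ofReal_mul (by positivity),
    ← ENNReal.ofReal_mul hW, ← ENNReal.ofReal_mul (by positivity)]
  refine ENNReal.ofReal_le_ofReal ?_
  unfold carlemanForm carlemanWeight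
  simp only [abs_mul]
  rw [abs_eq_weighted (γ / 2) f, abs_eq_weighted (γ / 2 + 2) h,
    abs_of_pos (sqrt_maxwellian_pos _), abs_of_nonneg (Real.rpow_nonneg (norm_nonneg _) γ)]
  have h1 := sqrt_maxwellian_le (x.1 + t • carlemanShift x.2)
  have h2 := japaneseBracket_pos (x.1 + x.2.1)
  have h3 := japaneseBracket_pos (x.1 + x.2.1 + t • carlemanShift x.2)
  refine mul_le_mul_of_nonneg_left ?_ (abs_nonneg _)
  calc _ = ‖x.2.1‖ ^ γ * japaneseBracket (x.1 + x.2.1) ^ (-(γ / 2)) *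
        japaneseBracket (x.1 + x.2.1 + t • carlemanShift x.2) ^ (-(γ / 2 + 2)) *
        Real.sqrt (maxwellian (x.1 + t • carlemanShift x.2)) * (|g x.1| *
        |weighted (γ / 2) f (x.1 + x.2.1)| *
        |weighted (γ / 2 + 2) h (x.1 + x.2.1 + t • carlemanShift x.2)|) := by ring
    _ ≤ _ := by gcongr

/-- The mass of an angular function. -/
def angularMass (Φ : ℝ → ℝ) : ℝ≥0∞ := ∫⁻ x in Set.Ioo (0 : ℝ) 1, ENNReal.ofReal |Φ x|

/-- The bound for the trilinear form in Carleman variables by the mass of the kernel. -/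
theorem exists_lintegral_carlemanForm_le {γ : ℝ} (hγ : -3 < γ) : ∃ C : ℝ≥0∞, C ≠ ⊤ ∧
    ∀ (Φ : ℝ → ℝ) (t : ℝ), Measurable Φ → (∀ x, Φ x ≠ 0 → t = 0 ∨ 1 / 2 ≤ x ^ 2) → |t| ≤ 1 →
    ∀ g h f : Vel → ℝ, Measurable g → Measurable h → Measurable f →
    ∀ S : ℝ≥0∞, (∀ᵐ x, ‖weighted (γ / 2 + 2) h x‖ₑ ≤ S) →
      ∫⁻ x, ‖carlemanForm γ Φ t g h f x‖ₑ ∂tripleMeasure ≤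
        C * angularMass Φ * (l2norm (fun x => ‖g x‖ₑ) * l2norm (fun x => ‖weighted (γ / 2) f x‖ₑ) *
          (l2norm (fun x => ‖weighted (γ / 2 + 2) h x‖ₑ) + S)) := by
  obtain ⟨C, hC, hle⟩ := exists_trilinear_le hγ
  refine ⟨C * ENNReal.ofReal (2 * Real.pi), ENNReal.mul_ne_top hC ENNReal.ofReal_ne_top,
    fun Φ t hΦ hsupp ht g h f hg hh hf S hS => ?_⟩
  have m1 := measurable_weighted (γ / 2) hf
  have m2 := measurable_weighted (γ / 2 + 2) hh
  refine (lintegral_mono fun x => enorm_carlemanForm_le γ Φ t g h f x).trans ?_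
  refine (hle _ _ _ (isCarlemanKernel_angularKernel hΦ hsupp ht) (fun x => ‖g x‖ₑ)
    (fun x => ‖weighted (γ / 2) f x‖ₑ) (fun x => ‖weighted (γ / 2 + 2) h x‖ₑ) (by fun_prop)
    (by fun_prop) (by fun_prop) S hS).trans (le_of_eq ?_)
  unfold angularMass
  ring

theorem carlemanForm_axisRotation (γ : ℝ) (Φ : ℝ → ℝ) (t : ℝ) (g h f : Vel → ℝ)
    (x : Vel × Vel × S2) :
    carlemanForm γ Φ t g h f (x.1, axisRotation x.2) = carlemanForm γ Φ (-t) g h f x := by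
  unfold carlemanForm
  rw [angularKernel_axisRotation]
  by_cases hx : 0 < inner ℝ x.2.1 (x.2.2 : Vel)
  · rw [carlemanShift_axisRotation hx.ne', smul_neg, neg_smul]
    rfl
  · simp [angularKernel, hx]

theorem measurePreserving_prod_axisRotation :
    MeasurePreserving (fun x : Vel × Vel × S2 => (x.1, axisRotation x.2))
      tripleMeasure tripleMeasure :=
  (MeasurePreserving.id (volume : Measure Vel)).prod measurePreserving_axisRotation

/-- The half turn of k about y preserves the measure and the angular kernel and reverses the shift.
-/
theorem integral_carlemanForm_neg (γ : ℝ) {Φ : ℝ → ℝ} (hΦ : Measurable Φ) (t : ℝ)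
    {g h f : Vel → ℝ} (hg : Measurable g) (hh : Measurable h) (hf : Measurable f) :
    ∫ x, carlemanForm γ Φ (-t) g h f x ∂tripleMeasure =
      ∫ x, carlemanForm γ Φ t g h f x ∂tripleMeasure := by
  simp_rw [← carlemanForm_axisRotation]
  conv_rhs => rw [← measurePreserving_prod_axisRotation.map_eq]
  rw [integral_map measurePreserving_prod_axisRotation.aemeasurable
    (measurable_carlemanForm γ hΦ t hg hh hf).aestronglyMeasurable]

theorem exists_second_difference_le (l : ℝ) : ∃ C : ℝ, 0 < C ∧ ∀ k N : Vel → ℝ, Continuous N →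
    (∀ x p, HasSecondOrderBound (fun t => k (x + t • p)) (fun t => N (x + t • p)) ‖p‖) →
    ∀ u w p : Vel, |(japaneseBracket (u + p) ^ (-l) * k (u + p)) * Real.sqrt (maxwellian (w + p)) +
      (japaneseBracket (u - p) ^ (-l) * k (u - p)) * Real.sqrt (maxwellian (w - p)) -
      2 * ((japaneseBracket u ^ (-l) * k u) * Real.sqrt (maxwellian w))| ≤
      C * ∫ t in (-1)..1, (japaneseBracket (u + t • p) ^ (-l) * Real.exp (-‖w + t • p‖ ^ 2 / 8) *
        N (u + t • p)) * ‖p‖ ^ 2 := by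
  obtain ⟨C, hC, hj⟩ := exists_hasSecondOrderBound_japaneseBracket (-l)
  -- 128 = 4 · 4 · 8: two applications of the product rule, and the constant in the bound of the
  -- Maxwellian.
  refine ⟨128 * C, by positivity, fun k N hN hk u w p => ?_⟩
  have h := ((hj u p).mul (norm_nonneg p) (hk u p)).mul (norm_nonneg p)
    (hasSecondOrderBound_sqrt_maxwellian w p)
  have hc : Continuous fun t : ℝ => japaneseBracket (u + t • p) ^ (-l) := by
    refine (continuous_japaneseBracket.comp (by fun_prop)).rpow_const fun t =>
      Or.inl (japaneseBracket_pos _).ne'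
  have h2 := h.abs_second_difference_le (by fun_prop)
  simp only [one_smul, neg_smul, zero_smul, add_zero, ← sub_eq_add_neg] at h2
  refine h2.trans (le_of_eq ?_)
  rw [← intervalIntegral.integral_const_mul]
  refine intervalIntegral.integral_congr fun t _ => ?_
  ring

/-- The gain in the trilinear form from the cancellation of the first-order terms. -/
theorem exists_carlemanForm_symm_le {γ : ℝ} (hγ : -3 < γ) : ∃ C : ℝ≥0∞, C ≠ ⊤ ∧
    ∀ Φ : ℝ → ℝ, Measurable Φ → (∀ x, Φ x ≠ 0 → 1 / 2 ≤ x ^ 2) →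
    ∀ g f k N : Vel → ℝ, Measurable g → Measurable f → Continuous N →
    (∀ x p, HasSecondOrderBound (fun t => k (x + t • p)) (fun t => N (x + t • p)) ‖p‖) →
      ∫⁻ x, ‖carlemanForm γ Φ 1 g (weighted (-(γ / 2 + 2)) k) f x +
          carlemanForm γ Φ (-1) g (weighted (-(γ / 2 + 2)) k) f x -
          2 * carlemanForm γ Φ 0 g (weighted (-(γ / 2 + 2)) k) f x‖ₑ ∂tripleMeasure ≤
        C * angularMass (fun x => Φ x * ((1 - x ^ 2) / x ^ 2)) *
          (l2norm (fun x => ‖g x‖ₑ) * l2norm (fun x => ‖weighted (γ / 2) f x‖ₑ) *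
            l2norm (fun x => ENNReal.ofReal (N x))) := by
  obtain ⟨C₁, hC₁, hfar⟩ := exists_trilinear_far_le hγ
  obtain ⟨C₂, hC₂, hdiff⟩ := exists_second_difference_le (γ / 2 + 2)
  refine ⟨ENNReal.ofReal C₂ * (2 * (C₁ * ENNReal.ofReal (2 * Real.pi))),
    by finiteness, fun Φ hΦ hsupp g f k N hg hf hN hk => ?_⟩
  have hj := measurable_japaneseBracket
  have hs := measurable_carlemanShift
  have m1 := measurable_weighted (γ / 2) hf
  have hNm := hN.measurable
  -- The gain |q|² = |y|²(1-c²)/c² is split: |y|² raises the exponent from γ to γ + 2, and the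
  -- angular factor enters the kernel Ψ.
  set Ψ : ℝ → ℝ := fun x => Φ x * ((1 - x ^ 2) / x ^ 2) with hΨdef
  have hΨ : Measurable Ψ := by fun_prop
  have hK := measurable_angularKernel hΨ
  have hΨs : ∀ x, Ψ x ≠ 0 → 1 / 2 ≤ x ^ 2 := fun x hx => hsupp x (left_ne_zero_of_mul hx)
  have hN0 : ∀ x, 0 ≤ N x := by
    intro x
    obtain ⟨_, _, _, _, _, h4⟩ := hk x 0
    have := (abs_nonneg _).trans (h4 0).1
    simpa using this
  set J : ℝ → Vel × Vel × S2 → ℝ≥0∞ := fun t x => ENNReal.ofReal |angularKernel Ψ x.2| *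
    (ENNReal.ofReal (carlemanWeight γ (γ + 2) x.1 x.2.1 (t • carlemanShift x.2)) *
      (‖g x.1‖ₑ * ‖weighted (γ / 2) f (x.1 + x.2.1)‖ₑ *
        ENNReal.ofReal (N (x.1 + x.2.1 + t • carlemanShift x.2)))) with hJ
  have hJm : Measurable (Function.uncurry J) := by
    unfold Function.uncurry
    simp only [hJ, carlemanWeight]
    fun_prop
  have hpt : ∀ x, ‖carlemanForm γ Φ 1 g (weighted (-(γ / 2 + 2)) k) f x +
      carlemanForm γ Φ (-1) g (weighted (-(γ / 2 + 2)) k) f x -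
      2 * carlemanForm γ Φ 0 g (weighted (-(γ / 2 + 2)) k) f x‖ₑ ≤
      ENNReal.ofReal C₂ * ∫⁻ t in Set.Ioc (-1 : ℝ) 1, J t x := by
    intro x
    by_cases hx : 0 < inner ℝ x.2.1 (x.2.2 : Vel)
    swap
    · have : angularKernel Φ x.2 = 0 := by simp [angularKernel, hx]
      simp [carlemanForm, this]
    have hy : x.2.1 ≠ 0 := by
      rintro h0
      simp [h0] at hx
    have hy0 := norm_pos_iff.2 hy
    have hd := hdiff k N hN hk (x.1 + x.2.1) x.1 (carlemanShift x.2)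
    set p := carlemanShift x.2 with hp
    have hp2 : ‖p‖ ^ 2 = _ := norm_carlemanShift_sq hx
    set u := x.1 + x.2.1 with hu
    have e1 : carlemanForm γ Φ 1 g (weighted (-(γ / 2 + 2)) k) f x +
        carlemanForm γ Φ (-1) g (weighted (-(γ / 2 + 2)) k) f x -
        2 * carlemanForm γ Φ 0 g (weighted (-(γ / 2 + 2)) k) f x =
        Φ (cosAngle x.2) * (‖x.2.1‖ ^ γ * (g x.1 * f u)) *
        ((japaneseBracket (u + p) ^ (-(γ / 2 + 2)) * k (u + p)) *
          Real.sqrt (maxwellian (x.1 + p)) +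
        (japaneseBracket (u - p) ^ (-(γ / 2 + 2)) * k (u - p)) *
          Real.sqrt (maxwellian (x.1 - p)) -
        2 * ((japaneseBracket u ^ (-(γ / 2 + 2)) * k u) * Real.sqrt (maxwellian x.1))) := by
      simp only [carlemanForm, weighted, angularKernel, hx, if_true, one_smul, neg_smul, zero_smul,
        add_zero, ← sub_eq_add_neg, ← hp, ← hu]
      ring
    have hcont : Continuous fun t : ℝ => (japaneseBracket (u + t • p) ^ (-(γ / 2 + 2)) *
        Real.exp (-‖x.1 + t • p‖ ^ 2 / 8) * N (u + t • p)) * ‖p‖ ^ 2 := by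
      have hc : Continuous fun t : ℝ => japaneseBracket (u + t • p) ^ (-(γ / 2 + 2)) := by
        refine (continuous_japaneseBracket.comp (by fun_prop)).rpow_const fun t =>
          Or.inl (japaneseBracket_pos _).ne'
      fun_prop
    have hnn : ∀ t : ℝ, 0 ≤ (japaneseBracket (u + t • p) ^ (-(γ / 2 + 2)) *
        Real.exp (-‖x.1 + t • p‖ ^ 2 / 8) * N (u + t • p)) * ‖p‖ ^ 2 := by
      intro t
      have := japaneseBracket_pos (u + t • p)
      have := hN0 (u + t • p)
      positivity
    have e2 : ENNReal.ofReal (∫ t in (-1)..1, (japaneseBracket (u + t • p) ^ (-(γ / 2 + 2)) *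
        Real.exp (-‖x.1 + t • p‖ ^ 2 / 8) * N (u + t • p)) * ‖p‖ ^ 2) =
        ∫⁻ t in Set.Ioc (-1 : ℝ) 1, ENNReal.ofReal ((japaneseBracket (u + t • p) ^
          (-(γ / 2 + 2)) * Real.exp (-‖x.1 + t • p‖ ^ 2 / 8) * N (u + t • p)) * ‖p‖ ^ 2) := by
      rw [intervalIntegral.integral_of_le (by norm_num),
        ofReal_integral_eq_lintegral_ofReal (hcont.integrableOn_Ioc)
          (Eventually.of_forall hnn)]
    rw [e1, enorm_mul, ← ofReal_norm (_ - _), Real.norm_eq_abs]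
    refine (mul_le_mul_right (ENNReal.ofReal_le_ofReal hd) _).trans ?_
    rw [ENNReal.ofReal_mul hC₂.le, e2, mul_left_comm, ← lintegral_const_mul _ (by fun_prop)]
    refine mul_le_mul_right (lintegral_mono fun t => le_of_eq ?_) _
    simp only [hJ, ← hp, ← hu]
    have hb := japaneseBracket_pos (u + t • p)
    have hW := carlemanWeight_nonneg γ (γ + 2) x.1 x.2.1 (t • p)
    have hNt := hN0 (u + t • p)
    simp_rw [← ofReal_norm, Real.norm_eq_abs]
    rw [← ENNReal.ofReal_mul (by positivity), ← ENNReal.ofReal_mul (by positivity),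
      ← ENNReal.ofReal_mul (by positivity),
      ← ENNReal.ofReal_mul hW, ← ENNReal.ofReal_mul (by positivity)]
    congr 1
    have e3 : |angularKernel Ψ x.2| * ‖x.2.1‖ ^ 2 = |Φ (cosAngle x.2)| * ‖p‖ ^ 2 := by
      rw [hp2]
      simp only [angularKernel, hx, if_true, hΨdef, abs_mul]
      have c0 := cosAngle_pos hx
      have c1 := cosAngle_le_one x.2
      have c2 : 0 ≤ (1 - cosAngle x.2 ^ 2) / cosAngle x.2 ^ 2 :=
        div_nonneg (by nlinarith) (by positivity)
      rw [abs_of_nonneg c2]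
      ring
    simp only [carlemanWeight, ← hu, abs_mul]
    rw [abs_eq_weighted (γ / 2) f, abs_of_nonneg (Real.rpow_nonneg (norm_nonneg _) γ),
      Real.rpow_add hy0, Real.rpow_two]
    linear_combination (-(‖x.2.1‖ ^ γ * |g x.1| * |weighted (γ / 2) f u| *
      japaneseBracket u ^ (-(γ / 2)) * japaneseBracket (u + t • p) ^ (-(γ / 2 + 2)) *
        Real.exp (-‖x.1 + t • p‖ ^ 2 / 8) * N (u + t • p))) * e3
  refine (lintegral_mono hpt).trans ?_
  have hJm2 : Measurable fun x => ∫⁻ t in Set.Ioc (-1 : ℝ) 1, J t x :=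
    (hJm.comp measurable_swap).lintegral_prod_right'
  rw [lintegral_const_mul _ hJm2, mul_assoc, mul_assoc]
  refine mul_le_mul_right ?_ _
  -- For every t in (-1, 1] the trilinear bound applies with the shift tq, uniformly in t; the
  -- interval contributes its length 2.
  rw [lintegral_lintegral_swap (f := fun x t => J t x) (hJm.comp measurable_swap).aemeasurable]
  have hB : ∀ t ∈ Set.Ioc (-1 : ℝ) 1, ∫⁻ x, J t x ∂tripleMeasure ≤
      C₁ * (ENNReal.ofReal (2 * Real.pi) * angularMass Ψ) *
        (l2norm (fun x => ‖g x‖ₑ) * l2norm (fun x => ‖weighted (γ / 2) f x‖ₑ) *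
          l2norm (fun x => ENNReal.ofReal (N x))) := by
    intro t ht
    exact hfar _ _ _ (isCarlemanKernel_angularKernel hΨ (fun x hx => Or.inr (hΨs x hx))
        (abs_le.2 ⟨ht.1.le, ht.2⟩))
      (fun x => ‖g x‖ₑ) (fun x => ‖weighted (γ / 2) f x‖ₑ) (fun x => ENNReal.ofReal (N x))
      (by fun_prop) (by fun_prop) (by fun_prop)
  refine (setLIntegral_mono' measurableSet_Ioc hB).trans (le_of_eq ?_)
  rw [setLIntegral_const, Real.volume_Ioc]
  norm_num
  ring

/-! ### The collision operator in Carleman variables -/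

theorem norm_post_sq (v w : Vel) (σ : S2) :
    ‖postV v w σ‖ ^ 2 + ‖postVStar v w σ‖ ^ 2 = ‖v‖ ^ 2 + ‖w‖ ^ 2 := by
  have h1 : ‖postV v w σ‖ ^ 2 + ‖postVStar v w σ‖ ^ 2 =
      2 * (‖(1 / 2 : ℝ) • (v + w)‖ ^ 2 + ‖(‖v - w‖ / 2) • (σ : Vel)‖ ^ 2) := by
    unfold postV postVStar
    have := parallelogram_law_with_norm ℝ ((1 / 2 : ℝ) • (v + w)) ((‖v - w‖ / 2) • (σ : Vel))
    exact this
  have h2 := parallelogram_law_with_norm ℝ v w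
  rw [h1, norm_smul, norm_smul, norm_sphere, Real.norm_eq_abs, Real.norm_eq_abs,
    abs_of_nonneg (by positivity : 0 ≤ ‖v - w‖ / 2), abs_of_pos (by norm_num : (0 : ℝ) < 1 / 2)]
  nlinarith

theorem sqrt_maxwellian_post (v w : Vel) (σ : S2) :
    Real.sqrt (maxwellian (postVStar v w σ)) * Real.sqrt (maxwellian (postV v w σ)) =
      Real.sqrt (maxwellian w) * Real.sqrt (maxwellian v) := by
  have h := norm_post_sq v w σ
  simp only [sqrt_maxwellian]
  rw [mul_mul_mul_comm, ← Real.exp_add, mul_mul_mul_comm (Real.sqrt _) (Real.exp (-‖w‖ ^ 2 / 4)),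
    ← Real.exp_add]
  congr 2
  linarith

/-- The integrand of the triple integral that gives `⟨Γ_β(g,h), f⟩`. -/
def pairingIntegrand (γ : ℝ) (β : ℝ → ℝ) (g h f : Vel → ℝ) (p : Vel × Vel × S2) : ℝ :=
  (Real.sqrt (maxwellian p.1))⁻¹ *
    collisionIntegrand γ β (sqrtMaxwellianMul g) (sqrtMaxwellianMul h) p.1 p.2.1 p.2.2 * f p.1

/-- The gain part of the integrand. -/
def gainIntegrand (γ : ℝ) (β : ℝ → ℝ) (g h f : Vel → ℝ) (p : Vel × Vel × S2) : ℝ :=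
  ‖p.1 - p.2.1‖ ^ γ * β (cosDev p.1 p.2.1 p.2.2) * Real.sqrt (maxwellian p.2.1) *
    (g (postVStar p.1 p.2.1 p.2.2) * h (postV p.1 p.2.1 p.2.2) * f p.1)

/-- The loss part of the integrand. -/
def lossIntegrand (γ : ℝ) (β : ℝ → ℝ) (g h f : Vel → ℝ) (p : Vel × Vel × S2) : ℝ :=
  ‖p.1 - p.2.1‖ ^ γ * β (cosDev p.1 p.2.1 p.2.2) * Real.sqrt (maxwellian p.2.1) *
    (g p.2.1 * h p.1 * f p.1)

/-- By conservation of energy both the gain and the loss carry the factor μ^{1/2}(v) μ^{1/2}(v_*),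
and μ^{-1/2}(v) cancels the first part. -/
theorem inv_mul_collisionIntegrand (γ : ℝ) (β : ℝ → ℝ) (g h : Vel → ℝ) (v w : Vel) (σ : S2) :
    (Real.sqrt (maxwellian v))⁻¹ *
      collisionIntegrand γ β (sqrtMaxwellianMul g) (sqrtMaxwellianMul h) v w σ =
    ‖v - w‖ ^ γ * β (cosDev v w σ) * Real.sqrt (maxwellian w) *
      (g (postVStar v w σ) * h (postV v w σ) - g w * h v) := by
  have h1 := sqrt_maxwellian_post v w σ
  have h2 := (sqrt_maxwellian_pos v).ne'
  unfold collisionIntegrand sqrtMaxwellianMul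
  rw [inv_mul_eq_iff_eq_mul₀ h2]
  linear_combination (‖v - w‖ ^ γ * β (cosDev v w σ) * g (postVStar v w σ) * h (postV v w σ)) * h1

theorem pairingIntegrand_eq (γ : ℝ) (β : ℝ → ℝ) (g h f : Vel → ℝ) (p : Vel × Vel × S2) :
    pairingIntegrand γ β g h f p = gainIntegrand γ β g h f p - lossIntegrand γ β g h f p := by
  rw [pairingIntegrand, inv_mul_collisionIntegrand, gainIntegrand, lossIntegrand]
  ring

theorem ae_snd_ne_zero : ∀ᵐ q ∂tripleMeasure, q.2.1 ≠ 0 := by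
  have h1 : ∀ᵐ y : Vel, y ≠ 0 := by simp [ae_iff]
  have h2 : ∀ᵐ q ∂((volume : Measure Vel).prod sphereMeasure), q.1 ≠ 0 :=
    Measure.quasiMeasurePreserving_fst.ae h1
  exact Measure.quasiMeasurePreserving_snd.ae h2

theorem ae_ne : ∀ᵐ q ∂tripleMeasure, q.1 ≠ q.2.1 := by
  filter_upwards [measurePreserving_relative.quasiMeasurePreserving.ae ae_snd_ne_zero] with q hq
  exact sub_ne_zero.1 hq

/-- For fixed y ≠ 0 the exceptional directions form a great circle, which is null because the cosine
is uniformly distributed on (-1, 1). -/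
theorem ae_inner_ne_zero : ∀ᵐ q ∂tripleMeasure, inner ℝ q.2.1 (q.2.2 : Vel) ≠ 0 := by
  refine Measure.quasiMeasurePreserving_snd.ae
      (p := fun q : Vel × S2 => inner ℝ q.1 (q.2 : Vel) ≠ 0) ?_
  have hm : MeasurableSet {q : Vel × S2 | inner ℝ q.1 (q.2 : Vel) = 0} :=
    measurableSet_eq_fun (by fun_prop) measurable_const
  have h0 : ((volume : Measure Vel).prod sphereMeasure)
      {q : Vel × S2 | inner ℝ q.1 (q.2 : Vel) = 0} = 0 := by
    rw [Measure.measure_prod_null hm]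
    have h1 : ∀ᵐ y : Vel, y ≠ 0 := by simp [ae_iff]
    filter_upwards [h1] with y hy
    have h2 := lintegral_cosAngle (F := ({0} : Set ℝ).indicator 1)
      (measurable_one.indicator (measurableSet_singleton 0)) hy
    rw [lintegral_indicator_one (measurableSet_singleton 0)] at h2
    have h3 : (fun σ : S2 => ({0} : Set ℝ).indicator (1 : ℝ → ℝ≥0∞) (cosAngle (y, σ))) =
        (Prod.mk y ⁻¹' {q : Vel × S2 | inner ℝ q.1 (q.2 : Vel) = 0}).indicator 1 := by
      funext σ
      have h4 := norm_ne_zero_iff.2 hy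
      have h5 : cosAngle (y, σ) = 0 ↔ inner ℝ y (σ : Vel) = 0 := by simp [cosAngle, h4]
      by_cases h : inner ℝ y (σ : Vel) = 0
      · simp [h5.2 h, Set.indicator, h]
      · simp [Set.indicator, h, h5]
    rw [h3, lintegral_indicator_one (measurable_prodMk_left hm)] at h2
    rw [h2]
    simp
  rw [ae_iff]
  simpa using h0

/-- The angular kernel of the gain part in Carleman variables. -/
def gainKernel (γ : ℝ) (β : ℝ → ℝ) (c : ℝ) : ℝ := 4 * c ^ (-2 - γ) * β (2 * c ^ 2 - 1)

/-- The angular kernel of the loss part in Carleman variables. -/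
def lossKernel (β : ℝ → ℝ) (c : ℝ) : ℝ := 4 * c * β (2 * c ^ 2 - 1)

theorem measurable_gainKernel (γ : ℝ) {β : ℝ → ℝ} (hβ : Measurable β) :
    Measurable (gainKernel γ β) := by
  unfold gainKernel; fun_prop

theorem measurable_lossKernel {β : ℝ → ℝ} (hβ : Measurable β) :
    Measurable (lossKernel β) := by
  unfold lossKernel; fun_prop

theorem half_le_sq_of_ne_zero {β : ℝ → ℝ} (h0 : ∀ x, x < 0 → β x = 0) {c : ℝ}
    (h : β (2 * c ^ 2 - 1) ≠ 0) : 1 / 2 ≤ c ^ 2 := by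
  by_contra hc
  exact h (h0 _ (by linarith))

theorem gain_carleman (γ : ℝ) {β : ℝ → ℝ} (hβ : Measurable β) {g h f : Vel → ℝ}
    (hg : Measurable g) (hh : Measurable h) (hf : Measurable f) :
    ∃ G : Vel × Vel × S2 → ℝ, Measurable G ∧
      (gainIntegrand γ β g h f =ᵐ[tripleMeasure] fun q => G (carleman q)) ∧
      ∀ q, carlemanJac q.2 * G q = carlemanForm γ (gainKernel γ β) 1 g h f q := by
  have hs := measurable_carlemanShift
  have hc := measurable_cosAngle
  have hM := measurable_maxwellian
  refine ⟨fun x => (‖x.2.1‖ / cosAngle x.2) ^ γ * β (2 * cosAngle x.2 ^ 2 - 1) *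
    Real.sqrt (maxwellian (x.1 + carlemanShift x.2)) *
    (g x.1 * h (x.1 + x.2.1 + carlemanShift x.2) * f (x.1 + x.2.1)), by fun_prop, ?_, fun q => ?_⟩
  · filter_upwards [ae_ne, ae_carleman_pos] with q hq1 hq2
    obtain ⟨v, w, σ⟩ := q
    obtain ⟨e1, e2, e3, e4, e5, e6⟩ := carleman_spec hq1 hq2
    simp only [gainIntegrand]
    rw [e3, e4, e5, e6, ← e1, ← e2]
  · by_cases hx : 0 < inner ℝ q.2.1 (q.2.2 : Vel)
    swap
    · simp [carlemanJac, carlemanForm, angularKernel, hx]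
    have c0 := cosAngle_pos hx
    have hy : q.2.1 ≠ 0 := by
      rintro h0
      simp [h0] at hx
    have hy0 := norm_pos_iff.2 hy
    -- The Jacobian 4/c² and the factor c^(-γ) from |v-v_*|^γ = (|y|/c)^γ make up the gain kernel.
    have e : 4 * ‖q.2.1‖ ^ 2 / inner ℝ q.2.1 (q.2.2 : Vel) ^ 2 = 4 / cosAngle q.2 ^ 2 := by
      rw [cosAngle]; field_simp
    simp only [carlemanJac, carlemanForm, angularKernel, hx, if_true, one_smul, e, gainKernel]
    rw [Real.div_rpow hy0.le c0.le, Real.rpow_sub c0, Real.rpow_neg c0.le, Real.rpow_two]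
    have := Real.rpow_pos_of_pos c0 γ
    field_simp

/-- In the loss term the variables are w = v_* and y = v - v_*, without change of σ. Their angle is
θ and not θ/2, hence the kernel β itself; since β vanishes for negative cosines, the restriction to
the half space loses nothing. -/
theorem loss_carleman (γ : ℝ) {β : ℝ → ℝ} (h0 : ∀ x, x < 0 → β x = 0) (g h f : Vel → ℝ) :
    lossIntegrand γ β g h f =ᵐ[tripleMeasure]
      fun q => carlemanForm γ β 0 g h f (q.2.1, q.1 - q.2.1, q.2.2) := by
  filter_upwards [measurePreserving_relative.quasiMeasurePreserving.ae ae_inner_ne_zero] with q hq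
  have e : ∀ v w : Vel, w + (v - w) = v := fun v w => by abel
  simp only [lossIntegrand, carlemanForm, zero_smul, add_zero, e]
  have hc : cosDev q.1 q.2.1 q.2.2 = cosAngle (q.1 - q.2.1, q.2.2) := rfl
  rw [hc]
  have hk : angularKernel β (q.1 - q.2.1, q.2.2) = β (cosAngle (q.1 - q.2.1, q.2.2)) := by
    by_cases hx : 0 < inner ℝ (q.1 - q.2.1) (q.2.2 : Vel)
    · simp [angularKernel, hx]
    · have h1 : inner ℝ (q.1 - q.2.1) (q.2.2 : Vel) < 0 := lt_of_le_of_ne (not_lt.1 hx) hq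
      have h2 : 0 < ‖q.1 - q.2.1‖ := norm_pos_iff.2 (by
        rintro h2
        simp [h2] at h1)
      simp only [angularKernel, hx, if_false]
      exact (h0 _ (div_neg_of_neg_of_pos h1 h2)).symm
  rw [hk]
  ring

theorem image_two_mul_sq : (fun c : ℝ => 2 * c ^ 2 - 1) '' Set.Ioo 0 1 = Set.Ioo (-1) 1 := by
  ext x
  simp only [Set.mem_image, Set.mem_Ioo]
  constructor
  · rintro ⟨c, ⟨h1, h2⟩, rfl⟩
    constructor <;> nlinarith
  · rintro ⟨h1, h2⟩
    refine ⟨Real.sqrt ((1 + x) / 2), ⟨Real.sqrt_pos.2 (by linarith), ?_⟩, ?_⟩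
    · rw [Real.sqrt_lt' one_pos]
      linarith
    · rw [Real.sq_sqrt (by linarith)]
      ring

/-- The substitution x = 2c² - 1, dx = 4c dc, which expresses the loss through the half angle used
for the gain. -/
theorem integral_lossKernel {β : ℝ → ℝ} (h0 : ∀ x, x < 0 → β x = 0) :
    ∫ c in Set.Ioo (0 : ℝ) 1, lossKernel β c = ∫ x in Set.Ioo (0 : ℝ) 1, β x := by
  have hd : ∀ c ∈ Set.Ioo (0 : ℝ) 1,
      HasDerivWithinAt (fun c : ℝ => 2 * c ^ 2 - 1) (4 * c) (Set.Ioo 0 1) c := by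
    intro c _
    have := ((hasDerivAt_pow 2 c).const_mul 2).sub_const 1
    rw [show 2 * (((2 : ℕ) : ℝ) * c ^ (2 - 1)) = 4 * c by norm_num; ring] at this
    exact this.hasDerivWithinAt
  have hinj : Set.InjOn (fun c : ℝ => 2 * c ^ 2 - 1) (Set.Ioo 0 1) := by
    intro a ha b hb hab
    have h1 : a ^ 2 = b ^ 2 := by simp only at hab; linarith
    exact (pow_left_inj₀ ha.1.le hb.1.le two_ne_zero).1 h1
  have h1 := integral_image_eq_integral_abs_deriv_smul measurableSet_Ioo hd hinj β
  rw [image_two_mul_sq] at h1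
  have h2 : ∫ x in Set.Ioo (-1 : ℝ) 1, β x = ∫ x in Set.Ioo (0 : ℝ) 1, β x := by
    rw [← Ioo_inter_Ioi_zero, ← setIntegral_indicator measurableSet_Ioi]
    refine setIntegral_congr_ae measurableSet_Ioo ?_
    have : ∀ᵐ x : ℝ, x ≠ 0 := by simp [ae_iff]
    filter_upwards [this] with x hx _
    by_cases hx0 : 0 < x
    · simp [hx0]
    · rw [Set.indicator_of_notMem (Set.notMem_Ioi.2 (not_lt.1 hx0)), h0 x
        (lt_of_le_of_ne (not_lt.1 hx0) hx)]
  rw [← h2, h1]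
  refine setIntegral_congr_fun measurableSet_Ioo fun c hc => ?_
  simp only [lossKernel, smul_eq_mul]
  rw [abs_of_pos (by linarith [hc.1])]

/-- Without shift only the kernel depends on σ, so the form sees Φ through its integral alone. This
makes `β` and `lossKernel β` interchangeable in the loss term. -/
theorem integral_carlemanForm_zero (γ : ℝ) {Φ : ℝ → ℝ} (hΦ : Measurable Φ) {g h f : Vel → ℝ}
    (hi : Integrable (carlemanForm γ Φ 0 g h f) tripleMeasure) :
    ∫ x, carlemanForm γ Φ 0 g h f x ∂tripleMeasure =
      ∫ w : Vel, ∫ y : Vel, (2 * Real.pi * ∫ x in Set.Ioo (0 : ℝ) 1, Φ x) *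
        (‖y‖ ^ γ * (g w * f (w + y)) * (h (w + y) * Real.sqrt (maxwellian w))) := by
  rw [integral_prod _ hi]
  refine integral_congr_ae ?_
  filter_upwards [hi.prod_right_ae] with w hw
  rw [integral_prod _ hw]
  have h1 : ∀ᵐ y : Vel, y ≠ 0 := by simp [ae_iff]
  refine integral_congr_ae ?_
  filter_upwards [h1] with y hy
  simp only [carlemanForm, zero_smul, add_zero]
  rw [integral_mul_const, integral_angularKernel hΦ hy]

theorem angularMass_le {Φ : ℝ → ℝ} {B : ℝ} (h : ∀ x, 0 < x → x < 1 → |Φ x| ≤ B) :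
    angularMass Φ ≤ ENNReal.ofReal B := by
  refine (setLIntegral_mono' measurableSet_Ioo (g := fun _ => ENNReal.ofReal B)
    fun x hx => ENNReal.ofReal_le_ofReal (h x hx.1 hx.2)).trans ?_
  rw [setLIntegral_const, Real.volume_Ioo]
  simp

/-- On the support c ≥ 1/2, which bounds powers of c of either sign. -/
theorem gainKernel_abs_le (γ : ℝ) {β : ℝ → ℝ} (h0 : ∀ x, x < 0 → β x = 0) {c : ℝ} (hc : 0 < c)
    (hc1 : c < 1) :
    |gainKernel γ β c| ≤ 4 * 2 ^ |2 + γ| * |β (2 * c ^ 2 - 1)| := by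
  by_cases hβ : β (2 * c ^ 2 - 1) = 0
  · simp [gainKernel, hβ]
  have h1 := half_le_sq_of_ne_zero h0 hβ
  have h2 : 1 / 2 ≤ c := by nlinarith
  rw [gainKernel, abs_mul, abs_mul, abs_of_pos (by positivity : 0 < c ^ (-2 - γ)),
    abs_of_pos (by norm_num : (0 : ℝ) < 4)]
  gcongr
  calc c ^ (-2 - γ) ≤ c ^ (-|2 + γ|) :=
        Real.rpow_le_rpow_of_exponent_ge hc hc1.le (by linarith [le_abs_self (2 + γ)])
    _ = (c⁻¹) ^ |2 + γ| := by rw [Real.rpow_neg hc.le, Real.inv_rpow hc.le]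
    _ ≤ 2 ^ |2 + γ| := by
        gcongr
        rw [inv_le_comm₀ hc two_pos]
        linarith

theorem integrable_carlemanForm {γ : ℝ} (hγ : -3 < γ) {Φ : ℝ → ℝ} (hΦ : Measurable Φ) {t : ℝ}
    (hsupp : ∀ x, Φ x ≠ 0 → t = 0 ∨ 1 / 2 ≤ x ^ 2) (ht : |t| ≤ 1) (hm : angularMass Φ ≠ ⊤)
    {g h f : Vel → ℝ} (hg : Measurable g) (hh : Measurable h) (hf : Measurable f)
    (ng : l2norm (fun x => ‖g x‖ₑ) ≠ ⊤) (nf : l2norm (fun x => ‖weighted (γ / 2) f x‖ₑ) ≠ ⊤)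
    (nh : l2norm (fun x => ‖weighted (γ / 2 + 2) h x‖ₑ) ≠ ⊤) {S : ℝ≥0∞} (hS : S ≠ ⊤)
    (hhS : ∀ᵐ x, ‖weighted (γ / 2 + 2) h x‖ₑ ≤ S) :
    Integrable (carlemanForm γ Φ t g h f) tripleMeasure := by
  obtain ⟨C, hC, hle⟩ := exists_lintegral_carlemanForm_le hγ
  refine ⟨(measurable_carlemanForm γ hΦ t hg hh hf).aestronglyMeasurable, ?_⟩
  refine (hle Φ t hΦ hsupp ht g h f hg hh hf S hhS).trans_lt ?_
  finiteness

theorem pairing_carleman {γ : ℝ} (hγ : -3 < γ) {β : ℝ → ℝ} (hβ : Measurable β)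
    (h0 : ∀ x, x < 0 → β x = 0) {B : ℝ} (hB : ∀ x, |β x| ≤ B)
    {g h f : Vel → ℝ} (hg : Measurable g) (hh : Measurable h) (hf : Measurable f)
    (ng : l2norm (fun x => ‖g x‖ₑ) ≠ ⊤) (nf : l2norm (fun x => ‖weighted (γ / 2) f x‖ₑ) ≠ ⊤)
    (nh : l2norm (fun x => ‖weighted (γ / 2 + 2) h x‖ₑ) ≠ ⊤) {S : ℝ≥0∞} (hS : S ≠ ⊤)
    (hhS : ∀ᵐ x, ‖weighted (γ / 2 + 2) h x‖ₑ ≤ S) :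
    Integrable (pairingIntegrand γ β g h f) tripleMeasure ∧
    ∫ x, pairingIntegrand γ β g h f x ∂tripleMeasure =
      ∫ x, carlemanForm γ (gainKernel γ β) 1 g h f x ∂tripleMeasure -
      ∫ x, carlemanForm γ (lossKernel β) 0 g h f x ∂tripleMeasure := by
  have mg := measurable_gainKernel γ hβ
  have ml := measurable_lossKernel hβ
  have i1 : Integrable (carlemanForm γ (gainKernel γ β) 1 g h f) tripleMeasure := by
    refine integrable_carlemanForm hγ mg (fun c hc => Or.inr ?_) (by simp) ?_ hg hh hf ng nf nh hS
        hhS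
    · exact half_le_sq_of_ne_zero h0 (right_ne_zero_of_mul hc)
    · refine ne_top_of_le_ne_top ENNReal.ofReal_ne_top (angularMass_le
        (B := 4 * 2 ^ |2 + γ| * B) fun c hc hc1 => ?_)
      exact (gainKernel_abs_le γ h0 hc hc1).trans (by gcongr; exact hB _)
  have i2 : Integrable (carlemanForm γ (lossKernel β) 0 g h f) tripleMeasure := by
    refine integrable_carlemanForm hγ ml (fun c _ => Or.inl rfl) (by simp) ?_ hg hh hf ng nf nh hS
        hhS
    refine ne_top_of_le_ne_top ENNReal.ofReal_ne_top (angularMass_le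
        (B := 4 * 1 * B) fun c hc hc1 => ?_)
    rw [lossKernel, abs_mul, abs_mul, abs_of_pos hc, abs_of_pos (by norm_num : (0 : ℝ) < 4)]
    gcongr
    exact hB _
  have i3 : Integrable (carlemanForm γ β 0 g h f) tripleMeasure := by
    refine integrable_carlemanForm hγ hβ (fun c _ => Or.inl rfl) (by simp) ?_ hg hh hf ng nf nh hS
        hhS
    exact ne_top_of_le_ne_top ENNReal.ofReal_ne_top (angularMass_le fun c _ _ => hB c)
  obtain ⟨G, hG, hG1, hG2⟩ := gain_carleman γ hβ hg hh hf
  have j1 : Integrable (gainIntegrand γ β g h f) tripleMeasure := by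
    rw [integrable_congr hG1, integrable_carleman hG]
    simp_rw [hG2]
    exact i1
  have k1 : ∫ x, gainIntegrand γ β g h f x ∂tripleMeasure =
      ∫ x, carlemanForm γ (gainKernel γ β) 1 g h f x ∂tripleMeasure := by
    rw [integral_congr_ae hG1, integral_carleman hG]
    simp_rw [hG2]
  have hl := loss_carleman γ h0 g h f
  have hlm := measurable_carlemanForm γ hβ 0 hg hh hf
  have j2 : Integrable (lossIntegrand γ β g h f) tripleMeasure := by
    rw [integrable_congr hl]
    exact (measurePreserving_relative.integrable_comp hlm.aestronglyMeasurable).2 i3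
  have k2 : ∫ x, lossIntegrand γ β g h f x ∂tripleMeasure =
      ∫ x, carlemanForm γ (lossKernel β) 0 g h f x ∂tripleMeasure := by
    rw [integral_congr_ae hl, integral_carlemanForm_zero γ ml i2, integral_lossKernel h0,
      ← integral_carlemanForm_zero γ hβ i3,
      ← integral_map (φ := fun q : Vel × Vel × S2 => (q.2.1, q.1 - q.2.1, q.2.2))
        (f := carlemanForm γ β 0 g h f) measurePreserving_relative.aemeasurable
        hlm.aestronglyMeasurable, measurePreserving_relative.map_eq]
  refine ⟨(j1.sub j2).congr (Eventually.of_forall fun x => (pairingIntegrand_eq γ β g h f x).symm),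
      ?_⟩
  simp_rw [pairingIntegrand_eq]
  rw [integral_sub j1 j2, k1, k2]

/-! ### Kernel masses bounded by the angular moment -/

/-- The angular moment `∫ sin² (θ/2) |β(cos θ)| dx` in the variable `x = cos (θ/2)`. -/
def angularMoment (β : ℝ → ℝ) : ℝ≥0∞ :=
  ∫⁻ x in Set.Ioo (0 : ℝ) 1, ENNReal.ofReal ((1 - x ^ 2) * |β (2 * x ^ 2 - 1)|)

theorem angularMass_le_moment {Φ β : ℝ → ℝ} (hβ : Measurable β) {K : ℝ} (hK : 0 ≤ K)
    (h : ∀ x, 0 < x → x < 1 → |Φ x| ≤ K * ((1 - x ^ 2) * |β (2 * x ^ 2 - 1)|)) :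
    angularMass Φ ≤ ENNReal.ofReal K * angularMoment β := by
  have hm : Measurable fun x : ℝ => |β (2 * x ^ 2 - 1)| :=
    measurable_norm.comp (hβ.comp (by fun_prop))
  rw [angularMoment, ← lintegral_const_mul _ (by fun_prop)]
  refine setLIntegral_mono' measurableSet_Ioo fun x hx => ?_
  rw [← ENNReal.ofReal_mul hK]
  exact ENNReal.ofReal_le_ofReal (h x hx.1 hx.2)

theorem angularMass_gainKernel_le (γ : ℝ) {β : ℝ → ℝ} (hβ : Measurable β)
    (h0 : ∀ x, x < 0 → β x = 0) :
    angularMass (fun x => gainKernel γ β x * ((1 - x ^ 2) / x ^ 2)) ≤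
      ENNReal.ofReal (8 * 2 ^ |2 + γ|) * angularMoment β := by
  refine angularMass_le_moment hβ (by positivity) fun c hc hc1 => ?_
  by_cases hβ0 : β (2 * c ^ 2 - 1) = 0
  · simp [gainKernel, hβ0]
  have h1 := half_le_sq_of_ne_zero h0 hβ0
  have h2 := gainKernel_abs_le γ h0 hc hc1
  have h3 : 0 ≤ 1 - c ^ 2 := by nlinarith
  have h4 : (1 - c ^ 2) / c ^ 2 ≤ 2 * (1 - c ^ 2) := by
    rw [div_le_iff₀ (by positivity)]; nlinarith
  rw [abs_mul, abs_of_nonneg (div_nonneg h3 (by positivity))]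
  calc _ ≤ (4 * 2 ^ |2 + γ| * |β (2 * c ^ 2 - 1)|) * (2 * (1 - c ^ 2)) := by gcongr
    _ = _ := by ring

/-- Bernoulli's inequality needs an exponent at least 1; passing from b to max 1 b only lowers the
power of c ≤ 1. -/
theorem one_sub_rpow_le {b c : ℝ} (hc : 0 < c) (hc1 : c ≤ 1) :
    1 - c ^ b ≤ max 1 b * (1 - c) := by
  have h1 : c ^ max 1 b ≤ c ^ b := Real.rpow_le_rpow_of_exponent_ge hc hc1 (le_max_right _ _)
  have h2 := one_add_mul_self_le_rpow_one_add (s := c - 1) (by linarith) (le_max_left 1 b)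
  rw [show 1 + (c - 1) = c by ring] at h2
  linarith

/-- With b = 3 + γ > 0 the difference is c · c^(-b) (1 - c^b), which is nonnegative and vanishes to
first order at c = 1. -/
theorem rpow_sub_self_abs_le {γ c : ℝ} (hγ : -3 < γ) (hc : 1 / 2 ≤ c) (hc1 : c ≤ 1) :
    |c ^ (-2 - γ) - c| ≤ 2 ^ (3 + γ) * max 1 (3 + γ) * (1 - c ^ 2) := by
  have hc0 : 0 < c := by linarith
  set b := 3 + γ with hb
  have hb0 : 0 < b := by linarith
  have e : c ^ (-2 - γ) - c = c * (c⁻¹ ^ b * (1 - c ^ b)) := by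
    rw [Real.inv_rpow hc0.le, mul_sub, mul_one, inv_mul_cancel₀ (Real.rpow_pos_of_pos hc0 b).ne',
      ← Real.rpow_neg hc0.le, mul_sub, mul_one, mul_comm c, ← Real.rpow_add_one hc0.ne']
    congr 2
    rw [hb]; ring
  have h1 : c ^ b ≤ 1 := Real.rpow_le_one hc0.le hc1 hb0.le
  have h2 : c⁻¹ ^ b ≤ 2 ^ b := by
    gcongr
    rw [inv_le_comm₀ hc0 two_pos]
    linarith
  have h3 := one_sub_rpow_le (b := b) hc0 hc1
  have h4 : 0 ≤ c⁻¹ ^ b := by positivity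
  have h5 : 0 ≤ 1 - c ^ b := by linarith
  rw [e, abs_of_nonneg (by positivity)]
  calc c * (c⁻¹ ^ b * (1 - c ^ b)) ≤ 1 * (2 ^ b * (max 1 b * (1 - c))) := by gcongr
    _ ≤ 2 ^ b * max 1 b * (1 - c ^ 2) := by
      rw [one_mul, ← mul_assoc]
      gcongr
      nlinarith

/-- The cancellation lemma for this change of variables: the Jacobian and the kinetic factor of the
gain tend to those of the loss at θ = 0, with an error proportional to sin²(θ/2). -/
theorem angularMass_gainKernel_sub_lossKernel_le {γ : ℝ} (hγ : -3 < γ) {β : ℝ → ℝ}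
    (hβ : Measurable β) (h0 : ∀ x, x < 0 → β x = 0) :
    angularMass (fun x => gainKernel γ β x - lossKernel β x) ≤
      ENNReal.ofReal (4 * (2 ^ (3 + γ) * max 1 (3 + γ))) * angularMoment β := by
  refine angularMass_le_moment hβ (by positivity) fun c hc hc1 => ?_
  by_cases hβ0 : β (2 * c ^ 2 - 1) = 0
  · simp [gainKernel, lossKernel, hβ0]
  have h1 := half_le_sq_of_ne_zero h0 hβ0
  have h2 := rpow_sub_self_abs_le hγ (by nlinarith : 1 / 2 ≤ c) hc1.le
  rw [gainKernel, lossKernel, show 4 * c ^ (-2 - γ) * β (2 * c ^ 2 - 1) -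
    4 * c * β (2 * c ^ 2 - 1) = 4 * (c ^ (-2 - γ) - c) * β (2 * c ^ 2 - 1) by ring, abs_mul,
      abs_mul,
    abs_of_pos (by norm_num : (0 : ℝ) < 4)]
  calc _ ≤ 4 * (2 ^ (3 + γ) * max 1 (3 + γ) * (1 - c ^ 2)) * |β (2 * c ^ 2 - 1)| := by gcongr
    _ = _ := by ring

/-! ### The estimate by the angular moment, for smooth and then for general h -/

theorem weighted_weighted_neg (l : ℝ) (f : Vel → ℝ) : weighted l (weighted (-l) f) = f := by
  funext v
  have := weighted_neg_weighted (-l) f v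
  rwa [neg_neg] at this

theorem weighted_sub (l : ℝ) (f g : Vel → ℝ) :
    weighted l (fun v => f v - g v) = fun v => weighted l f v - weighted l g v := by
  funext v
  simp only [weighted]
  ring

/-- The trilinear form of the collision operator in Carleman variables. -/
def carlemanDiff (γ : ℝ) (β : ℝ → ℝ) (g h f : Vel → ℝ) : ℝ :=
  ∫ x, carlemanForm γ (gainKernel γ β) 1 g h f x ∂tripleMeasure -
    ∫ x, carlemanForm γ (lossKernel β) 0 g h f x ∂tripleMeasure

theorem angularMass_gainKernel_ne_top (γ : ℝ) {β : ℝ → ℝ}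
    (h0 : ∀ x, x < 0 → β x = 0) {B : ℝ} (hB : ∀ x, |β x| ≤ B) :
    angularMass (gainKernel γ β) ≠ ⊤ :=
  ne_top_of_le_ne_top ENNReal.ofReal_ne_top (angularMass_le
    (B := 4 * 2 ^ |2 + γ| * B) fun c hc hc1 =>
      (gainKernel_abs_le γ h0 hc hc1).trans (by gcongr; exact hB _))

theorem angularMass_lossKernel_ne_top {β : ℝ → ℝ} {B : ℝ} (hB : ∀ x, |β x| ≤ B) :
    angularMass (lossKernel β) ≠ ⊤ := by
  refine ne_top_of_le_ne_top ENNReal.ofReal_ne_top (angularMass_le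
      (B := 4 * 1 * B) fun c hc hc1 => ?_)
  rw [lossKernel, abs_mul, abs_mul, abs_of_pos hc, abs_of_pos (by norm_num : (0 : ℝ) < 4)]
  gcongr
  exact hB _

theorem angularMoment_ne_top {β : ℝ → ℝ} {B : ℝ} (hB : ∀ x, |β x| ≤ B) :
    angularMoment β ≠ ⊤ := by
  have h : angularMoment β ≤ ∫⁻ _x in Set.Ioo (0 : ℝ) 1, ENNReal.ofReal B := by
    refine setLIntegral_mono' measurableSet_Ioo fun x hx => ENNReal.ofReal_le_ofReal ?_
    have h1 : 1 - x ^ 2 ≤ 1 := by nlinarith [sq_nonneg x]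
    have h2 := hB (2 * x ^ 2 - 1)
    exact (mul_le_of_le_one_left (abs_nonneg _) h1).trans h2
  refine ne_top_of_le_ne_top ?_ h
  rw [setLIntegral_const, Real.volume_Ioo]
  finiteness

theorem integrable_gain_carlemanForm {γ : ℝ} (hγ : -3 < γ) {β : ℝ → ℝ} (hβ : Measurable β)
    (h0 : ∀ x, x < 0 → β x = 0) {B : ℝ} (hB : ∀ x, |β x| ≤ B) {t : ℝ} (ht : |t| ≤ 1)
    {g h f : Vel → ℝ} (hg : Measurable g) (hh : Measurable h) (hf : Measurable f)
    (ng : l2norm (fun x => ‖g x‖ₑ) ≠ ⊤) (nf : l2norm (fun x => ‖weighted (γ / 2) f x‖ₑ) ≠ ⊤)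
    (nh : l2norm (fun x => ‖weighted (γ / 2 + 2) h x‖ₑ) ≠ ⊤) {S : ℝ≥0∞} (hS : S ≠ ⊤)
    (hhS : ∀ᵐ x, ‖weighted (γ / 2 + 2) h x‖ₑ ≤ S) :
    Integrable (carlemanForm γ (gainKernel γ β) t g h f) tripleMeasure :=
  integrable_carlemanForm hγ (measurable_gainKernel γ hβ)
    (fun _ hc => Or.inr (half_le_sq_of_ne_zero h0 (right_ne_zero_of_mul hc))) ht
    (angularMass_gainKernel_ne_top γ h0 hB) hg hh hf ng nf nh hS hhS

theorem integrable_loss_carlemanForm {γ : ℝ} (hγ : -3 < γ) {β : ℝ → ℝ} (hβ : Measurable β)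
    {B : ℝ} (hB : ∀ x, |β x| ≤ B)
    {g h f : Vel → ℝ} (hg : Measurable g) (hh : Measurable h) (hf : Measurable f)
    (ng : l2norm (fun x => ‖g x‖ₑ) ≠ ⊤) (nf : l2norm (fun x => ‖weighted (γ / 2) f x‖ₑ) ≠ ⊤)
    (nh : l2norm (fun x => ‖weighted (γ / 2 + 2) h x‖ₑ) ≠ ⊤) {S : ℝ≥0∞} (hS : S ≠ ⊤)
    (hhS : ∀ᵐ x, ‖weighted (γ / 2 + 2) h x‖ₑ ≤ S) :
    Integrable (carlemanForm γ (lossKernel β) 0 g h f) tripleMeasure :=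
  integrable_carlemanForm hγ (measurable_lossKernel hβ)
    (fun _ _ => Or.inl rfl) (by simp)
    (angularMass_lossKernel_ne_top hB) hg hh hf ng nf nh hS hhS

/-- The estimate of the trilinear form for twice differentiable functions. -/
theorem exists_carlemanDiff_smooth_le {γ : ℝ} (hγ : -3 < γ) : ∃ C : ℝ≥0∞, C ≠ ⊤ ∧
    ∀ β : ℝ → ℝ, Measurable β → (∀ x, x < 0 → β x = 0) → (∃ B : ℝ, ∀ x, |β x| ≤ B) →
    ∀ g f k N : Vel → ℝ, Measurable g → Measurable f → Continuous k → Continuous N →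
    (∀ x p, HasSecondOrderBound (fun t => k (x + t • p)) (fun t => N (x + t • p)) ‖p‖) →
    ∀ S : ℝ≥0∞, S ≠ ⊤ → (∀ x, ‖k x‖ₑ ≤ S) → l2norm (fun x => ENNReal.ofReal (N x)) ≠ ⊤ →
    l2norm (fun x => ‖g x‖ₑ) ≠ ⊤ → l2norm (fun x => ‖weighted (γ / 2) f x‖ₑ) ≠ ⊤ →
      ‖carlemanDiff γ β g (weighted (-(γ / 2 + 2)) k) f‖ₑ ≤ C * angularMoment β *
        (l2norm (fun x => ‖g x‖ₑ) * l2norm (fun x => ‖weighted (γ / 2) f x‖ₑ) *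
          (l2norm (fun x => ENNReal.ofReal (N x)) + S)) := by
  obtain ⟨C₁, hC₁, hsymm⟩ := exists_carlemanForm_symm_le hγ
  obtain ⟨C₂, hC₂, hform⟩ := exists_lintegral_carlemanForm_le hγ
  set a := ENNReal.ofReal (8 * 2 ^ |2 + γ|) with ha
  set b := ENNReal.ofReal (4 * (2 ^ (3 + γ) * max 1 (3 + γ))) with hb
  have hat : a ≠ ⊤ := ENNReal.ofReal_ne_top
  have hbt : b ≠ ⊤ := ENNReal.ofReal_ne_top
  refine ⟨C₁ * a + C₂ * b, by finiteness, ?_⟩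
  rintro β hβ h0 ⟨B, hB⟩ g f k N hg hf hkc hN hk S hS hkS nN ng nf
  set h := weighted (-(γ / 2 + 2)) k with hh
  have hwk : weighted (γ / 2 + 2) h = k := weighted_weighted_neg _ _
  have hhm : Measurable h := measurable_weighted _ hkc.measurable
  have hkN : ∀ x, ‖k x‖ₑ ≤ ENNReal.ofReal (N x) := by
    intro x
    obtain ⟨_, _, _, _, _, h4⟩ := hk x 0
    have := (h4 0).1
    simp only [smul_zero, add_zero] at this
    rw [← ofReal_norm]
    exact ENNReal.ofReal_le_ofReal this
  have hl2 : l2norm (fun x => ‖weighted (γ / 2 + 2) h x‖ₑ) ≤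
      l2norm (fun x => ENNReal.ofReal (N x)) := by
    rw [hwk]
    exact l2norm_mono (Eventually.of_forall hkN)
  have nh := ne_top_of_le_ne_top nN hl2
  have hhS : ∀ᵐ x, ‖weighted (γ / 2 + 2) h x‖ₑ ≤ S := by
    rw [hwk]
    exact Eventually.of_forall hkS
  have mg := measurable_gainKernel γ hβ
  have ml := measurable_lossKernel hβ
  have i (t : ℝ) (ht : |t| ≤ 1) := integrable_gain_carlemanForm hγ hβ h0 hB ht hg hhm hf ng nf nh
      hS hhS
  have i1 := i 1 (by simp)
  have i2 := i (-1) (by simp)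
  have i3 := i 0 (by simp)
  have i4 := integrable_loss_carlemanForm hγ hβ hB hg hhm hf ng nf nh hS hhS
  -- The gain at t = 1 is the mean of those at t = 1 and t = -1. Subtracting the gain at t = 0
  -- leaves half of a second difference, and adding it back leaves the difference of the two kernels
  -- without shift.
  have e1 : carlemanDiff γ β g h f = 2⁻¹ * ∫ x, (carlemanForm γ (gainKernel γ β) 1 g h f x +
      carlemanForm γ (gainKernel γ β) (-1) g h f x -
      2 * carlemanForm γ (gainKernel γ β) 0 g h f x) ∂tripleMeasure +
      ∫ x, carlemanForm γ (fun x => gainKernel γ β x - lossKernel β x) 0 g h f x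
        ∂tripleMeasure := by
    have e2 : ∀ x, carlemanForm γ (fun x => gainKernel γ β x - lossKernel β x) 0 g h f x =
        carlemanForm γ (gainKernel γ β) 0 g h f x - carlemanForm γ (lossKernel β) 0 g h f x := by
      intro x
      unfold carlemanForm angularKernel
      split_ifs <;> ring
    simp_rw [e2]
    have e3 := integral_sub (i1.add i2) (i3.const_mul 2)
    simp only [Pi.add_apply] at e3
    rw [e3, integral_add i1 i2, integral_const_mul,
      integral_carlemanForm_neg γ mg 1 hg hhm hf, integral_sub i3 i4, carlemanDiff]
    ring
  rw [e1, add_mul, add_mul]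
  refine (enorm_add_le _ _).trans (add_le_add ?_ ?_)
  · rw [enorm_mul]
    have h2 : ‖(2⁻¹ : ℝ)‖ₑ ≤ 1 := by
      rw [Real.enorm_of_nonneg (by norm_num), ENNReal.ofReal_le_one]
      norm_num
    refine (mul_le_of_le_one_left zero_le h2).trans
      ((enorm_integral_le_lintegral_enorm _).trans ?_)
    refine (hsymm _ mg (fun _ hc => half_le_sq_of_ne_zero h0 (right_ne_zero_of_mul hc)) g f k N
      hg hf hN hk).trans ?_
    rw [mul_assoc C₁ a]
    gcongr
    · exact angularMass_gainKernel_le γ hβ h0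
    · exact le_self_add
  · refine (enorm_integral_le_lintegral_enorm _).trans ((hform _ 0 (mg.sub ml)
      (fun _ _ => Or.inl rfl) (by simp) g h f hg hhm hf S hhS).trans ?_)
    rw [mul_assoc C₂ b]
    gcongr
    exact angularMass_gainKernel_sub_lossKernel_le hγ hβ h0

/-- A crude estimate of the trilinear form, which is used for density arguments. -/
theorem exists_carlemanDiff_crude_le {γ : ℝ} (hγ : -3 < γ) : ∃ C : ℝ≥0∞, C ≠ ⊤ ∧
    ∀ β : ℝ → ℝ, Measurable β → (∀ x, x < 0 → β x = 0) →
    ∀ g h f : Vel → ℝ, Measurable g → Measurable h → Measurable f →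
    ∀ S : ℝ≥0∞, (∀ᵐ x, ‖weighted (γ / 2 + 2) h x‖ₑ ≤ S) →
      ‖carlemanDiff γ β g h f‖ₑ ≤ C * (angularMass (gainKernel γ β) + angularMass (lossKernel β)) *
        (l2norm (fun x => ‖g x‖ₑ) * l2norm (fun x => ‖weighted (γ / 2) f x‖ₑ) *
          (l2norm (fun x => ‖weighted (γ / 2 + 2) h x‖ₑ) + S)) := by
  obtain ⟨C, hC, hform⟩ := exists_lintegral_carlemanForm_le hγ
  refine ⟨C, hC, fun β hβ h0 g h f hg hh hf S hS => ?_⟩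
  rw [mul_add, add_mul, carlemanDiff]
  refine (enorm_sub_le).trans (add_le_add ?_ ?_)
  · exact (enorm_integral_le_lintegral_enorm _).trans
      (hform _ 1 (measurable_gainKernel γ hβ) (fun _ hc => Or.inr
        (half_le_sq_of_ne_zero h0 (right_ne_zero_of_mul hc))) (by simp) g h f hg hh hf S hS)
  · exact (enorm_integral_le_lintegral_enorm _).trans
      (hform _ 0 (measurable_lossKernel hβ) (fun _ _ => Or.inl rfl) (by simp) g h f hg hh hf S hS)

/-- The estimate of the trilinear form of the collision operator by the second angular moment, for
bounded angular functions. -/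
theorem exists_pairingIntegrand_le {γ : ℝ} (hγ : -3 < γ) : ∃ C : ℝ≥0∞, C ≠ ⊤ ∧
    ∀ β : ℝ → ℝ, Measurable β → (∀ x, x < 0 → β x = 0) → (∃ B : ℝ, ∀ x, |β x| ≤ B) →
    ∀ g h f : Vel → ℝ, Measurable g → Measurable h → Measurable f →
    l2norm (fun x => ‖g x‖ₑ) ≠ ⊤ → l2norm (fun x => ‖weighted (γ / 2) f x‖ₑ) ≠ ⊤ →
    ∀ (hk : MemLp (fun v => (weighted (γ / 2 + 2) h v : ℂ)) 2 volume) (A : ℝ≥0∞), A ≠ ⊤ →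
    eLpNorm (fun ξ : Vel => ((Real.sqrt (1 + (2 * Real.pi * ‖ξ‖) ^ 2) ^ 2 : ℝ) : ℂ) *
        (𝓕 (hk.toLp (fun v => (weighted (γ / 2 + 2) h v : ℂ))) : Lp ℂ 2 (volume : Measure Vel)) ξ)
          2 volume ≤ A →
      Integrable (pairingIntegrand γ β g h f) tripleMeasure ∧
      ‖∫ x, pairingIntegrand γ β g h f x ∂tripleMeasure‖ₑ ≤ C * angularMoment β *
        (l2norm (fun x => ‖g x‖ₑ) * l2norm (fun x => ‖weighted (γ / 2) f x‖ₑ) * A) := by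
  obtain ⟨C₀, hC₀, happrox⟩ := exists_sobolev_approx
  obtain ⟨C₁, hC₁, hsmooth⟩ := exists_carlemanDiff_smooth_le hγ
  obtain ⟨C₂, hC₂, hcrude⟩ := exists_carlemanDiff_crude_le hγ
  -- One C₀ comes from the L² norm of the majorant N, the other from the supremum of k'.
  refine ⟨C₁ * (C₀ + C₀), by finiteness, ?_⟩
  rintro β hβ h0 ⟨B, hB⟩ g h f hg hh hf ng nf hk A hA hkA
  set k := weighted (γ / 2 + 2) h with hkdef
  have hkm : Measurable k := measurable_weighted _ hh
  have nk : l2norm (fun x => ‖k x‖ₑ) ≠ ⊤ := by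
    have := hk.eLpNorm_ne_top
    rw [eLpNorm_two_eq_l2norm] at this
    simpa [← ofReal_norm] using this
  -- Any approximation in L^∞ by a bounded function, here with ε = 1, shows that k is bounded.
  obtain ⟨S, hS, hkS⟩ : ∃ S : ℝ≥0∞, S ≠ ⊤ ∧ ∀ᵐ x, ‖k x‖ₑ ≤ S := by
    obtain ⟨k', N, _, _, _, _, h5, _, h7⟩ := happrox k hk A hA hkA 1 one_pos
    refine ⟨C₀ * 1 + C₀ * (A + 1), by finiteness, ?_⟩
    filter_upwards [h7] with x hx
    calc ‖k x‖ₑ = ‖(k x - k' x) + k' x‖ₑ := by rw [sub_add_cancel]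
      _ ≤ _ := (enorm_add_le _ _).trans (add_le_add hx (h5 x))
  obtain ⟨hint, hform⟩ := pairing_carleman hγ hβ h0 hB hg hh hf ng nf nk hS hkS
  refine ⟨hint, ?_⟩
  rw [hform, ← carlemanDiff]
  have hM := angularMoment_ne_top hB
  have hm1 := angularMass_gainKernel_ne_top γ h0 hB
  have hm2 := angularMass_lossKernel_ne_top hB
  set G := l2norm (fun x => ‖g x‖ₑ)
  set F := l2norm (fun x => ‖weighted (γ / 2) f x‖ₑ)
  set m := angularMass (gainKernel γ β) + angularMass (lossKernel β)
  have hmt : m ≠ ⊤ := by finiteness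
  -- The smooth approximant h' obeys the bound by the moment, and h - h' the crude one. The constant
  -- m depends on β through the full kernel masses, but it is finite and disappears as ε tends to 0.
  have hbound : ∀ ε : ℝ≥0∞, 0 < ε → ε ≠ ⊤ → ‖carlemanDiff γ β g h f‖ₑ ≤
      C₁ * angularMoment β * (G * F * (C₀ * (A + ε) + C₀ * (A + ε))) +
      C₂ * m * (G * F * (C₀ * ε + C₀ * ε)) := by
    intro ε hε hεt
    obtain ⟨k', N, h1, h2, h3, h4, h5, h6, h7⟩ := happrox k hk A hA hkA ε hε
    have hS' : C₀ * (A + ε) ≠ ⊤ := by finiteness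
    set h' := weighted (-(γ / 2 + 2)) k' with hh'
    have hwk' : weighted (γ / 2 + 2) h' = k' := weighted_weighted_neg _ _
    have hh'm : Measurable h' := measurable_weighted _ h1.measurable
    have hd : weighted (γ / 2 + 2) (fun v => h v - h' v) = fun v => k v - k' v := by
      rw [weighted_sub, hwk']
    have hkN : ∀ x, ‖k' x‖ₑ ≤ ENNReal.ofReal (N x) := by
      intro x
      obtain ⟨_, _, _, _, _, h4⟩ := h3 x 0
      have := (h4 0).1
      simp only [smul_zero, add_zero] at this
      rw [← ofReal_norm]
      exact ENNReal.ofReal_le_ofReal this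
    have nh' : l2norm (fun x => ‖weighted (γ / 2 + 2) h' x‖ₑ) ≠ ⊤ := by
      rw [hwk']
      exact ne_top_of_le_ne_top hS' ((l2norm_mono (Eventually.of_forall hkN)).trans h4)
    have hhS' : ∀ᵐ x, ‖weighted (γ / 2 + 2) h' x‖ₑ ≤ C₀ * (A + ε) := by
      rw [hwk']
      exact Eventually.of_forall h5
    have i1 := integrable_gain_carlemanForm hγ hβ h0 hB (t := 1) (by simp) hg hh hf ng nf nk hS hkS
    have i2 := integrable_loss_carlemanForm hγ hβ hB hg hh hf ng nf nk hS hkS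
    have j1 := integrable_gain_carlemanForm hγ hβ h0 hB (t := 1) (by simp) hg hh'm hf ng nf nh'
      hS' hhS'
    have j2 := integrable_loss_carlemanForm hγ hβ hB hg hh'm hf ng nf nh' hS' hhS'
    have e : carlemanDiff γ β g h f =
        carlemanDiff γ β g h' f + carlemanDiff γ β g (fun v => h v - h' v) f := by
      have e2 (Φ : ℝ → ℝ) (t : ℝ) (x) : carlemanForm γ Φ t g (fun v => h v - h' v) f x =
          carlemanForm γ Φ t g h f x - carlemanForm γ Φ t g h' f x := by
        unfold carlemanForm
        ring
      simp only [carlemanDiff, e2]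
      rw [integral_sub i1 j1, integral_sub i2 j2]
      ring
    rw [e]
    refine (enorm_add_le _ _).trans (add_le_add ?_ ?_)
    · refine (hsmooth β hβ h0 ⟨B, hB⟩ g f k' N hg hf h1 h2 h3 _ hS' h5
        (ne_top_of_le_ne_top hS' h4) ng nf).trans ?_
      gcongr
    · refine (hcrude β hβ h0 g (fun v => h v - h' v) f hg (hh.sub hh'm) hf (C₀ * ε) ?_).trans ?_
      · rw [hd]; exact h7
      · rw [hd]
        gcongr
  have hlim : Tendsto (fun ε : ℝ≥0∞ => C₁ * angularMoment β *
      (G * F * (C₀ * (A + ε) + C₀ * (A + ε))) + C₂ * m * (G * F * (C₀ * ε + C₀ * ε)))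
      (𝓝 0) (𝓝 (C₁ * angularMoment β * (G * F * (C₀ * (A + 0) + C₀ * (A + 0))) +
        C₂ * m * (G * F * (C₀ * 0 + C₀ * 0)))) := by
    have t1 : Tendsto (fun ε : ℝ≥0∞ => C₀ * (A + ε)) (𝓝 0) (𝓝 (C₀ * (A + 0))) :=
      ENNReal.Tendsto.const_mul (tendsto_const_nhds.add tendsto_id) (Or.inr hC₀)
    have t2 : Tendsto (fun ε : ℝ≥0∞ => C₀ * ε) (𝓝 0) (𝓝 (C₀ * 0)) :=
      ENNReal.Tendsto.const_mul tendsto_id (Or.inr hC₀)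
    exact (ENNReal.Tendsto.const_mul (ENNReal.Tendsto.const_mul (t1.add t1)
      (Or.inr (by finiteness))) (Or.inr (by finiteness))).add
      (ENNReal.Tendsto.const_mul (ENNReal.Tendsto.const_mul (t2.add t2)
      (Or.inr (by finiteness))) (Or.inr (by finiteness)))
  have hseq := hlim.comp ENNReal.tendsto_inv_nat_nhds_zero
  refine (ge_of_tendsto hseq ?_).trans (le_of_eq ?_)
  · filter_upwards [eventually_ge_atTop 1] with n hn
    refine hbound _ (by simp) ?_
    simp only [ne_eq, ENNReal.inv_eq_top, Nat.cast_eq_zero]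
    omega
  · simp only [add_zero, mul_zero]
    ring

/-! ### Moments of the truncated and cutoff kernels -/

theorem sin_half_arccos_sq {x : ℝ} (h1 : -1 ≤ x) (h2 : x ≤ 1) :
    Real.sin (Real.arccos x / 2) ^ 2 = (1 - x) / 2 := by
  rw [Real.sin_sq_eq_half_sub, show 2 * (Real.arccos x / 2) = Real.arccos x by ring,
    Real.cos_arccos h1 h2]
  ring

theorem sin_half_arccos_nonneg (x : ℝ) : 0 ≤ Real.sin (Real.arccos x / 2) :=
  Real.sin_nonneg_of_nonneg_of_le_pi (by have := Real.arccos_nonneg x; linarith)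
    (by have := Real.arccos_le_pi x; have := Real.arccos_nonneg x; linarith)

/-- Division by sin θ ≥ 2θ/π costs one more power of θ and the constant π/2. -/
theorem IsNonCutoffAngular.le_rpow {s K : ℝ} {b : ℝ → ℝ} (hb : IsNonCutoffAngular s K b)
    {x : ℝ} (hx0 : 0 ≤ x) (hx1 : x < 1) :
    b x ≤ Real.pi / 2 * K * Real.arccos x ^ (-2 - 2 * s) := by
  have hθ : 0 < Real.arccos x := Real.arccos_pos.2 hx1
  have hθ2 : Real.arccos x ≤ Real.pi / 2 := Real.arccos_le_pi_div_two.2 hx0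
  have h := hb.upper _ hθ hθ2
  rw [Real.cos_arccos (by linarith) hx1.le] at h
  have hsin := Real.mul_le_sin hθ.le hθ2
  have hb0 := hb.nonneg x
  have h1 : 2 / Real.pi * Real.arccos x * b x ≤ K * Real.arccos x ^ (-1 - 2 * s) :=
    (mul_le_mul_of_nonneg_right hsin hb0).trans h
  have hpi := Real.pi_pos
  rw [show (-2 - 2 * s) = (-1 - 2 * s) - 1 by ring, Real.rpow_sub_one hθ.ne']
  calc b x = 2 / Real.pi * Real.arccos x * b x * (Real.pi / 2 / Real.arccos x) := by
        field_simp
    _ ≤ K * Real.arccos x ^ (-1 - 2 * s) * (Real.pi / 2 / Real.arccos x) := by gcongr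
    _ = _ := by ring

theorem IsNonCutoffAngular.le_of_le_arccos {s K : ℝ} {b : ℝ → ℝ} (hs : 0 < s) (hK : 1 ≤ K)
    (hb : IsNonCutoffAngular s K b) {δ x : ℝ} (hδ : 0 < δ) (hx : δ ≤ Real.arccos x) :
    b x ≤ Real.pi / 2 * K * δ ^ (-2 - 2 * s) := by
  have hpi := Real.pi_pos
  rcases lt_or_ge x 0 with h | h
  · rw [hb.support x h]
    positivity
  have hx1 : x < 1 := Real.arccos_pos.1 (hδ.trans_le hx)
  refine (hb.le_rpow h hx1).trans ?_
  gcongr ?_ * ?_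
  exact Real.rpow_le_rpow_of_nonpos hδ hx (by linarith)

theorem lintegral_one_sub_rpow_le {s η : ℝ} (hs1 : s < 1) (hη : 0 ≤ η) :
    ∫⁻ c : ℝ, (Set.Ioc (0 : ℝ) η).indicator (fun u => ENNReal.ofReal (u ^ (-s))) (1 - c) =
      ENNReal.ofReal (η ^ (1 - s) / (1 - s)) := by
  rw [lintegral_sub_left_eq_self (fun u => (Set.Ioc (0 : ℝ) η).indicator
    (fun u => ENNReal.ofReal (u ^ (-s))) u) 1, lintegral_indicator measurableSet_Ioc,
    ← ofReal_integral_eq_lintegral_ofReal]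
  · rw [← intervalIntegral.integral_of_le hη, integral_rpow (Or.inl (by linarith)),
      Real.zero_rpow (by linarith), sub_zero, show -s + 1 = 1 - s by ring]
  · exact (intervalIntegrable_iff_integrableOn_Ioc_of_le hη).1
      (intervalIntegral.intervalIntegrable_rpow' (by linarith))
  · filter_upwards [ae_restrict_mem measurableSet_Ioc] with u hu
    exact Real.rpow_nonneg hu.1.le _

theorem IsNonCutoffAngular.le_one_sub_rpow {s K : ℝ} {b : ℝ → ℝ} (hs : 0 < s) (hK : 1 ≤ K)
    (hb : IsNonCutoffAngular s K b) {x : ℝ} (hx0 : 0 ≤ x) (hx1 : x < 1) :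
    b x ≤ Real.pi / 2 * K * ((1 - x) / 2) ^ (-1 - s) := by
  have hpi := Real.pi_pos
  have hθ : 0 < Real.arccos x := Real.arccos_pos.2 hx1
  have h4 := sin_half_arccos_sq (by linarith) hx1.le
  have h5 : (1 - x) / 2 ≤ Real.arccos x ^ 2 := by
    have h6 := sin_half_arccos_nonneg x
    have h7 := Real.sin_le (by linarith : 0 ≤ Real.arccos x / 2)
    nlinarith
  refine (hb.le_rpow hx0 hx1).trans ?_
  gcongr ?_ * ?_
  calc Real.arccos x ^ (-2 - 2 * s) = (Real.arccos x ^ 2) ^ (-1 - s) := by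
        rw [← Real.rpow_natCast_mul hθ.le]
        congr 1
        push_cast
        ring
    _ ≤ _ := Real.rpow_le_rpow_of_nonpos (by linarith) h5 (by linarith)

/-- The second angular moment of the singular part of the kernel near `θ = 0`. -/
theorem IsNonCutoffAngular.moment_le {s K : ℝ} {b : ℝ → ℝ} (hs : 0 < s) (hs1 : s < 1)
    (hK : 1 ≤ K) (hb : IsNonCutoffAngular s K b) {β : ℝ → ℝ} {η : ℝ} (hη : 0 ≤ η)
    (hβ : ∀ x, |β x| ≤ b x) (hsupp : ∀ x, 0 ≤ x → x < 1 → β x ≠ 0 → (1 - x) / 2 ≤ η) :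
    angularMoment β ≤ ENNReal.ofReal (Real.pi / 2 * K * (η ^ (1 - s) / (1 - s))) := by
  have hpi := Real.pi_pos
  rw [ENNReal.ofReal_mul (by positivity), ← lintegral_one_sub_rpow_le hs1 hη, angularMoment,
    ← lintegral_const_mul' _ _ ENNReal.ofReal_ne_top, ← lintegral_indicator measurableSet_Ioo]
  refine lintegral_mono fun c => ?_
  by_cases hc : c ∈ Set.Ioo (0 : ℝ) 1
  swap
  · rw [Set.indicator_of_notMem hc]
    exact zero_le
  rw [Set.indicator_of_mem hc]
  obtain ⟨c0, c1⟩ := hc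
  by_cases h : β (2 * c ^ 2 - 1) = 0
  · rw [h]
    simp
  have hx0 : 0 ≤ 2 * c ^ 2 - 1 := by
    by_contra hneg
    have h1 := hβ (2 * c ^ 2 - 1)
    rw [hb.support _ (not_le.1 hneg)] at h1
    exact h (abs_nonpos_iff.1 h1)
  have hx1 : 2 * c ^ 2 - 1 < 1 := by nlinarith
  have h2 := hsupp _ hx0 hx1 h
  have h3 : 0 < 1 - c ^ 2 := by nlinarith
  -- One has 1 - c ≤ 1 - c² = sin²(θ/2) ≤ η on the support. The integrand is there a multiple of
  -- (1-c²)(1-c²)^(-1-s) = (1-c²)^(-s) ≤ (1-c)^(-s), integrable as s < 1.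
  have hmem : (1 - c) ∈ Set.Ioc 0 η := ⟨by linarith, by nlinarith⟩
  rw [Set.indicator_of_mem hmem, ← ENNReal.ofReal_mul (by positivity)]
  refine ENNReal.ofReal_le_ofReal ?_
  have h6 := hb.le_one_sub_rpow hs hK hx0 hx1
  rw [show (1 - (2 * c ^ 2 - 1)) / 2 = 1 - c ^ 2 by ring] at h6
  calc (1 - c ^ 2) * |β (2 * c ^ 2 - 1)| ≤ (1 - c ^ 2) * b (2 * c ^ 2 - 1) := by
        gcongr; exact hβ _
    _ ≤ (1 - c ^ 2) * (Real.pi / 2 * K * (1 - c ^ 2) ^ (-1 - s)) := by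
        gcongr
    _ = Real.pi / 2 * K * (1 - c ^ 2) ^ (-s) := by
        rw [show -s = (-1 - s) + 1 by ring, Real.rpow_add_one h3.ne']
        ring
    _ ≤ _ := by
        gcongr ?_ * ?_
        exact Real.rpow_le_rpow_of_nonpos (by linarith) (by nlinarith) (by linarith)

/-- The profile is determined on nonnegative radii only, hence the absolute value; continuity is
read off along a line through the origin. -/
theorem IsCutoffProfile.continuous_abs {φ : ℝ → ℝ} (hφ : IsCutoffProfile φ) :
    Continuous fun r : ℝ => φ |r| := by
  have h : (fun r : ℝ => φ |r|) =
      (fun x : Vel => φ ‖x‖) ∘ fun r : ℝ => r • (EuclideanSpace.single 0 1 : Vel) := by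
    funext r
    simp [norm_smul]
  rw [h]
  exact hφ.smooth.continuous.comp (by fun_prop)

theorem measurable_cutoffAngular {φ b : ℝ → ℝ} (hφ : IsCutoffProfile φ) (hb : Measurable b)
    {ε : ℝ} (hε : 0 < ε) : Measurable (cutoffAngular φ b ε) := by
  have h : cutoffAngular φ b ε = fun x => b x * (1 - (fun r : ℝ => φ |r|)
      (Real.sin (Real.arccos x / 2) / ε)) := by
    funext x
    beta_reduce
    rw [cutoffAngular, abs_of_nonneg (div_nonneg (sin_half_arccos_nonneg x) hε.le)]
  rw [h]
  have h1 : Continuous fun x => (fun r : ℝ => φ |r|) (Real.sin (Real.arccos x / 2) / ε) := by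
    have := Real.continuous_arccos
    exact hφ.continuous_abs.comp (by fun_prop)
  exact hb.mul (measurable_const.sub h1.measurable)

theorem measurable_truncAngular {b : ℝ → ℝ} (hb : Measurable b) (δ : ℝ) :
    Measurable (truncAngular b δ) :=
  Measurable.ite (measurableSet_le measurable_const Real.continuous_arccos.measurable) hb
    measurable_const

theorem truncAngular_mem_Icc {s K : ℝ} {b : ℝ → ℝ} (hb : IsNonCutoffAngular s K b) (δ x : ℝ) :
    truncAngular b δ x ∈ Set.Icc 0 (b x) := by
  have := hb.nonneg x
  unfold truncAngular
  split_ifs <;> simp [this]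

theorem cutoffAngular_mem_Icc {s K : ℝ} {φ b : ℝ → ℝ} (hφ : IsCutoffProfile φ)
    (hb : IsNonCutoffAngular s K b) {ε : ℝ} (hε : 0 < ε) (x : ℝ) :
    cutoffAngular φ b ε x ∈ Set.Icc 0 (b x) := by
  have h0 := hb.nonneg x
  have h1 := div_nonneg (sin_half_arccos_nonneg x) hε.le
  have h2 := hφ.nonneg _ h1
  have h3 := hφ.le_one _ h1
  exact ⟨mul_nonneg h0 (by linarith), mul_le_of_le_one_right h0 (by linarith)⟩

theorem sin_half_arccos_le (x : ℝ) : Real.sin (Real.arccos x / 2) ≤ Real.arccos x / 2 :=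
  Real.sin_le (by have := Real.arccos_nonneg x; linarith)

theorem truncAngular_le {s K : ℝ} {b : ℝ → ℝ} (hs : 0 < s) (hK : 1 ≤ K)
    (hb : IsNonCutoffAngular s K b) {δ : ℝ} (hδ : 0 < δ) (x : ℝ) :
    truncAngular b δ x ≤ Real.pi / 2 * K * δ ^ (-2 - 2 * s) := by
  have hpi := Real.pi_pos
  unfold truncAngular
  split_ifs with h
  · exact hb.le_of_le_arccos hs hK hδ h
  · positivity

/-- For θ < ε one has sin(θ/2)/ε < 1/2, where φ = 1 and the cutoff kernel vanishes. -/
theorem cutoffAngular_le {s K : ℝ} {φ b : ℝ → ℝ} (hs : 0 < s) (hK : 1 ≤ K)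
    (hφ : IsCutoffProfile φ) (hb : IsNonCutoffAngular s K b) {ε : ℝ} (hε : 0 < ε) (x : ℝ) :
    cutoffAngular φ b ε x ≤ Real.pi / 2 * K * ε ^ (-2 - 2 * s) := by
  have hpi := Real.pi_pos
  rcases le_or_gt ε (Real.arccos x) with h | h
  · exact (cutoffAngular_mem_Icc hφ hb hε x).2.trans (hb.le_of_le_arccos hs hK hε h)
  · have h1 : Real.sin (Real.arccos x / 2) / ε ≤ 3 / 4 := by
      rw [div_le_iff₀ hε]
      have := sin_half_arccos_le x
      linarith
    rw [cutoffAngular, hφ.eq_one _ (div_nonneg (sin_half_arccos_nonneg x) hε.le) h1, sub_self,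
      mul_zero]
    positivity

theorem abs_sub_le_of_mem_Icc {a b c : ℝ} (ha : a ∈ Set.Icc 0 c) (hb : b ∈ Set.Icc 0 c) :
    |a - b| ≤ c :=
  abs_sub_le_iff.2 ⟨by linarith [ha.2, hb.1], by linarith [hb.2, ha.1]⟩

/-- If sin(θ/2) > 4ε/3, then φ = 0 and θ > ε ≥ δ, so both kernels equal b. The bound does not depend
on δ, which permits δ → 0. -/
theorem moment_truncAngular_sub_cutoffAngular_le {s K : ℝ} {φ b : ℝ → ℝ} (hs : 0 < s)
    (hs1 : s < 1) (hK : 1 ≤ K) (hφ : IsCutoffProfile φ) (hb : IsNonCutoffAngular s K b)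
    {δ ε : ℝ} (hδε : δ ≤ ε) (hε : 0 < ε) :
    angularMoment (fun x => truncAngular b δ x - cutoffAngular φ b ε x) ≤
      ENNReal.ofReal (Real.pi / 2 * K * (((4 / 3 * ε) ^ 2) ^ (1 - s) / (1 - s))) := by
  refine hb.moment_le hs hs1 hK (by positivity) (fun x => abs_sub_le_of_mem_Icc
    (truncAngular_mem_Icc hb δ x) (cutoffAngular_mem_Icc hφ hb hε x)) fun x hx0 hx1 hx => ?_
  rw [← sin_half_arccos_sq (by linarith) hx1.le]
  have h0 := sin_half_arccos_nonneg x
  gcongr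
  by_contra! h
  have h1 : 4 / 3 < Real.sin (Real.arccos x / 2) / ε := by rwa [lt_div_iff₀ hε]
  have h2 : δ ≤ Real.arccos x := by
    have := sin_half_arccos_le x
    linarith
  refine hx ?_
  simp [truncAngular, cutoffAngular, h2, hφ.eq_zero _ h1]

/-- Both truncations equal b as soon as sin(θ/2) > r. -/
theorem moment_truncAngular_sub_truncAngular_le {s K : ℝ} {b : ℝ → ℝ} (hs : 0 < s)
    (hs1 : s < 1) (hK : 1 ≤ K) (hb : IsNonCutoffAngular s K b)
    {δ δ' r : ℝ} (h1 : δ ≤ r) (h2 : δ' ≤ r) (hr : 0 < r) :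
    angularMoment (fun x => truncAngular b δ x - truncAngular b δ' x) ≤
      ENNReal.ofReal (Real.pi / 2 * K * ((r ^ 2) ^ (1 - s) / (1 - s))) := by
  refine hb.moment_le hs hs1 hK (by positivity) (fun x => abs_sub_le_of_mem_Icc
    (truncAngular_mem_Icc hb δ x) (truncAngular_mem_Icc hb δ' x)) fun x hx0 hx1 hx => ?_
  rw [← sin_half_arccos_sq (by linarith) hx1.le]
  have h0 := sin_half_arccos_nonneg x
  gcongr
  by_contra! h
  have h3 := sin_half_arccos_le x
  have h4 := Real.arccos_nonneg x
  refine hx ?_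
  simp [truncAngular, (by linarith : δ ≤ Real.arccos x), (by linarith : δ' ≤ Real.arccos x)]

/-! ### The estimate for almost everywhere classes, in the norms of the statement -/

theorem ae_comp_postVStar {p : Vel → Prop} (h : ∀ᵐ v, p v) :
    ∀ᵐ q ∂tripleMeasure, p (postVStar q.1 q.2.1 q.2.2) :=
  ae_carleman (P := fun q => p q.1) (Measure.quasiMeasurePreserving_fst.ae h)

/-- In Carleman variables v' = w + (y + q), a translation of the first variable by a function of the
others; such a translation preserves null sets. -/
theorem ae_comp_postV {p : Vel → Prop} (h : ∀ᵐ v, p v) :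
    ∀ᵐ q ∂tripleMeasure, p (postV q.1 q.2.1 q.2.2) := by
  have hs : Measurable fun q : Vel × S2 => q.1 + carlemanShift q :=
    measurable_fst.add measurable_carlemanShift
  have h1 : ∀ᵐ q ∂tripleMeasure, p (q.1 + (q.2.1 + carlemanShift q.2)) :=
    (measurePreserving_shift hs).quasiMeasurePreserving.ae
      (p := fun q : Vel × Vel × S2 => p q.1) (Measure.quasiMeasurePreserving_fst.ae h)
  filter_upwards [ae_carleman h1, ae_ne, ae_carleman_pos] with q hq hq1 hq2
  obtain ⟨v, w, σ⟩ := q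
  obtain ⟨_, _, _, e4, _, _⟩ := carleman_spec hq1 hq2
  rw [← add_assoc, ← e4] at hq
  exact hq

theorem pairingIntegrand_congr (γ : ℝ) (β : ℝ → ℝ) {g h f g' h' f' : Vel → ℝ}
    (hg : g =ᵐ[volume] g') (hh : h =ᵐ[volume] h') (hf : f =ᵐ[volume] f') :
    pairingIntegrand γ β g h f =ᵐ[tripleMeasure] pairingIntegrand γ β g' h' f' := by
  have g2 : ∀ᵐ q ∂tripleMeasure, g q.2.1 = g' q.2.1 :=
    Measure.quasiMeasurePreserving_snd.ae
      (p := fun q : Vel × S2 => g q.1 = g' q.1) (Measure.quasiMeasurePreserving_fst.ae hg)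
  have h2 : ∀ᵐ q ∂tripleMeasure, h q.1 = h' q.1 := Measure.quasiMeasurePreserving_fst.ae hh
  have f2 : ∀ᵐ q ∂tripleMeasure, f q.1 = f' q.1 := Measure.quasiMeasurePreserving_fst.ae hf
  filter_upwards [ae_comp_postVStar hg, ae_comp_postV hh, g2, h2, f2] with q e1 e2 e3 e4 e5
  simp only [pairingIntegrand, collisionIntegrand, sqrtMaxwellianMul, e1, e2, e3, e4, e5]

theorem aemeasurable_of_weighted {l : ℝ} {f : Vel → ℝ}
    (hf : AEStronglyMeasurable (weighted l f) volume) : AEMeasurable f volume := by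
  have h : f = fun v => japaneseBracket v ^ (-l) * weighted l f v :=
    funext fun v => (weighted_neg_weighted l f v).symm
  rw [h]
  have := measurable_japaneseBracket
  exact (by fun_prop : Measurable fun v => japaneseBracket v ^ (-l)).aemeasurable.mul
    hf.aemeasurable

theorem weighted_congr (l : ℝ) {f f' : Vel → ℝ} (h : f =ᵐ[volume] f') :
    weighted l f =ᵐ[volume] weighted l f' := by
  filter_upwards [h] with v hv
  rw [weighted, weighted, hv]

theorem weighted_zero (f : Vel → ℝ) : weighted 0 f = f := by
  funext v
  simp [weighted]

/-- The trilinear estimate with the weighted norms of the statement. -/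
theorem exists_abs_integral_pairingIntegrand_le {γ : ℝ} (hγ : -3 < γ) : ∃ C : ℝ, 0 < C ∧
    ∀ β : ℝ → ℝ, Measurable β → (∀ x, x < 0 → β x = 0) → (∃ B : ℝ, ∀ x, |β x| ≤ B) →
    ∀ m : ℝ, 0 ≤ m → angularMoment β ≤ ENNReal.ofReal m →
    ∀ g h f : Vel → ℝ, MemL2 0 g → MemSobolevWeighted 2 (γ / 2 + 2) h → MemL2 (γ / 2) f →
      Integrable (pairingIntegrand γ β g h f) tripleMeasure ∧
      |∫ x, pairingIntegrand γ β g h f x ∂tripleMeasure| ≤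
        C * m * (normL2 0 g * normH 2 (γ / 2 + 2) h * normL2 (γ / 2) f) := by
  obtain ⟨C, hC, hle⟩ := exists_pairingIntegrand_le hγ
  -- The functions are only almost everywhere measurable; they are replaced below by measurable
  -- representatives, which changes neither the norms nor the triple integral. The summand 1 makes
  -- the constant positive.
  refine ⟨C.toReal + 1, by positivity, fun β hβ h0 hB m hm hmβ g h f hg hh hf => ?_⟩
  have hhF : MemLp (fun v => (weighted (γ / 2 + 2) h v : ℂ)) 2 (volume : Measure Vel) := by
    by_contra hcon
    simp [MemSobolevWeighted, sobolevENorm, hcon] at hh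
  have hA : sobolevENorm 2 (γ / 2 + 2) h ≠ ⊤ := hh.ne
  have mh : AEMeasurable h volume := by
    refine aemeasurable_of_weighted (l := γ / 2 + 2) ?_
    have := Complex.continuous_re.comp_aestronglyMeasurable hhF.1
    simpa using this
  have mg := aemeasurable_of_weighted hg.1
  have mf := aemeasurable_of_weighted hf.1
  have wh := weighted_congr (γ / 2 + 2) mh.ae_eq_mk
  have wh' : (fun v => (weighted (γ / 2 + 2) h v : ℂ)) =ᵐ[volume]
      fun v => (weighted (γ / 2 + 2) (mh.mk h) v : ℂ) := by
    filter_upwards [wh] with v hv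
    rw [hv]
  have hk := hhF.ae_eq wh'
  have eg : l2norm (fun x => ‖mg.mk g x‖ₑ) = eLpNorm (weighted 0 g) 2 volume := by
    rw [← eLpNorm_two_eq_l2norm, weighted_zero]
    exact eLpNorm_congr_ae mg.ae_eq_mk.symm
  have ef : l2norm (fun x => ‖weighted (γ / 2) (mf.mk f) x‖ₑ) =
      eLpNorm (weighted (γ / 2) f) 2 volume := by
    rw [← eLpNorm_two_eq_l2norm]
    exact eLpNorm_congr_ae (weighted_congr _ mf.ae_eq_mk).symm
  obtain ⟨hint, hest⟩ := hle β hβ h0 hB (mg.mk g) (mh.mk h) (mf.mk f) mg.measurable_mk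
    mh.measurable_mk mf.measurable_mk (by rw [eg]; exact hg.eLpNorm_ne_top)
    (by rw [ef]; exact hf.eLpNorm_ne_top) hk (sobolevENorm 2 (γ / 2 + 2) h) hA (by
      rw [sobolevENorm, dif_pos hhF, MemLp.toLp_congr hhF hk wh'])
  have hcongr := pairingIntegrand_congr γ β mg.ae_eq_mk mh.ae_eq_mk mf.ae_eq_mk
  refine ⟨hint.congr hcongr.symm, ?_⟩
  rw [integral_congr_ae hcongr]
  rw [eg, ef] at hest
  have h1 : ENNReal.ofReal |∫ x, pairingIntegrand γ β (mg.mk g) (mh.mk h) (mf.mk f) x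
      ∂tripleMeasure| ≤ ENNReal.ofReal ((C.toReal + 1) * m *
        (normL2 0 g * normH 2 (γ / 2 + 2) h * normL2 (γ / 2) f)) := by
    rw [← Real.norm_eq_abs, ofReal_norm]
    refine hest.trans ?_
    rw [ENNReal.ofReal_mul (by positivity), ENNReal.ofReal_mul (by positivity),
      ENNReal.ofReal_mul (by unfold normL2 normH; positivity),
      ENNReal.ofReal_mul (by unfold normL2; positivity), normL2, normL2, normH,
      ENNReal.ofReal_toReal hg.eLpNorm_ne_top, ENNReal.ofReal_toReal hf.eLpNorm_ne_top,
      ENNReal.ofReal_toReal hA, mul_right_comm (eLpNorm _ _ _)]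
    gcongr
    rw [ENNReal.ofReal_add ENNReal.toReal_nonneg zero_le_one, ENNReal.ofReal_toReal hC]
    exact le_self_add
  exact (ENNReal.ofReal_le_ofReal_iff (by unfold normL2 normH; positivity)).1 h1

theorem pairing_gammaOp {γ : ℝ} {β : ℝ → ℝ} {g h f : Vel → ℝ}
    (hi : Integrable (pairingIntegrand γ β g h f) tripleMeasure) :
    pairing (gammaOp γ β g h) f = ∫ x, pairingIntegrand γ β g h f x ∂tripleMeasure := by
  rw [integral_prod _ hi, pairing]
  refine integral_congr_ae ?_
  filter_upwards [hi.prod_right_ae] with v hv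
  rw [integral_prod _ hv]
  simp only [pairingIntegrand, gammaOp, collisionQ, integral_mul_const, integral_const_mul]

theorem pairingIntegrand_sub (γ : ℝ) (β β' : ℝ → ℝ) (g h f : Vel → ℝ) (x : Vel × Vel × S2) :
    pairingIntegrand γ (fun y => β y - β' y) g h f x =
      pairingIntegrand γ β g h f x - pairingIntegrand γ β' g h f x := by
  simp only [pairingIntegrand, collisionIntegrand]
  ring

/-- An angular function of the class for which the collision operator is defined by an absolutely
convergent integral. -/
structure IsBoundedAngular (β : ℝ → ℝ) : Prop where
  measurable : Measurable β
  support : ∀ x, x < 0 → β x = 0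
  bounded : ∃ B : ℝ, ∀ x, |β x| ≤ B

theorem IsBoundedAngular.sub {β β' : ℝ → ℝ} (h : IsBoundedAngular β) (h' : IsBoundedAngular β') :
    IsBoundedAngular fun x => β x - β' x := by
  obtain ⟨B, hB⟩ := h.bounded
  obtain ⟨B', hB'⟩ := h'.bounded
  refine ⟨h.measurable.sub h'.measurable, fun x hx => ?_, B + B', fun x => ?_⟩
  · rw [h.support x hx, h'.support x hx, sub_zero]
  · exact (abs_sub _ _).trans (add_le_add (hB x) (hB' x))

theorem isBoundedAngular_truncAngular {s K : ℝ} {b : ℝ → ℝ} (hs : 0 < s) (hK : 1 ≤ K)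
    (hb : IsNonCutoffAngular s K b) {δ : ℝ} (hδ : 0 < δ) : IsBoundedAngular (truncAngular b δ) where
  measurable := measurable_truncAngular hb.measurable δ
  support x hx := by simp [truncAngular, hb.support x hx]
  bounded := ⟨_, fun x => by
    rw [abs_of_nonneg (truncAngular_mem_Icc hb δ x).1]
    exact truncAngular_le hs hK hb hδ x⟩

theorem isBoundedAngular_cutoffAngular {s K : ℝ} {φ b : ℝ → ℝ} (hs : 0 < s) (hK : 1 ≤ K)
    (hφ : IsCutoffProfile φ) (hb : IsNonCutoffAngular s K b) {ε : ℝ} (hε : 0 < ε) :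
    IsBoundedAngular (cutoffAngular φ b ε) where
  measurable := measurable_cutoffAngular hφ hb.measurable hε
  support x hx := by simp [cutoffAngular, hb.support x hx]
  bounded := ⟨_, fun x => by
    rw [abs_of_nonneg (cutoffAngular_mem_Icc hφ hb hε x).1]
    exact cutoffAngular_le hs hK hφ hb hε x⟩

/-- The comparison of two collision operators by the second angular moment of the difference of
their angular functions. -/
theorem exists_abs_pairing_sub_le {γ : ℝ} (hγ : -3 < γ) : ∃ C : ℝ, 0 < C ∧
    ∀ β β' : ℝ → ℝ, IsBoundedAngular β → IsBoundedAngular β' →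
    ∀ m : ℝ, 0 ≤ m → angularMoment (fun x => β x - β' x) ≤ ENNReal.ofReal m →
    ∀ g h f : Vel → ℝ, MemL2 0 g → MemSobolevWeighted 2 (γ / 2 + 2) h → MemL2 (γ / 2) f →
      |pairing (gammaOp γ β g h) f - pairing (gammaOp γ β' g h) f| ≤
        C * m * (normL2 0 g * normH 2 (γ / 2 + 2) h * normL2 (γ / 2) f) := by
  obtain ⟨C, hC, hle⟩ := exists_abs_integral_pairingIntegrand_le hγ
  refine ⟨C, hC, fun β β' hβ hβ' m hm hmβ g h f hg hh hf => ?_⟩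
  have hi (β : ℝ → ℝ) (hβ : IsBoundedAngular β) :
      Integrable (pairingIntegrand γ β g h f) tripleMeasure := by
    obtain ⟨B, hB⟩ := hβ.bounded
    have hM := angularMoment_ne_top hB
    exact (hle β hβ.measurable hβ.support hβ.bounded (angularMoment β).toReal
      ENNReal.toReal_nonneg (ENNReal.ofReal_toReal hM).ge g h f hg hh hf).1
  rw [pairing_gammaOp (hi β hβ), pairing_gammaOp (hi β' hβ'), ← integral_sub (hi β hβ) (hi β' hβ')]
  have hd := hβ.sub hβ'
  have := (hle _ hd.measurable hd.support hd.bounded m hm hmβ g h f hg hh hf).2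
  simpa only [pairingIntegrand_sub] using this

theorem gammaPairingAbsConv {γ : ℝ} (hγ : -3 < γ) {β : ℝ → ℝ} (hβ : IsBoundedAngular β)
    {g h f : Vel → ℝ} (hg : MemL2 0 g) (hh : MemSobolevWeighted 2 (γ / 2 + 2) h)
    (hf : MemL2 (γ / 2) f) : GammaPairingAbsConv γ β g h f := by
  obtain ⟨C, hC, hle⟩ := exists_abs_integral_pairingIntegrand_le hγ
  obtain ⟨B, hB⟩ := hβ.bounded
  have hM := angularMoment_ne_top hB
  exact (hle β hβ.measurable hβ.support hβ.bounded (angularMoment β).toReal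
    ENNReal.toReal_nonneg (ENNReal.ofReal_toReal hM).ge g h f hg hh hf).1

/-! ### The weak principal value and the error estimate -/

/-- Cauchy's criterion: the pairings for two truncations with δ, δ' ≤ r differ by at most a multiple
of r^(2-2s). -/
theorem tendsto_gammaForm {γ s K : ℝ} (hγ : -3 < γ) (hs : 0 < s) (hs1 : s < 1) (hK : 1 ≤ K)
    {b : ℝ → ℝ} (hb : IsNonCutoffAngular s K b) {g h f : Vel → ℝ} (hg : MemL2 0 g)
    (hh : MemSobolevWeighted 2 (γ / 2 + 2) h) (hf : MemL2 (γ / 2) f) :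
    Tendsto (fun δ => pairing (gammaTrunc γ b δ g h) f) (𝓝[>] (0 : ℝ))
      (𝓝 (gammaForm γ b g h f)) := by
  obtain ⟨C, hC, hle⟩ := exists_abs_pairing_sub_le hγ
  refine tendsto_nhds_limUnder (cauchy_map_iff_exists_tendsto.1 ?_)
  rw [Metric.cauchy_iff]
  refine ⟨inferInstance, fun e he => ?_⟩
  set Q := normL2 0 g * normH 2 (γ / 2 + 2) h * normL2 (γ / 2) f
  have hpi := Real.pi_pos
  set F : ℝ → ℝ := fun r => C * (Real.pi / 2 * K * ((r ^ 2) ^ (1 - s) / (1 - s))) * Q with hF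
  have hcont : Tendsto F (𝓝[>] 0) (𝓝 0) := by
    have hc : Continuous F := by
      have h1 : Continuous fun r : ℝ => (r ^ 2) ^ (1 - s) :=
        (continuous_pow 2).rpow_const fun _ => Or.inr (by linarith)
      fun_prop
    have h0 : F 0 = 0 := by
      simp [hF, Real.zero_rpow (by linarith : (1 - s) ≠ 0)]
    have := hc.tendsto 0
    rw [h0] at this
    exact this.mono_left nhdsWithin_le_nhds
  obtain ⟨r, hr1, hr⟩ := ((hcont.eventually (gt_mem_nhds he)).and self_mem_nhdsWithin).exists
  have hr0 : 0 < r := hr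
  refine ⟨(fun δ => pairing (gammaTrunc γ b δ g h) f) '' Set.Ioc 0 r,
    image_mem_map (Ioc_mem_nhdsGT hr0), ?_⟩
  rintro _ ⟨δ, hδ, rfl⟩ _ ⟨δ', hδ', rfl⟩
  rw [Real.dist_eq]
  refine lt_of_le_of_lt ?_ hr1
  refine hle _ _ (isBoundedAngular_truncAngular hs hK hb hδ.1)
    (isBoundedAngular_truncAngular hs hK hb hδ'.1) _ ?_
    (moment_truncAngular_sub_truncAngular_le hs hs1 hK hb hδ.2 hδ'.2 hr0) g h f hg hh hf
  have : 0 < 1 - s := by linarith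
  positivity

theorem exists_abs_gammaForm_sub_le {γ s K : ℝ} (hγ : -3 < γ) (hs : 0 < s) (hs1 : s < 1)
    (hK : 1 ≤ K) : ∃ C : ℝ, 0 < C ∧ ∀ φ b : ℝ → ℝ, IsCutoffProfile φ → IsNonCutoffAngular s K b →
      ∀ ε : ℝ, 0 < ε → ∀ g h f : Vel → ℝ,
        MemL2 0 g → MemSobolevWeighted 2 (γ / 2 + 2) h → MemL2 (γ / 2) f →
          |gammaForm γ b g h f - pairing (gammaCutoff γ φ b ε g h) f| ≤
            C * ε ^ (2 - 2 * s) * normL2 0 g * normH 2 (γ / 2 + 2) h * normL2 (γ / 2) f := by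
  obtain ⟨C, hC, hle⟩ := exists_abs_pairing_sub_le hγ
  have hpi := Real.pi_pos
  have hs2 : 0 < 1 - s := by linarith
  refine ⟨C * (Real.pi / 2 * K * ((4 / 3) ^ (2 - 2 * s) / (1 - s))), by positivity,
    fun φ b hφ hb ε hε g h f hg hh hf => ?_⟩
  have hlim := ((tendsto_gammaForm hγ hs hs1 hK hb hg hh hf).sub_const
    (pairing (gammaCutoff γ φ b ε g h) f)).abs
  refine le_of_tendsto hlim ?_
  filter_upwards [Ioc_mem_nhdsGT hε] with δ hδ
  refine (hle _ _ (isBoundedAngular_truncAngular hs hK hb hδ.1)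
    (isBoundedAngular_cutoffAngular hs hK hφ hb hε) _ (by positivity)
    (moment_truncAngular_sub_cutoffAngular_le hs hs1 hK hφ hb hδ.2 hε) g h f hg hh hf).trans
    (le_of_eq ?_)
  -- The power of ε arises as ((4ε/3)²)^(1-s) = (4/3)^(2-2s) ε^(2-2s).
  rw [← Real.rpow_natCast_mul (by positivity), Real.mul_rpow (by norm_num) hε.le]
  have e : ((2 : ℕ) : ℝ) * (1 - s) = 2 - 2 * s := by push_cast; ring
  rw [e]
  ring

/-! ### The pointwise principal value for Schwartz functions -/

theorem HasSecondOrderBound.mono {φ A B : ℝ → ℝ} {P : ℝ} (hP : 0 ≤ P)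
    (h : HasSecondOrderBound φ A P) (hAB : ∀ t, A t ≤ B t) : HasSecondOrderBound φ B P := by
  obtain ⟨φ', φ'', h1, h2, h3, h4⟩ := h
  refine ⟨φ', φ'', h1, h2, h3, fun t => ?_⟩
  obtain ⟨b0, b1, b2⟩ := h4 t
  have := hAB t
  exact ⟨b0.trans this, b1.trans (by gcongr), b2.trans (by gcongr)⟩

theorem HasSecondOrderBound.abs_sub_le {φ : ℝ → ℝ} {A P : ℝ}
    (h : HasSecondOrderBound φ (fun _ => A) P) : |φ 1 - φ 0| ≤ A * P := by
  obtain ⟨φ', φ'', h1, h2, h3, h4⟩ := h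
  have := norm_image_sub_le_of_norm_deriv_le_segment' (f := φ) (f' := φ') (C := A * P)
    (a := 0) (b := 1) (fun t _ => (h1 t).hasDerivWithinAt) (fun t _ => (h4 t).2.1) 1 (by simp)
  simpa using this

theorem exists_hasSecondOrderBound_schwartz (g : 𝓢(Vel, ℝ)) : ∃ A : ℝ, 0 ≤ A ∧ ∀ x p : Vel,
    HasSecondOrderBound (fun t => g (x + t • p)) (fun _ => A) ‖p‖ := by
  set χ : 𝓢(Vel, ℂ) := g.postcompCLM Complex.ofRealCLM with hχ
  have hre : ∀ x, (χ x).re = g x := fun x => by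
    rw [hχ, SchwartzMap.postcompCLM_apply]
    simp
  have hb (ψ : 𝓢(Vel, ℂ)) : ∃ A : ℝ, ∀ x, ‖ψ x‖ ≤ A := ⟨_, ψ.norm_le_seminorm ℝ⟩
  choose A hA using hb
  have hA0 (ψ : 𝓢(Vel, ℂ)) : 0 ≤ A ψ := (norm_nonneg _).trans (hA ψ 0)
  refine ⟨A χ + ∑ i, A (coordDeriv i χ) + ∑ i, ∑ j, A (coordDeriv i (coordDeriv j χ)),
    add_nonneg (add_nonneg (hA0 _) (Finset.sum_nonneg fun _ _ => hA0 _))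
      (Finset.sum_nonneg fun _ _ => Finset.sum_nonneg fun _ _ => hA0 _), fun x p => ?_⟩
  have h := hasSecondOrderBound_re χ x p
  simp_rw [hre] at h
  refine h.mono (norm_nonneg p) fun t => ?_
  unfold secondOrderSize
  gcongr
  · exact hA _ _
  · exact hA _ _
  · exact hA _ _

/-- The rotation by the angle `π` of the sphere around the direction of the relative velocity. -/
def postRotation (v w : Vel) (σ : S2) : S2 := sphereMap (ℝ ∙ (v - w)).reflection σ

theorem coe_postRotation (v w : Vel) (σ : S2) : (postRotation v w σ : Vel) =
    (2 : ℝ) • (inner ℝ (v - w) (σ : Vel) / ‖v - w‖ ^ 2) • (v - w) - (σ : Vel) :=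
  coe_axisRotation (v - w, σ)

theorem measurePreserving_postRotation (v w : Vel) :
    MeasurePreserving (postRotation v w) sphereMeasure sphereMeasure :=
  measurePreserving_sphereMap _

theorem cosDev_postRotation (v w : Vel) (σ : S2) :
    cosDev v w (postRotation v w σ) = cosDev v w σ := by
  unfold cosDev
  congr 1
  exact inner_axisRotation (v - w, σ)

theorem cosDev_le_one (v w : Vel) (σ : S2) : cosDev v w σ ≤ 1 := cosAngle_le_one (v - w, σ)

/-- The cancellation of the first-order terms in the average over the azimuthal angle. -/
theorem exists_post_second_difference_le (g h : 𝓢(Vel, ℝ)) : ∃ C : ℝ, 0 ≤ C ∧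
    ∀ (v w : Vel) (σ : S2), v ≠ w →
      |(g (postVStar v w σ) * h (postV v w σ) - g w * h v) +
        (g (postVStar v w (postRotation v w σ)) * h (postV v w (postRotation v w σ)) - g w * h v)| ≤
      C * (‖v - w‖ + ‖v - w‖ ^ 2) * (1 - cosDev v w σ) := by
  obtain ⟨A, hA, hg⟩ := exists_hasSecondOrderBound_schwartz g
  obtain ⟨B, hB, hh⟩ := exists_hasSecondOrderBound_schwartz h
  refine ⟨4 * (A * B), by positivity, fun v w σ hvw => ?_⟩
  set z := v - w with hz
  have hz0 : 0 < ‖z‖ := norm_pos_iff.2 (sub_ne_zero.2 hvw)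
  set c := cosDev v w σ with hc
  have hc1 : c ≤ 1 := cosDev_le_one v w σ
  have hin : inner ℝ z (σ : Vel) = c * ‖z‖ := by
    rw [hc, cosDev, ← hz]
    field_simp
  -- Decomposition v' = v + m + p and v'_* = w - m - p, where m is parallel to z with |m| = |z|(1 -
  -- cos θ)/2, and p is orthogonal to z with |p|² ≤ |z|²(1 - cos θ)/2. The half turn about z
  -- reverses p and keeps m.
  set m : Vel := ((c - 1) / 2) • z with hm
  set p : Vel := (1 / 2 : ℝ) • (‖z‖ • (σ : Vel) - c • z) with hp
  have hσ : ‖z‖ • (postRotation v w σ : Vel) = (2 * c) • z - ‖z‖ • (σ : Vel) := by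
    rw [coe_postRotation, ← hz, hin, smul_sub, smul_smul, smul_smul]
    congr 2
    field_simp
  have e1 : postV v w σ = v + m + p := by
    rw [postV, ← hz, hm, hp, show w = v - z by rw [hz]; abel]
    module
  have e2 : postVStar v w σ = w - m - p := by
    rw [postVStar, ← hz, hm, hp, show v = w + z by rw [hz]; abel]
    module
  have hhalf (σ : S2) : (‖z‖ / 2) • (σ : Vel) = (1 / 2 : ℝ) • (‖z‖ • (σ : Vel)) := by
    rw [smul_smul]; ring_nf
  have e3 : postV v w (postRotation v w σ) = v + m - p := by
    rw [postV, ← hz, hhalf, hσ, hm, hp, show w = v - z by rw [hz]; abel]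
    module
  have e4 : postVStar v w (postRotation v w σ) = w - m + p := by
    rw [postVStar, ← hz, hhalf, hσ, hm, hp, show v = w + z by rw [hz]; abel]
    module
  have hnm : ‖m‖ = (1 - c) / 2 * ‖z‖ := by
    rw [hm, norm_smul, Real.norm_eq_abs, abs_of_nonpos (by linarith)]
    ring
  have hnp : ‖p‖ ^ 2 ≤ ‖z‖ ^ 2 * ((1 - c) / 2) := by
    have h1 : ‖‖z‖ • (σ : Vel) - c • z‖ ^ 2 = ‖z‖ ^ 2 * (1 - c ^ 2) := by
      rw [norm_sub_sq_real, norm_smul, norm_smul, norm_sphere, real_inner_smul_left,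
        real_inner_smul_right, real_inner_comm, hin]
      simp only [Real.norm_eq_abs, mul_pow, sq_abs]
      ring
    rw [hp, norm_smul, mul_pow, h1, Real.norm_eq_abs, sq_abs]
    nlinarith [mul_nonneg (sq_nonneg ‖z‖) (sq_nonneg (1 - c))]
  -- `s1` is a second difference in p at the points displaced by m, hence of order |p|². `s2` is a
  -- first difference in m, hence of order |m|. Both are O(1 - cos θ).
  have s1 := ((hg (w - m) (-p)).mul (norm_nonneg _) (by
    have := hh (v + m) p
    rwa [← norm_neg p] at this)).abs_second_difference_le (by fun_prop)
  have s2 := ((hg w (-m)).mul (norm_nonneg _) (by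
    have := hh v m
    rwa [← norm_neg m] at this)).abs_sub_le
  simp only [one_smul, neg_smul, zero_smul, add_zero, ← sub_eq_add_neg, smul_neg, sub_neg_eq_add,
    intervalIntegral.integral_const, norm_neg, sub_zero] at s1 s2
  rw [e1, e2, e3, e4]
  rw [smul_eq_mul, show (1 + 1 : ℝ) = 2 by norm_num] at s1
  rw [hnm] at s2
  have hAB : 0 ≤ A * B := by positivity
  have s3 : 2 * (4 * (A * B) * ‖p‖ ^ 2) ≤ 2 * (4 * (A * B) * (‖z‖ ^ 2 * ((1 - c) / 2))) := by
    gcongr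
  rw [abs_le] at s1 s2 ⊢
  constructor <;> nlinarith [s1.1, s1.2, s2.1, s2.2]

/-- The difference `g'_* h' - g_* h`. -/
def postDiff (g h : Vel → ℝ) (v w : Vel) (σ : S2) : ℝ :=
  g (postVStar v w σ) * h (postV v w σ) - g w * h v

/-- The average of `g'_* h' - g_* h` over a half turn around the relative velocity. -/
def postDiffSymm (g h : Vel → ℝ) (v w : Vel) (σ : S2) : ℝ :=
  (postDiff g h v w σ + postDiff g h v w (postRotation v w σ)) / 2

theorem gammaOp_eq (γ : ℝ) (β : ℝ → ℝ) (g h : Vel → ℝ) (v : Vel) :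
    gammaOp γ β g h v = ∫ w : Vel, ∫ σ : S2, ‖v - w‖ ^ γ * β (cosDev v w σ) *
      Real.sqrt (maxwellian w) * postDiff g h v w σ ∂sphereMeasure := by
  simp only [gammaOp, collisionQ, ← integral_const_mul, inv_mul_collisionIntegrand, postDiff]

theorem measurable_postDiff {g h : Vel → ℝ} (hg : Measurable g) (hh : Measurable h) :
    Measurable fun q : Vel × Vel × S2 => postDiff g h q.1 q.2.1 q.2.2 :=
  ((hg.comp measurable_postVStar).mul (hh.comp measurable_postV)).sub
    ((hg.comp (measurable_fst.comp measurable_snd)).mul (hh.comp measurable_fst))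

theorem measurable_gammaIntegrand (γ : ℝ) {β : ℝ → ℝ} (hβ : Measurable β) {g h : Vel → ℝ}
    (hg : Measurable g) (hh : Measurable h) :
    Measurable fun q : Vel × Vel × S2 => ‖q.1 - q.2.1‖ ^ γ * β (cosDev q.1 q.2.1 q.2.2) *
      Real.sqrt (maxwellian q.2.1) * postDiff g h q.1 q.2.1 q.2.2 := by
  have h1 := measurable_postDiff hg hh
  have h2 := hβ.comp measurable_cosDev
  have h3 := measurable_maxwellian
  have h4 : Measurable fun q : Vel × Vel × S2 => ‖q.1 - q.2.1‖ ^ γ := by fun_prop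
  have h5 : Measurable fun q : Vel × Vel × S2 => Real.sqrt (maxwellian q.2.1) := by fun_prop
  exact ((h4.mul h2).mul h5).mul h1

theorem measurable_gammaOp (γ : ℝ) {β : ℝ → ℝ} (hβ : Measurable β) {g h : Vel → ℝ}
    (hg : Measurable g) (hh : Measurable h) : Measurable (gammaOp γ β g h) := by
  have h1 := (measurable_gammaIntegrand γ hβ hg hh).comp
    (f := fun q : (Vel × Vel) × S2 => (q.1.1, q.1.2, q.2)) (by fun_prop)
  have h2 := (h1.stronglyMeasurable.integral_prod_right' (ν := sphereMeasure)).integral_prod_right'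
    (ν := (volume : Measure Vel))
  have : gammaOp γ β g h = _ := funext (gammaOp_eq γ β g h)
  rw [this]
  exact h2.measurable

theorem exists_abs_postDiff_le (g h : 𝓢(Vel, ℝ)) : ∃ C : ℝ, ∀ v w σ,
    |postDiff g h v w σ| ≤ C := by
  have hg (x : Vel) := g.norm_le_seminorm ℝ x
  have hh (x : Vel) := h.norm_le_seminorm ℝ x
  set A := SchwartzMap.seminorm ℝ 0 0 g * SchwartzMap.seminorm ℝ 0 0 h
  refine ⟨A + A, fun v w σ => (abs_sub _ _).trans (add_le_add ?_ ?_)⟩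
  · rw [abs_mul]
    exact mul_le_mul (hg _) (hh _) (abs_nonneg _) (apply_nonneg _ _)
  · rw [abs_mul]
    exact mul_le_mul (hg _) (hh _) (abs_nonneg _) (apply_nonneg _ _)

theorem integrable_mul_postDiff {β : ℝ → ℝ} (hβ : IsBoundedAngular β) (g h : 𝓢(Vel, ℝ))
    (v w : Vel) : Integrable (fun σ => β (cosDev v w σ) * postDiff g h v w σ) sphereMeasure := by
  obtain ⟨C, hC⟩ := exists_abs_postDiff_le g h
  obtain ⟨B, hB⟩ := hβ.bounded
  have hm : Measurable fun σ : S2 => β (cosDev v w σ) * postDiff g h v w σ :=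
    ((hβ.measurable.comp measurable_cosDev).mul (measurable_postDiff g.continuous.measurable
      h.continuous.measurable)).comp (f := fun σ : S2 => (v, w, σ)) (by fun_prop)
  refine Integrable.of_bound hm.aestronglyMeasurable (B * C) (ae_of_all _ fun σ => ?_)
  rw [norm_mul]
  exact mul_le_mul (hB _) (hC v w σ) (norm_nonneg _) ((abs_nonneg _).trans (hB 0))

/-- The half turn preserves the surface measure and cos θ, so the difference may be averaged with
its rotated copy; after this the singularity of b becomes integrable. -/
theorem integral_mul_postDiff {β : ℝ → ℝ} (hβ : IsBoundedAngular β) (g h : 𝓢(Vel, ℝ))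
    (v w : Vel) : ∫ σ, β (cosDev v w σ) * postDiff g h v w σ ∂sphereMeasure =
      ∫ σ, β (cosDev v w σ) * postDiffSymm g h v w σ ∂sphereMeasure := by
  have h1 := integrable_mul_postDiff hβ g h v w
  have h2 := (measurePreserving_postRotation v w).integrable_comp_of_integrable h1
  have h3 : ∫ σ, (fun σ => β (cosDev v w σ) * postDiff g h v w σ) (postRotation v w σ)
      ∂sphereMeasure = ∫ σ, β (cosDev v w σ) * postDiff g h v w σ ∂sphereMeasure := by
    have hmp := measurePreserving_postRotation v w
    conv_rhs => rw [← hmp.map_eq]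
    rw [integral_map hmp.measurable.aemeasurable (by rw [hmp.map_eq]; exact h1.1)]
  simp only [Function.comp_def, cosDev_postRotation] at h2 h3
  have h4 : ∀ σ, β (cosDev v w σ) * postDiffSymm g h v w σ =
      (β (cosDev v w σ) * postDiff g h v w σ +
        β (cosDev v w σ) * postDiff g h v w (postRotation v w σ)) * (1 / 2) := fun σ => by
    unfold postDiffSymm; ring
  simp_rw [h4]
  rw [integral_mul_const, integral_add h1 h2, h3]
  ring

theorem exists_integrable_mul_one_sub_cosDev {s K : ℝ} (hs : 0 < s) (hs1 : s < 1) (hK : 1 ≤ K)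
    {b : ℝ → ℝ} (hb : IsNonCutoffAngular s K b) : ∃ M : ℝ, 0 ≤ M ∧ ∀ v w : Vel, v ≠ w →
      Integrable (fun σ => b (cosDev v w σ) * (1 - cosDev v w σ)) sphereMeasure ∧
      ∫ σ, b (cosDev v w σ) * (1 - cosDev v w σ) ∂sphereMeasure ≤ M := by
  have hpi := Real.pi_pos
  have hbm := hb.measurable
  set A : ℝ := Real.pi / 2 * K * 2 ^ (1 + s) with hA
  have hA0 : 0 ≤ A := by positivity
  have h0 (v w : Vel) (σ : S2) : 0 ≤ b (cosDev v w σ) * (1 - cosDev v w σ) :=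
    mul_nonneg (hb.nonneg _) (sub_nonneg.2 (cosDev_le_one v w σ))
  have hle : ∀ x ∈ Set.Ioo (-1 : ℝ) 1, ENNReal.ofReal (b x * (1 - x)) ≤ ENNReal.ofReal A *
      (Set.Ioc (0 : ℝ) 1).indicator (fun u => ENNReal.ofReal (u ^ (-s))) (1 - x) := by
    intro x hx
    rcases lt_or_ge x 0 with hx0 | hx0
    · simp [hb.support x hx0]
    have hu : 0 < 1 - x := by linarith [hx.2]
    rw [Set.indicator_of_mem (Set.mem_Ioc.2 ⟨hu, by linarith⟩), ← ENNReal.ofReal_mul hA0]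
    refine ENNReal.ofReal_le_ofReal ?_
    calc b x * (1 - x) ≤ Real.pi / 2 * K * ((1 - x) / 2) ^ (-1 - s) * (1 - x) := by
          gcongr
          exact hb.le_one_sub_rpow hs hK hx0 hx.2
      _ = A * (1 - x) ^ (-s) := by
          rw [Real.div_rpow hu.le (by norm_num), show (-1 - s : ℝ) = -(1 + s) by ring,
            Real.rpow_neg (by norm_num : (0 : ℝ) ≤ 2), div_inv_eq_mul,
            show -s = -(1 + s) + 1 by ring, Real.rpow_add hu, Real.rpow_one, hA]
          ring
  have hL : ∀ v w : Vel, v ≠ w →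
      ∫⁻ σ, ENNReal.ofReal (b (cosDev v w σ) * (1 - cosDev v w σ)) ∂sphereMeasure ≤
        ENNReal.ofReal (2 * Real.pi * (A * (1 ^ (1 - s) / (1 - s)))) := by
    intro v w hvw
    have h1 := lintegral_cosAngle (F := fun x => ENNReal.ofReal (b x * (1 - x))) (by fun_prop)
      (sub_ne_zero.2 hvw)
    refine h1.le.trans ?_
    rw [ENNReal.ofReal_mul (p := 2 * Real.pi) (by positivity), ENNReal.ofReal_mul hA0,
      ← lintegral_one_sub_rpow_le hs1 zero_le_one]
    gcongr
    refine (setLIntegral_mono' measurableSet_Ioo hle).trans ?_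
    rw [lintegral_const_mul' _ _ ENNReal.ofReal_ne_top]
    gcongr
    exact Measure.restrict_le_self
  have hs2 : 0 < 1 - s := by linarith
  refine ⟨_, (by positivity : 0 ≤ 2 * Real.pi * (A * (1 ^ (1 - s) / (1 - s)))), fun v w hvw => ?_⟩
  have hm : Measurable fun σ : S2 => b (cosDev v w σ) * (1 - cosDev v w σ) :=
    (((hbm.comp measurable_cosDev).mul (measurable_const.sub measurable_cosDev))).comp
      (f := fun σ : S2 => (v, w, σ)) (by fun_prop)
  refine ⟨⟨hm.aestronglyMeasurable, ?_⟩, ?_⟩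
  · rw [hasFiniteIntegral_iff_ofReal (ae_of_all _ (h0 v w))]
    exact (hL v w hvw).trans_lt ENNReal.ofReal_lt_top
  · rw [integral_eq_lintegral_of_nonneg_ae (ae_of_all _ (h0 v w)) hm.aestronglyMeasurable]
    exact ENNReal.toReal_le_of_le_ofReal (by positivity) (hL v w hvw)

theorem exists_abs_postDiffSymm_le (g h : 𝓢(Vel, ℝ)) : ∃ C : ℝ, 0 ≤ C ∧
    ∀ (v w : Vel) (σ : S2), v ≠ w →
      |postDiffSymm g h v w σ| ≤ C * (‖v - w‖ + ‖v - w‖ ^ 2) * (1 - cosDev v w σ) := by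
  obtain ⟨C, hC, hle⟩ := exists_post_second_difference_le g h
  refine ⟨C / 2, by positivity, fun v w σ hvw => ?_⟩
  rw [postDiffSymm, abs_div, abs_two]
  unfold postDiff
  have := hle v w σ hvw
  linarith

/-- The limit and a uniform bound of the integrals over the sphere. -/
theorem exists_tendsto_integral_truncAngular {s K : ℝ} (hs : 0 < s) (hs1 : s < 1) (hK : 1 ≤ K)
    {b : ℝ → ℝ} (hb : IsNonCutoffAngular s K b) (g h : 𝓢(Vel, ℝ)) : ∃ C : ℝ, 0 ≤ C ∧
    ∀ v w : Vel, v ≠ w →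
      (∃ L, Tendsto (fun δ => ∫ σ, truncAngular b δ (cosDev v w σ) * postDiff g h v w σ
        ∂sphereMeasure) (𝓝[>] 0) (𝓝 L)) ∧
      ∀ δ > 0, |∫ σ, truncAngular b δ (cosDev v w σ) * postDiff g h v w σ ∂sphereMeasure| ≤
        C * (‖v - w‖ + ‖v - w‖ ^ 2) := by
  obtain ⟨M, hM, hint⟩ := exists_integrable_mul_one_sub_cosDev hs hs1 hK hb
  obtain ⟨C, hC, hle⟩ := exists_abs_postDiffSymm_le g h
  refine ⟨C * M, by positivity, fun v w hvw => ?_⟩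
  obtain ⟨hi, hiM⟩ := hint v w hvw
  set Z := ‖v - w‖ + ‖v - w‖ ^ 2 with hZ
  have hZ0 : 0 ≤ Z := by positivity
  have hbd (δ : ℝ) (σ : S2) : ‖truncAngular b δ (cosDev v w σ) * postDiffSymm g h v w σ‖ ≤
      C * Z * (b (cosDev v w σ) * (1 - cosDev v w σ)) := by
    obtain ⟨h1, h2⟩ := truncAngular_mem_Icc hb δ (cosDev v w σ)
    rw [norm_mul, Real.norm_of_nonneg h1]
    calc _ ≤ b (cosDev v w σ) * (C * Z * (1 - cosDev v w σ)) :=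
          mul_le_mul h2 (hle v w σ hvw) (abs_nonneg _) (hb.nonneg _)
      _ = _ := by ring
  have hev : ∀ δ ∈ Set.Ioi (0 : ℝ),
      ∫ σ, truncAngular b δ (cosDev v w σ) * postDiffSymm g h v w σ ∂sphereMeasure =
      ∫ σ, truncAngular b δ (cosDev v w σ) * postDiff g h v w σ ∂sphereMeasure := fun δ hδ =>
    (integral_mul_postDiff (isBoundedAngular_truncAngular hs hK hb hδ) g h v w).symm
  have hms : Measurable fun σ => postDiffSymm g h v w σ := by
    have h1 := (measurable_postDiff g.continuous.measurable
      h.continuous.measurable).comp (f := fun σ : S2 => (v, w, σ)) (by fun_prop)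
    exact (h1.add (h1.comp (measurePreserving_postRotation v w).measurable)).div_const 2
  have hmc : Measurable fun σ => cosDev v w σ :=
    measurable_cosDev.comp (f := fun σ : S2 => (v, w, σ)) (by fun_prop)
  refine ⟨⟨∫ σ, b (cosDev v w σ) * postDiffSymm g h v w σ ∂sphereMeasure, ?_⟩, fun δ hδ => ?_⟩
  · refine (tendsto_congr' (eventually_of_mem self_mem_nhdsWithin hev)).1 ?_
    refine tendsto_integral_filter_of_dominated_convergence
      (fun σ => C * Z * (b (cosDev v w σ) * (1 - cosDev v w σ))) ?_ ?_ (hi.const_mul _) ?_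
    · exact Eventually.of_forall fun δ =>
        (((measurable_truncAngular hb.measurable δ).comp hmc).mul hms).aestronglyMeasurable
    · exact Eventually.of_forall fun δ => ae_of_all _ (hbd δ)
    · refine ae_of_all _ fun σ => tendsto_const_nhds.congr' ?_
      rcases (cosDev_le_one v w σ).lt_or_eq with hc | hc
      · filter_upwards [Ioc_mem_nhdsGT (Real.arccos_pos.2 hc)] with δ hδ
        rw [truncAngular, if_pos hδ.2]
      -- At θ = 0 the truncations vanish for every δ > 0 and need not tend to b(1), but the averaged
      -- difference is zero there.
      · have h0 : postDiffSymm g h v w σ = 0 := by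
          have := hle v w σ hvw
          rw [hc, sub_self, mul_zero] at this
          exact abs_nonpos_iff.1 this
        simp [h0]
  · rw [← hev δ hδ, ← Real.norm_eq_abs]
    refine (norm_integral_le_of_norm_le (hi.const_mul (C * Z)) (ae_of_all _ (hbd δ))).trans ?_
    rw [integral_const_mul]
    calc C * Z * _ ≤ C * Z * M := by gcongr
      _ = _ := by ring

theorem ae_ne_left (v : Vel) : ∀ᵐ w : Vel, v ≠ w := by
  have := measure_singleton (μ := (volume : Measure Vel)) v
  filter_upwards [compl_mem_ae_iff.2 this] with w hw using fun h => hw h.symm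

theorem integral_gammaIntegrand (γ : ℝ) (β : ℝ → ℝ) (g h : Vel → ℝ) (v w : Vel) :
    ∫ σ : S2, ‖v - w‖ ^ γ * β (cosDev v w σ) * Real.sqrt (maxwellian w) * postDiff g h v w σ
      ∂sphereMeasure = ‖v - w‖ ^ γ * Real.sqrt (maxwellian w) *
        ∫ σ : S2, β (cosDev v w σ) * postDiff g h v w σ ∂sphereMeasure := by
  rw [← integral_const_mul]
  congr with σ
  ring

/-- The weight that dominates the collision integrals of Schwartz functions. -/
def collisionWeight (γ : ℝ) (v : Vel) : ℝ :=
  japaneseBracket v ^ (γ + 1) + japaneseBracket v ^ (γ + 2)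

theorem exists_integrable_rpow_gaussian {a : ℝ} (ha : -3 < a) : ∃ C : ℝ, 0 ≤ C ∧ ∀ v : Vel,
    Integrable (fun w : Vel => ‖v - w‖ ^ a * Real.exp (-‖w‖ ^ 2 / 8)) ∧
    ∫ w : Vel, ‖v - w‖ ^ a * Real.exp (-‖w‖ ^ 2 / 8) ≤ C * japaneseBracket v ^ a := by
  obtain ⟨C, hC, hle⟩ := exists_lintegral_rpow_gaussian_le ha
  refine ⟨C.toReal, ENNReal.toReal_nonneg, fun v => ?_⟩
  have hj : 0 < japaneseBracket v := by unfold japaneseBracket; positivity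
  have h0 (w : Vel) : 0 ≤ ‖v - w‖ ^ a * Real.exp (-‖w‖ ^ 2 / 8) := by positivity
  have hm : Measurable fun w : Vel => ‖v - w‖ ^ a * Real.exp (-‖w‖ ^ 2 / 8) := by fun_prop
  have hL : ∫⁻ w : Vel, ENNReal.ofReal (‖v - w‖ ^ a * Real.exp (-‖w‖ ^ 2 / 8)) ≤
      ENNReal.ofReal (C.toReal * japaneseBracket v ^ a) := by
    rw [mul_comm, ENNReal.ofReal_mul (by positivity), ENNReal.ofReal_toReal hC]
    refine le_trans (le_of_eq ?_) (mul_le_mul_right (hle v) _)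
    rw [← lintegral_const_mul' _ _ ENNReal.ofReal_ne_top]
    congr with w
    rw [← ENNReal.ofReal_mul (by positivity), Real.rpow_neg hj.le]
    congr 1
    field_simp
  refine ⟨⟨hm.aestronglyMeasurable, ?_⟩, ?_⟩
  · rw [hasFiniteIntegral_iff_ofReal (ae_of_all _ h0)]
    exact hL.trans_lt ENNReal.ofReal_lt_top
  · rw [integral_eq_lintegral_of_nonneg_ae (ae_of_all _ h0) hm.aestronglyMeasurable]
    exact ENNReal.toReal_le_of_le_ofReal (by positivity) hL

/-- For Schwartz functions the principal value exists at every point, with a uniform bound. -/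
theorem exists_tendsto_gammaTrunc {γ s K : ℝ} (hγ : -3 < γ) (hs : 0 < s) (hs1 : s < 1)
    (hK : 1 ≤ K) {b : ℝ → ℝ} (hb : IsNonCutoffAngular s K b) (g h : 𝓢(Vel, ℝ)) : ∃ C : ℝ,
    ∀ v : Vel,
      Tendsto (fun δ => gammaTrunc γ b δ g h v) (𝓝[>] 0) (𝓝 (gammaNonCutoff γ b g h v)) ∧
      ∀ δ > 0, |gammaTrunc γ b δ g h v| ≤ C * collisionWeight γ v := by
  obtain ⟨A, hA, hlim⟩ := exists_tendsto_integral_truncAngular hs hs1 hK hb g h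
  obtain ⟨C₁, hC₁, h₁⟩ := exists_integrable_rpow_gaussian (a := γ + 1) (by linarith)
  obtain ⟨C₂, hC₂, h₂⟩ := exists_integrable_rpow_gaussian (a := γ + 2) (by linarith)
  refine ⟨A * (C₁ + C₂), fun v => ?_⟩
  obtain ⟨i₁, l₁⟩ := h₁ v
  obtain ⟨i₂, l₂⟩ := h₂ v
  -- The factor |v-w| + |v-w|² of the spherical integral turns |v-w|^γ into the exponents γ + 1 and
  -- γ + 2.
  set D : Vel → ℝ := fun w => A * (‖v - w‖ ^ (γ + 1) * Real.exp (-‖w‖ ^ 2 / 8) +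
    ‖v - w‖ ^ (γ + 2) * Real.exp (-‖w‖ ^ 2 / 8)) with hD
  have iD : Integrable D := (i₁.add i₂).const_mul A
  have hbd : ∀ δ > 0, ∀ w, v ≠ w → ‖∫ σ : S2, ‖v - w‖ ^ γ * truncAngular b δ (cosDev v w σ) *
      Real.sqrt (maxwellian w) * postDiff g h v w σ ∂sphereMeasure‖ ≤ D w := by
    intro δ hδ w hvw
    have hz : 0 < ‖v - w‖ := norm_pos_iff.2 (sub_ne_zero.2 hvw)
    rw [integral_gammaIntegrand, norm_mul, Real.norm_of_nonneg (by positivity), Real.norm_eq_abs]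
    calc _ ≤ ‖v - w‖ ^ γ * Real.exp (-‖w‖ ^ 2 / 8) * (A * (‖v - w‖ + ‖v - w‖ ^ 2)) := by
          gcongr
          · exact sqrt_maxwellian_le w
          · exact (hlim v w hvw).2 δ hδ
      _ = D w := by
          simp only [hD]
          rw [Real.rpow_add hz, Real.rpow_add hz, Real.rpow_one, Real.rpow_two]
          ring
  constructor
  · refine tendsto_nhds_limUnder ?_
    have hex : ∀ w, ∃ L, v ≠ w → Tendsto (fun δ => ∫ σ, truncAngular b δ (cosDev v w σ) *
        postDiff g h v w σ ∂sphereMeasure) (𝓝[>] 0) (𝓝 L) := fun w => by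
      by_cases hvw : v = w
      · exact ⟨0, fun h => (h hvw).elim⟩
      · obtain ⟨L, hL⟩ := (hlim v w hvw).1
        exact ⟨L, fun _ => hL⟩
    choose L hL using hex
    refine ⟨∫ w, ‖v - w‖ ^ γ * Real.sqrt (maxwellian w) * L w, ?_⟩
    simp_rw [gammaTrunc, gammaOp_eq]
    refine tendsto_integral_filter_of_dominated_convergence D ?_ ?_ iD ?_
    · refine Eventually.of_forall fun δ => ?_
      have h1 := (measurable_gammaIntegrand γ (measurable_truncAngular hb.measurable δ)
        g.continuous.measurable h.continuous.measurable).comp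
        (f := fun q : Vel × S2 => (v, q.1, q.2)) (by fun_prop)
      exact (h1.stronglyMeasurable.integral_prod_right' (ν := sphereMeasure)).aestronglyMeasurable
    · filter_upwards [self_mem_nhdsWithin] with δ hδ
      filter_upwards [ae_ne_left v] with w hw using hbd δ hδ w hw
    · filter_upwards [ae_ne_left v] with w hw
      simp_rw [integral_gammaIntegrand]
      exact (hL w hw).const_mul _
  · intro δ hδ
    rw [gammaTrunc, gammaOp_eq, ← Real.norm_eq_abs]
    refine (norm_integral_le_of_norm_le iD ?_).trans ?_
    · filter_upwards [ae_ne_left v] with w hw using hbd δ hδ w hw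
    · rw [integral_const_mul, integral_add i₁ i₂, collisionWeight, mul_assoc]
      gcongr
      have e₁ : 0 ≤ japaneseBracket v ^ (γ + 1) := by unfold japaneseBracket; positivity
      have e₂ : 0 ≤ japaneseBracket v ^ (γ + 2) := by unfold japaneseBracket; positivity
      nlinarith [mul_nonneg hC₁ e₂, mul_nonneg hC₂ e₁]

theorem integrable_japaneseBracket_rpow_mul (r : ℝ) (f : 𝓢(Vel, ℝ)) :
    Integrable fun v => japaneseBracket v ^ r * f v := by
  have hg : (fun x : Vel => (1 + ‖x‖ ^ 2) ^ (r / 2)).HasTemperateGrowth := by fun_prop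
  have := (SchwartzMap.smulLeftCLM ℝ (fun x : Vel => (1 + ‖x‖ ^ 2) ^ (r / 2)) f).integrable
    (μ := volume)
  refine this.congr (ae_of_all _ fun v => ?_)
  simp only [SchwartzMap.smulLeftCLM_apply_apply hg, smul_eq_mul, japaneseBracket_rpow_eq]

/-- The truncated operators are bounded by a fixed weight of polynomial growth uniformly in δ, and f
decays rapidly; dominated convergence in v then identifies the weak limit with the pairing of the
pointwise limit. -/
theorem gammaForm_schwartz {γ s K : ℝ} (hγ : -3 < γ) (hs : 0 < s) (hs1 : s < 1)
    (hK : 1 ≤ K) {b : ℝ → ℝ} (hb : IsNonCutoffAngular s K b) (g h f : 𝓢(Vel, ℝ)) :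
    (∀ v : Vel, Tendsto (fun δ => gammaTrunc γ b δ g h v) (𝓝[>] (0 : ℝ))
      (𝓝 (gammaNonCutoff γ b g h v))) ∧
    Integrable (fun v => gammaNonCutoff γ b g h v * f v) ∧
    gammaForm γ b g h f = pairing (gammaNonCutoff γ b g h) f := by
  obtain ⟨C, hC⟩ := exists_tendsto_gammaTrunc hγ hs hs1 hK hb g h
  have hmeas (δ : ℝ) : Measurable (gammaTrunc γ b δ g h) :=
    measurable_gammaOp γ (measurable_truncAngular hb.measurable δ) g.continuous.measurable
      h.continuous.measurable
  have hmN : AEStronglyMeasurable (gammaNonCutoff γ b g h) volume :=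
    aestronglyMeasurable_of_tendsto_ae (𝓝[>] (0 : ℝ)) (fun δ => (hmeas δ).aestronglyMeasurable)
      (ae_of_all _ fun v => (hC v).1)
  have iW : Integrable fun v => C * (collisionWeight γ v * ‖f v‖) := by
    refine Integrable.const_mul ?_ C
    refine ((integrable_japaneseBracket_rpow_mul (γ + 1) f).norm.add
      (integrable_japaneseBracket_rpow_mul (γ + 2) f).norm).congr (ae_of_all _ fun v => ?_)
    have e (r : ℝ) : 0 ≤ japaneseBracket v ^ r := by unfold japaneseBracket; positivity
    simp only [Pi.add_apply, norm_mul, Real.norm_of_nonneg (e _), collisionWeight, add_mul]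
  have hle : ∀ v, ‖gammaNonCutoff γ b g h v * f v‖ ≤ C * (collisionWeight γ v * ‖f v‖) := by
    intro v
    rw [norm_mul, ← mul_assoc]
    gcongr
    refine le_of_tendsto (hC v).1.norm ?_
    filter_upwards [self_mem_nhdsWithin] with δ hδ using (hC v).2 δ hδ
  refine ⟨fun v => (hC v).1, iW.mono' (hmN.mul f.continuous.aestronglyMeasurable)
    (ae_of_all _ hle), Tendsto.limUnder_eq ?_⟩
  refine tendsto_integral_filter_of_dominated_convergence _ ?_ ?_ iW ?_
  · exact Eventually.of_forall fun δ =>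
      ((hmeas δ).mul f.continuous.measurable).aestronglyMeasurable
  · filter_upwards [self_mem_nhdsWithin] with δ hδ
    refine ae_of_all _ fun v => ?_
    rw [norm_mul, ← mul_assoc]
    gcongr
    exact (hC v).2 δ hδ
  · exact ae_of_all _ fun v => (hC v).1.mul_const _

end

theorem lemma4 (γ s K : ℝ) (hγ : -3 < γ) (hs : 0 < s) (hs1 : s < 1) (hK : 1 ≤ K)
    (φ : ℝ → ℝ) (hφ : IsCutoffProfile φ) :
    ∃ C : ℝ, 0 < C ∧ ∀ b : ℝ → ℝ, IsNonCutoffAngular s K b →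
      -- the estimate, for all functions with finite norms; both pairings exist
      (∀ ε : ℝ, 0 < ε → ε ≤ Real.sqrt 2 / 2 → ∀ g h f : Vel → ℝ,
        MemL2 0 g → MemSobolevWeighted 2 (γ / 2 + 2) h → MemL2 (γ / 2) f →
          GammaPairingAbsConv γ (cutoffAngular φ b ε) g h f ∧
          (∀ δ : ℝ, 0 < δ → GammaPairingAbsConv γ (truncAngular b δ) g h f) ∧
          Tendsto (fun δ => pairing (gammaTrunc γ b δ g h) f) (𝓝[>] (0 : ℝ))
            (𝓝 (gammaForm γ b g h f)) ∧
          |gammaForm γ b g h f - pairing (gammaCutoff γ φ b ε g h) f| ≤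
            C * ε ^ (2 - 2 * s) * normL2 0 g * normH 2 (γ / 2 + 2) h * normL2 (γ / 2) f) ∧
      -- for Schwartz functions the operator exists pointwise and the form is its pairing with `f`
      (∀ g h f : 𝓢(Vel, ℝ),
        (∀ v : Vel, Tendsto (fun δ => gammaTrunc γ b δ g h v) (𝓝[>] (0 : ℝ))
          (𝓝 (gammaNonCutoff γ b g h v))) ∧
        Integrable (fun v => gammaNonCutoff γ b g h v * f v) ∧
        gammaForm γ b g h f = pairing (gammaNonCutoff γ b g h) f) := by
  obtain ⟨C, hC, hle⟩ := exists_abs_gammaForm_sub_le hγ hs hs1 hK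
  refine ⟨C, hC, fun b hb => ⟨fun ε hε _ g h f hg hh hf => ⟨?_, fun δ hδ => ?_, ?_, ?_⟩,
    fun g h f => gammaForm_schwartz hγ hs hs1 hK hb g h f⟩⟩
  · exact gammaPairingAbsConv hγ (isBoundedAngular_cutoffAngular hs hK hφ hb hε) hg hh hf
  · exact gammaPairingAbsConv hγ (isBoundedAngular_truncAngular hs hK hb hδ) hg hh hf
  · exact tendsto_gammaForm hγ hs hs1 hK hb hg hh hf
  · exact hle φ b hφ hb ε hε g h f hg hh hf
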